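/- Let $V,W:\mathbb R\to\mathbb R$ be analytic at $0$ with $V(0)=V'(0)=W(0)=W'(0)=0$, $v_2=V''(0)>0$, $\phi_2=W''(0)>0$, and consider the periodic chain $H=\sum_{m=1}^N[\frac12p_m^2+V(x_m)+W(x_{m+1}-x_m)]$ with $N$ even. Put $\omega_{q,0}^2=v_2+4\phi_2\sin^2(q/2)$, so that $\omega_{\pi,0}^2=v_2+4\phi_2$, and $\tilde V=V/\omega_{\pi,0}^2$, $\tilde W=W/\omega_{\pi,0}^2$, $\beta_1=4\phi_2/\omega_{\pi,0}^2$. *Out-of-phase mode.* Let $x_m=Q_0+(-1)^mQ_\pi$, where $Q_0(y,\tau)$, $Q_\pi(y,\tau)$, $\tilde T(y)$ is a family that is smooth in $(y,\tau)$ for $|y|<\rho$, $2\pi$-periodic and even in $\tau$, and solves $$\ddot Q_0+\tfrac{\tilde T^2}{2}[\tilde V'(Q_0+Q_\pi)+\tilde V'(Q_0-Q_\pi)]=0,\qquad \ddot Q_\pi+\tilde T^2\{\tfrac12[\tilde V'(Q_0+Q_\pi)-\tilde V'(Q_0-Q_\pi)]+\tilde W'(2Q_\pi)-\tilde W'(-2Q_\pi)\}=0,$$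 with $Q_\pi=y\cos\tau+o(y)$, $Q_0=o(y)$, $\tilde T(0)=1$ (here $\tau=\omega_\pi t$ and $\omega_\pi=\omega_{\pi,0}/\tilde T(y)$). Let $\varepsilon(y)$ be its energy per site. Assume that the mode is isochronous up to order $n\ge1$: $\omega_\pi^2=\omega_{\pi,0}^2+\gamma_{\pi,n}\varepsilon^n+o(\varepsilon^n)$ as $\varepsilon\to0$, with $\gamma_{\pi,n}\neq0$. Let $\tilde T_{2n}$ be the coefficient of $y^{2n}$ in the Taylor expansion of $\tilde T$ at $0$. *Variational system.* For $0\le\delta\le4$, with $\tilde V''_\pm=\tilde V''(Q_0\pm Q_\pi)$ and $\tilde W''_\pm=\tilde W''(\pm2Q_\pi)$, let $$\mathcal T_1=\tfrac{\tilde T^2}2[\tilde V''_++\tilde V''_-+(4-\delta)(\tilde W''_++\tilde W''_-)],\quad \mathcal T_2=\tfrac{\tilde T^2}2[\tilde V''_+-\tilde V''_-],$$ $$\mathcal T_3=\tilde T^2\sqrt{\delta(1-\delta/4)}\,[\tilde W''_+-\tilde W''_-],\quad \mathcal T_4=\tfrac{\tilde T^2}2[\tilde V''_++\tilde V''_-+\delta(\tilde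 W''_++\tilde W''_-)],$$ and consider the system $$\ddot r_\pi+\mathcal T_1r_\pi+\mathcal T_2r_0-\mathcal T_3j_0=0,\quad \ddot j_\pi+\mathcal T_1j_\pi+\mathcal T_2j_0+\mathcal T_3r_0=0,$$ $$\ddot r_0+\mathcal T_4r_0+\mathcal T_2r_\pi+\mathcal T_3j_\pi=0,\quad \ddot j_0+\mathcal T_4j_0+\mathcal T_2j_\pi-\mathcal T_3r_\pi=0.$$ For $\delta=4\sin^2(\pi/N)$ it governs the perturbations of the mode with wave numbers $q_c=\pi-2\pi/N$ and $q_c+\pi$. Call the system stable if all its solutions are bounded for $\tau\ge0$, and unstable otherwise. *Theorem.* 1. As $y\to0^+$, $\tilde T(y)=1+\tilde T_{2n}y^{2n}+o(y^{2n})$, and $\gamma_{\pi,n}=-2\omega_{\pi,0}^2(2/\omega_{\pi,0}^2)^n\tilde T_{2n}$. 2. (Second transition curve.) There are $y_1,\delta_1>0$ and a function $\delta_s$ with $$\delta_s(y)=-\frac{16n\tilde T_{2n}}{\beta_1}y^{2n}+o(y^{2n})\qquad(y\to0^+)$$ such that for $0<y<y_1$ and $0\le\delta<\delta_1$ the system has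 a nontrivial $2\pi$-periodic time-reversal symmetric (even) solution if and only if $\delta=\delta_s(y)$; moreover, for $0<\delta<\delta_1$, it is unstable if $\delta<\delta_s(y)$ and stable if $\delta>\delta_s(y)$. 3. (Bifurcation energy density.) If $\gamma_{\pi,n}>0$, there are $y_1>0$, $N_0$ and numbers $\varepsilon_N>0$ such that for every even $N\ge N_0$, with $\delta=4\sin^2(\pi/N)$: the value $\varepsilon_N$ is attained by $\varepsilon$ on $(0,y_1)$, and for $0<y<y_1$ the system has a nontrivial $2\pi$-periodic even solution if and only if $\varepsilon(y)=\varepsilon_N$, is stable if $\varepsilon(y)<\varepsilon_N$, and unstable if $\varepsilon(y)>\varepsilon_N$. As $N\to\infty$ through even integers, $\varepsilon_N/\varepsilon_\pi^{(n)}\to1$, where $$\varepsilon_\pi^{(n)}=\Bigl(\frac{\omega_{\pi,0}^2-\omega_{q_c,0}^2}{2n\gamma_{\pi,n}}\Bigr)^{1/n}=\Bigl(\frac{2\phi_2\sin^2(\pi/N)}{n\gamma_{\pi,n}}\Bigr)^{1/n}=\frac{\omega_{\pi,0}^2}2\Bigl(\frac{-\phi_2\sin^2(\pi/N)}{n\,\omega_{\pi,0}^2\tilde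 T_{2n}}\Bigr)^{1/n}.$$ 4. If $\gamma_{\pi,n}<0$, there are $y_1>0$ and $N_0$ such that for every even $N\ge N_0$, $\delta=4\sin^2(\pi/N)$ and $0<y<y_1$, the system is stable and has no nontrivial $2\pi$-periodic even solution. -/

import Mathlib

open Set Filter Topology Asymptotics
open scoped ContDiff

noncomputable section

namespace OutOfPhaseMode

/-- An onsite or interaction potential: expandable in a power series around its nondegenerate
minimum `x = 0`, with `U(x) = u₂ x² / 2 + u₃ x³ / 3 + ⋯` and `u₂ > 0`. -/
structure IsPotential (U : ℝ → ℝ) : Prop where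
  analyticAt : AnalyticAt ℝ U 0
  zero : U 0 = 0
  deriv_zero : deriv U 0 = 0
  pos : 0 < iteratedDeriv 2 U 0

/-- The harmonic coefficient `u₂` of `U(x) = u₂ x² / 2 + u₃ x³ / 3 + ⋯`
(`v₂` for the onsite potential, `φ₂` for the interaction potential). -/
def harmonicCoeff (U : ℝ → ℝ) : ℝ := iteratedDeriv 2 U 0

/-- The squared linear frequency `ω²_{q,0} = v₂ + 4 φ₂ sin²(q / 2)`. -/
def linFreqSq (V W : ℝ → ℝ) (q : ℝ) : ℝ :=
  harmonicCoeff V + 4 * harmonicCoeff W * Real.sin (q / 2) ^ 2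

/-- The squared linear frequency `ω²_{π,0} = v₂ + 4 φ₂` of the out-of-phase mode. -/
def omegaSq (V W : ℝ → ℝ) : ℝ := harmonicCoeff V + 4 * harmonicCoeff W

/-- The dimensionless onsite potential `Ṽ = V / (v₂ + 4 φ₂)`. -/
def Vt (V W : ℝ → ℝ) (x : ℝ) : ℝ := V x / omegaSq V W

/-- The dimensionless interaction potential `W̃ = W / (v₂ + 4 φ₂)`. -/
def Wt (V W : ℝ → ℝ) (x : ℝ) : ℝ := W x / omegaSq V W

/-- The coefficient `β₁ = 4 φ₂ / (v₂ + 4 φ₂)` of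
`W̃(x) = β₁ / 2 * (x / 2)² + β₂ / 3 * (x / 2)³ + ⋯`. -/
def beta₁ (V W : ℝ → ℝ) : ℝ := 4 * harmonicCoeff W / omegaSq V W

/-- The nonlinear out-of-phase mode `x_m = Q₀ + (-1)^m Qπ` at small amplitude: a smooth family,
parametrised by the amplitude `y ∈ (-ρ, ρ)`, of `2π`-periodic time-reversal symmetric solutions
`(Q₀ y, Qπ y)` of the dimensionless equations of motion (in the time `τ = ω(y) t`, with
dimensionless period `T y`), which continues the linear out-of-phase mode:
`Qπ = y cos τ + o(y)`, `Q₀ = o(y)`, `T = 1 + o(1)`. -/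
structure IsMode (V W : ℝ → ℝ) (Q₀ Qπ : ℝ → ℝ → ℝ) (T : ℝ → ℝ) (ρ : ℝ) : Prop where
  radius_pos : 0 < ρ
  smooth_Q₀ : ContDiffOn ℝ ∞ (fun p : ℝ × ℝ => Q₀ p.1 p.2) (Ioo (-ρ) ρ ×ˢ univ)
  smooth_Qπ : ContDiffOn ℝ ∞ (fun p : ℝ × ℝ => Qπ p.1 p.2) (Ioo (-ρ) ρ ×ˢ univ)
  smooth_T : ContDiffOn ℝ ∞ T (Ioo (-ρ) ρ)
  motion_Q₀ : ∀ y ∈ Ioo (-ρ) ρ, ∀ τ : ℝ,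
    iteratedDeriv 2 (Q₀ y) τ + T y ^ 2 / 2 *
      (deriv (Vt V W) (Q₀ y τ + Qπ y τ) + deriv (Vt V W) (Q₀ y τ - Qπ y τ)) = 0
  motion_Qπ : ∀ y ∈ Ioo (-ρ) ρ, ∀ τ : ℝ,
    iteratedDeriv 2 (Qπ y) τ + T y ^ 2 *
      ((1 / 2) * (deriv (Vt V W) (Q₀ y τ + Qπ y τ) - deriv (Vt V W) (Q₀ y τ - Qπ y τ))
        + deriv (Wt V W) (2 * Qπ y τ) - deriv (Wt V W) (-2 * Qπ y τ)) = 0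
  periodic_Q₀ : ∀ y ∈ Ioo (-ρ) ρ, Function.Periodic (Q₀ y) (2 * Real.pi)
  periodic_Qπ : ∀ y ∈ Ioo (-ρ) ρ, Function.Periodic (Qπ y) (2 * Real.pi)
  even_Q₀ : ∀ y ∈ Ioo (-ρ) ρ, Function.Even (Q₀ y)
  even_Qπ : ∀ y ∈ Ioo (-ρ) ρ, Function.Even (Qπ y)
  order_zero_Q₀ : ∀ τ, Q₀ 0 τ = 0
  order_zero_Qπ : ∀ τ, Qπ 0 τ = 0
  order_zero_T : T 0 = 1
  order_one_Q₀ : ∀ τ, deriv (fun y => Q₀ y τ) 0 = 0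
  order_one_Qπ : ∀ τ, deriv (fun y => Qπ y τ) 0 = Real.cos τ

/-- The squared frequency `ω_π² = (v₂ + 4 φ₂) / T̃(y)²` of the mode of amplitude `y`. -/
def freqSq (V W : ℝ → ℝ) (T : ℝ → ℝ) (y : ℝ) : ℝ := omegaSq V W / T y ^ 2

/-- The energy density (energy per site) of the mode of amplitude `y`; derivatives with respect
to `t` are `ω(y)` times derivatives with respect to `τ`. The energy is conserved, and it is
evaluated at `τ = 0`. -/
def energyDensity (V W : ℝ → ℝ) (Q₀ Qπ : ℝ → ℝ → ℝ) (T : ℝ → ℝ) (y : ℝ) : ℝ :=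
  (1 / 2) * (freqSq V W T y * (deriv (Q₀ y) 0 ^ 2 + deriv (Qπ y) 0 ^ 2)
    + V (Q₀ y 0 + Qπ y 0) + V (Q₀ y 0 - Qπ y 0) + W (2 * Qπ y 0) + W (-2 * Qπ y 0))

/-- The mode is isochronous up to order `n ≥ 1`: in terms of the energy density `ε`,
`ω_π² = ω²_{π,0} + γ εⁿ + o(εⁿ)` as `ε → 0`, with `γ ≠ 0`. -/
structure IsochronousUpTo (V W : ℝ → ℝ) (Q₀ Qπ : ℝ → ℝ → ℝ) (T : ℝ → ℝ) (n : ℕ) (γ : ℝ) :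
    Prop where
  order_pos : 1 ≤ n
  coeff_ne_zero : γ ≠ 0
  expansion :
    (fun y => freqSq V W T y - omegaSq V W - γ * energyDensity V W Q₀ Qπ T y ^ n)
      =o[𝓝[>] 0] (fun y => energyDensity V W Q₀ Qπ T y ^ n)

/-- The coefficient `T̃_{2n}` of `y^{2n}` in the expansion of the dimensionless period. -/
def periodCoeff (T : ℝ → ℝ) (n : ℕ) : ℝ :=
  iteratedDeriv (2 * n) T 0 / (Nat.factorial (2 * n) : ℝ)

/-! The coefficients of the variational system around the mode of amplitude `y`, for the
perturbation of wave number `q_c = π - 2π/N`; here `δ` stands for `4 sin² (π / N)`. -/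

def coeff₁ (V W : ℝ → ℝ) (Q₀ Qπ : ℝ → ℝ → ℝ) (T : ℝ → ℝ) (δ y τ : ℝ) : ℝ :=
  T y ^ 2 / 2 *
    (iteratedDeriv 2 (Vt V W) (Q₀ y τ + Qπ y τ) + iteratedDeriv 2 (Vt V W) (Q₀ y τ - Qπ y τ)
      + (4 - δ) * (iteratedDeriv 2 (Wt V W) (2 * Qπ y τ)
        + iteratedDeriv 2 (Wt V W) (-2 * Qπ y τ)))

def coeff₂ (V W : ℝ → ℝ) (Q₀ Qπ : ℝ → ℝ → ℝ) (T : ℝ → ℝ) (y τ : ℝ) : ℝ :=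
  T y ^ 2 / 2 *
    (iteratedDeriv 2 (Vt V W) (Q₀ y τ + Qπ y τ) - iteratedDeriv 2 (Vt V W) (Q₀ y τ - Qπ y τ))

def coeff₃ (V W : ℝ → ℝ) (Qπ : ℝ → ℝ → ℝ) (T : ℝ → ℝ) (δ y τ : ℝ) : ℝ :=
  T y ^ 2 * Real.sqrt (δ * (1 - δ / 4)) *
    (iteratedDeriv 2 (Wt V W) (2 * Qπ y τ) - iteratedDeriv 2 (Wt V W) (-2 * Qπ y τ))

def coeff₄ (V W : ℝ → ℝ) (Q₀ Qπ : ℝ → ℝ → ℝ) (T : ℝ → ℝ) (δ y τ : ℝ) : ℝ :=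
  T y ^ 2 / 2 *
    (iteratedDeriv 2 (Vt V W) (Q₀ y τ + Qπ y τ) + iteratedDeriv 2 (Vt V W) (Q₀ y τ - Qπ y τ)
      + δ * (iteratedDeriv 2 (Wt V W) (2 * Qπ y τ)
        + iteratedDeriv 2 (Wt V W) (-2 * Qπ y τ)))

/-- `(rπ, jπ, r₀, j₀)` solves the 4-dimensional variational system, where
`η_{q_c} = rπ + i jπ` and `η_{q_c + π} = r₀ + i j₀`. -/
structure IsSolution (V W : ℝ → ℝ) (Q₀ Qπ : ℝ → ℝ → ℝ) (T : ℝ → ℝ) (δ y : ℝ)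
    (rπ jπ r₀ j₀ : ℝ → ℝ) : Prop where
  contDiff_rπ : ContDiff ℝ 2 rπ
  contDiff_jπ : ContDiff ℝ 2 jπ
  contDiff_r₀ : ContDiff ℝ 2 r₀
  contDiff_j₀ : ContDiff ℝ 2 j₀
  eq_rπ : ∀ τ, iteratedDeriv 2 rπ τ + coeff₁ V W Q₀ Qπ T δ y τ * rπ τ
    + coeff₂ V W Q₀ Qπ T y τ * r₀ τ - coeff₃ V W Qπ T δ y τ * j₀ τ = 0
  eq_jπ : ∀ τ, iteratedDeriv 2 jπ τ + coeff₁ V W Q₀ Qπ T δ y τ * jπ τ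
    + coeff₂ V W Q₀ Qπ T y τ * j₀ τ + coeff₃ V W Qπ T δ y τ * r₀ τ = 0
  eq_r₀ : ∀ τ, iteratedDeriv 2 r₀ τ + coeff₄ V W Q₀ Qπ T δ y τ * r₀ τ
    + coeff₂ V W Q₀ Qπ T y τ * rπ τ + coeff₃ V W Qπ T δ y τ * jπ τ = 0
  eq_j₀ : ∀ τ, iteratedDeriv 2 j₀ τ + coeff₄ V W Q₀ Qπ T δ y τ * j₀ τ
    + coeff₂ V W Q₀ Qπ T y τ * jπ τ - coeff₃ V W Qπ T δ y τ * rπ τ = 0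

/-- The variational system has a nontrivial time-reversal symmetric solution with the period
`2π` of the mode. -/
def HasSymmetricPeriodicSolution (V W : ℝ → ℝ) (Q₀ Qπ : ℝ → ℝ → ℝ) (T : ℝ → ℝ) (δ y : ℝ) :
    Prop :=
  ∃ rπ jπ r₀ j₀ : ℝ → ℝ, IsSolution V W Q₀ Qπ T δ y rπ jπ r₀ j₀ ∧
    (∀ f ∈ ({rπ, jπ, r₀, j₀} : Set (ℝ → ℝ)),
      Function.Periodic f (2 * Real.pi) ∧ Function.Even f) ∧
    ¬ (rπ = 0 ∧ jπ = 0 ∧ r₀ = 0 ∧ j₀ = 0)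

/-- The variational system is stable: all its motions are bounded. -/
def IsStable (V W : ℝ → ℝ) (Q₀ Qπ : ℝ → ℝ → ℝ) (T : ℝ → ℝ) (δ y : ℝ) : Prop :=
  ∀ rπ jπ r₀ j₀ : ℝ → ℝ, IsSolution V W Q₀ Qπ T δ y rπ jπ r₀ j₀ →
    ∃ C : ℝ, ∀ τ : ℝ, 0 ≤ τ → |rπ τ| ≤ C ∧ |jπ τ| ≤ C ∧ |r₀ τ| ≤ C ∧ |j₀ τ| ≤ C

/-- The value of the small parameter `δ` in the lattice with `N` sites. -/
def latticeDelta (N : ℕ) : ℝ := 4 * Real.sin (Real.pi / N) ^ 2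

/-- The leading-order bifurcation energy density `(2 φ₂ sin²(π / N) / (n γ))^{1/n}`. -/
def bifurcationEnergy (W : ℝ → ℝ) (n : ℕ) (γ : ℝ) (N : ℕ) : ℝ :=
  (2 * harmonicCoeff W * Real.sin (Real.pi / N) ^ 2 / (n * γ)) ^ ((1 : ℝ) / n)

end OutOfPhaseMode

end

/-! In the complex unknowns `u = (rπ + i jπ, r₀ + i j₀)` the variational system is `u'' + a(τ) u =
0`, with `a` a Hermitian 2×2 matrix, even in `τ`. For small `y` the mode satisfies `Q₀(τ + π) =
Q₀(τ)` and `Qπ(τ + π) = -Qπ(τ)` (`IsMode.eventually_shift`), so that `a(τ + π) = σ a(τ) σ` with `σ =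
diag(-1, 1)`. Hence the half-period matrix `M = flip4 * Z π` governs all motions. Symplecticity and
time reversal force `M = [[P, B], [C, Pᴴ]]` with `B`, `C` Hermitian, `P² - BC = 1`, `PB = BPᴴ`, `CP
= PᴴC` (`IsFundamental.exists_blocks`).

Two facts follow. Even `2π`-periodic solutions correspond to the kernel of `C`. Moreover `M + M⁻¹ =
diag(2P, 2Pᴴ)`, so stability is read off from the eigenvalues of `P`. At `δ = y = 0` these are `1`
and `cos(Ωπ)`, with `Ω` the in-phase frequency and `0 < Ω < 1`. The second stays inside `(-1, 1)`;
the side of `1` on which the first lies is the sign of `1 - tr P + det P`, and `(1 - tr P + det P)(1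
+ tr P + det P) = det B · det C`. At `δ = 0` the velocity of the mode is an odd periodic solution,
so `det B = 0` there, and `det B < 0` for small `δ > 0`. Thus the sign of `det C` alone decides:
negative means stable, positive unstable, zero a periodic even solution.

Put `δ = 4 sin² θ`. Then `√(δ(1 - δ/4)) = sin(2θ) / 2 · 2` reduces to `sin 2θ`, so `det C` is smooth
in `(θ, y)`, and it is even in `θ` because `θ ↦ -θ` conjugates `a`. At `y = 0` the oscillators
decouple and `det C ≈ -b (πβ₁/2) θ²` with `b = Ω sin(Ωπ)`. At `θ = 0` the derivative of the mode
with respect to amplitude at fixed physical time is an even solution whose velocity at `τ = π` is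
proportional to `T'/T`; this gives `det C ≈ -2πn b T̃_{2n} y^{2n}`. Balancing both terms yields `θ²
≈ -(4n T̃_{2n}/β₁) y^{2n}` (`exists_transition_curve`), and `δ ≈ 4θ²` gives the second transition
curve.

The energy satisfies `ε ≈ (ω²_{π,0}/2) y²`, which relates `γ` to `T̃_{2n}` and turns the curve,
evaluated at `θ = π/N`, into the bifurcation energy. Smoothness of `M` in the parameters comes from
writing the fundamental matrix as a resolvent on a space of bounded functions with a `cosh` weight.
-/

namespace OutOfPhaseMode

/-! ### Fundamental solutions of linear equations and their smooth dependence on the coefficients.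
-/

section LinearODE

open BoundedContinuousFunction MeasureTheory

variable {A : Type*} [NormedRing A] [NormedAlgebra ℝ A]

/-- Integrating `cosh (k s)` produces `sinh (k t) / k`, and `|sinh| ≤ cosh`. The even weight `cosh`
makes integration a contraction for large `k` in both directions of time at once. -/
theorem norm_integral_cosh_smul_le {k : ℝ} (hk : 0 < k) {v : ℝ → A} {c : ℝ}
    (hv : ∀ s, ‖v s‖ ≤ c) (t : ℝ) :
    ‖∫ s in (0 : ℝ)..t, Real.cosh (k * s) • v s‖ ≤ c / k * Real.cosh (k * t) := by
  have hc : 0 ≤ c := (norm_nonneg _).trans (hv 0)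
  have hI : ∫ s in (0 : ℝ)..t, c * Real.cosh (k * s) = c / k * Real.sinh (k * t) := by
    rw [intervalIntegral.integral_eq_sub_of_hasDerivAt
      (f := fun s => c / k * Real.sinh (k * s))]
    · simp
    · intro s _
      have := ((Real.hasDerivAt_sinh (k * s)).comp s ((hasDerivAt_id s).const_mul k)).const_mul
        (c / k)
      refine this.congr_deriv ?_
      field_simp
    · exact (Continuous.intervalIntegrable (by fun_prop) _ _)
  calc ‖∫ s in (0 : ℝ)..t, Real.cosh (k * s) • v s‖
      ≤ |∫ s in (0 : ℝ)..t, c * Real.cosh (k * s)| := by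
        apply intervalIntegral.norm_integral_le_abs_of_norm_le
        · refine Eventually.of_forall fun s => ?_
          rw [norm_smul, Real.norm_of_nonneg (Real.cosh_pos _).le, mul_comm]
          exact mul_le_mul_of_nonneg_right (hv s) (Real.cosh_pos _).le
        · exact (Continuous.intervalIntegrable (by fun_prop) _ _)
    _ = c / k * |Real.sinh (k * t)| := by
        rw [hI, abs_mul, abs_of_nonneg (by positivity)]
    _ ≤ c / k * Real.cosh (k * t) := by
        gcongr
        rw [Real.abs_sinh]
        exact (Real.sinh_lt_cosh _).le.trans (by rw [Real.cosh_abs])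

/-- The Volterra operator `v ↦ (cosh kt)⁻¹ ∫₀ᵗ cosh(ks) v(s) ds`, of norm at most `1 / k`. -/
noncomputable def volterra (A : Type*) [NormedRing A] [NormedAlgebra ℝ A] [CompleteSpace A]
    (k : ℝ) (hk : 0 < k) : (ℝ →ᵇ A) →L[ℝ] (ℝ →ᵇ A) :=
  LinearMap.mkContinuous
    { toFun := fun v => BoundedContinuousFunction.ofNormedAddCommGroup
        (fun t => (Real.cosh (k * t))⁻¹ • ∫ s in (0 : ℝ)..t, Real.cosh (k * s) • v s)
        (by
          refine Continuous.smul (Continuous.inv₀ (by fun_prop)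
            (fun t => (Real.cosh_pos _).ne')) ?_
          exact intervalIntegral.continuous_primitive
            (fun a b => Continuous.intervalIntegrable (by fun_prop) a b) 0)
        (‖v‖ / k)
        (fun t => by
          rw [norm_smul, norm_inv, Real.norm_of_nonneg (Real.cosh_pos _).le,
            inv_mul_le_iff₀ (Real.cosh_pos _), mul_comm]
          exact norm_integral_cosh_smul_le hk v.norm_coe_le_norm t)
      map_add' := fun v w => by
        ext t
        simp only [coe_ofNormedAddCommGroup, coe_add, Pi.add_apply, smul_add]
        rw [intervalIntegral.integral_add, smul_add]
        all_goals exact Continuous.intervalIntegrable (by fun_prop) _ _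
      map_smul' := fun c v => by
        ext t
        simp only [coe_ofNormedAddCommGroup, coe_smul, RingHom.id_apply]
        simp_rw [smul_comm _ c]
        rw [intervalIntegral.integral_smul, smul_comm] }
    (1 / k) (fun v => by
      refine (BoundedContinuousFunction.norm_le (by positivity)).2 fun t => ?_
      change ‖(Real.cosh (k * t))⁻¹ • ∫ s in (0 : ℝ)..t, Real.cosh (k * s) • v s‖ ≤ _
      rw [norm_smul, norm_inv, Real.norm_of_nonneg (Real.cosh_pos _).le,
            inv_mul_le_iff₀ (Real.cosh_pos _), mul_comm]
      refine (norm_integral_cosh_smul_le hk v.norm_coe_le_norm t).trans (le_of_eq ?_)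
      ring)

variable [CompleteSpace A]

theorem norm_volterra_le {k : ℝ} (hk : 0 < k) : ‖volterra A k hk‖ ≤ 1 / k :=
  LinearMap.mkContinuous_norm_le _ (by positivity) _

/-- The operator `Y ↦ volterra (B Y)`. -/
noncomputable def volterraMul (k : ℝ) (hk : 0 < k) (B : ℝ →ᵇ A) :
    (ℝ →ᵇ A) →L[ℝ] (ℝ →ᵇ A) :=
  (volterra A k hk).comp (ContinuousLinearMap.mul ℝ (ℝ →ᵇ A) B)

theorem norm_volterraMul_lt_one {k : ℝ} (hk : 0 < k) {B : ℝ →ᵇ A} (hB : ‖B‖ < k) :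
    ‖volterraMul k hk B‖ < 1 := by
  calc ‖volterraMul k hk B‖ ≤ ‖volterra A k hk‖ * ‖ContinuousLinearMap.mul ℝ (ℝ →ᵇ A) B‖ :=
        ContinuousLinearMap.opNorm_comp_le _ _
    _ ≤ 1 / k * ‖B‖ := by
        gcongr
        · exact norm_volterra_le hk
        · exact ContinuousLinearMap.opNorm_mul_apply_le _ _ _
    _ < 1 := by rw [one_div, inv_mul_lt_iff₀ hk]; simpa using hB

/-- The bounded function `t ↦ (cosh kt)⁻¹`. -/
noncomputable def sechBCF (A : Type*) [NormedRing A] [NormedAlgebra ℝ A] (k : ℝ) : ℝ →ᵇ A :=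
  BoundedContinuousFunction.ofNormedAddCommGroup
    (fun t => (Real.cosh (k * t))⁻¹ • (1 : A))
    (Continuous.smul (Continuous.inv₀ (by fun_prop) (fun t => (Real.cosh_pos _).ne'))
      continuous_const) ‖(1 : A)‖
    (fun t => by
      rw [norm_smul, norm_inv, Real.norm_of_nonneg (Real.cosh_pos _).le]
      exact mul_le_of_le_one_left (norm_nonneg _) (inv_le_one_of_one_le₀ (Real.one_le_cosh _)))

/-- The fundamental solution of `Z' = B Z`, `Z 0 = 1` (for `‖B‖ < k`). -/
noncomputable def fundamental (k : ℝ) (hk : 0 < k) (B : ℝ →ᵇ A) (t : ℝ) : A :=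
  Real.cosh (k * t) • (Ring.inverse (1 - volterraMul k hk B) (sechBCF A k)) t

theorem isUnit_one_sub_of_opNorm_lt_one {E : Type*} [NormedAddCommGroup E] [NormedSpace ℝ E]
    [CompleteSpace E] {T : E →L[ℝ] E} (hT : ‖T‖ < 1) : IsUnit (1 - T) :=
  isUnit_one_sub_of_norm_lt_one (R := E →L[ℝ] E) hT

/-- Inversion is smooth on the units of a Banach algebra. This is the only source of smooth
parameter dependence for the differential equation. -/
theorem contDiffAt_inverse_one_sub {E F : Type*} [NormedAddCommGroup E] [NormedSpace ℝ E]
    [CompleteSpace E] [NormedAddCommGroup F] [NormedSpace ℝ F] (T : F →L[ℝ] E →L[ℝ] E) {x : F}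
    (hT : ‖T x‖ < 1) (e : E) {m : ℕ∞ω} :
    ContDiffAt ℝ m (fun x => Ring.inverse (1 - T x) e) x := by
  obtain ⟨u, hu⟩ := isUnit_one_sub_of_opNorm_lt_one hT
  have h1 : ContDiffAt ℝ m (fun x => 1 - T x) x := contDiffAt_const.sub T.contDiff.contDiffAt
  have h2 : ContDiffAt ℝ m (fun x => Ring.inverse (1 - T x)) x := by
    refine ContDiffAt.comp (g := Ring.inverse) x ?_ h1
    rw [← hu]
    exact contDiffAt_ringInverse ℝ u
  exact h2.clm_apply contDiffAt_const

theorem isUnit_one_sub_volterraMul {k : ℝ} (hk : 0 < k) {B : ℝ →ᵇ A} (hB : ‖B‖ < k) :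
    IsUnit (1 - volterraMul k hk B) :=
  isUnit_one_sub_of_opNorm_lt_one (norm_volterraMul_lt_one hk hB)

theorem contDiffAt_fundamental {k : ℝ} (hk : 0 < k) {B : ℝ →ᵇ A} (hB : ‖B‖ < k) (t : ℝ)
    {m : ℕ∞ω} : ContDiffAt ℝ m (fun B => fundamental k hk B t) B := by
  have h3 : ContDiffAt ℝ m
      (fun B : ℝ →ᵇ A => Ring.inverse (1 - volterraMul k hk B) (sechBCF A k)) B :=
    contDiffAt_inverse_one_sub
      ((ContinuousLinearMap.compL ℝ (ℝ →ᵇ A) (ℝ →ᵇ A) (ℝ →ᵇ A) (volterra A k hk)).comp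
        (ContinuousLinearMap.mul ℝ (ℝ →ᵇ A))) (norm_volterraMul_lt_one hk hB) _
  have h4 : ContDiffAt ℝ m (fun B : ℝ →ᵇ A =>
      BoundedContinuousFunction.evalCLM ℝ t
        (Ring.inverse (1 - volterraMul k hk B) (sechBCF A k))) B :=
    (ContinuousLinearMap.contDiff (BoundedContinuousFunction.evalCLM ℝ t :
      (ℝ →ᵇ A) →L[ℝ] A)).contDiffAt.comp (f := fun B : ℝ →ᵇ A =>
        Ring.inverse (1 - volterraMul k hk B) (sechBCF A k)) B h3
  exact h4.const_smul (Real.cosh (k * t))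

/-- With `Z = cosh(kt) Y`, the resolvent equation `Y - volterra (B Y) = sech` becomes, after
multiplication by the weight, the integral equation of `Z' = B Z`, `Z 0 = 1`. -/
theorem fundamental_eq {k : ℝ} (hk : 0 < k) {B : ℝ →ᵇ A} (hB : ‖B‖ < k) (t : ℝ) :
    fundamental k hk B t = 1 + ∫ s in (0 : ℝ)..t, B s * fundamental k hk B s := by
  set Y := Ring.inverse (1 - volterraMul k hk B) (sechBCF A k) with hY
  have h1 : (1 - volterraMul k hk B) Y = sechBCF A k := by
    have := Ring.mul_inverse_cancel _ (isUnit_one_sub_volterraMul hk hB)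
    exact congrArg (fun T : (ℝ →ᵇ A) →L[ℝ] (ℝ →ᵇ A) => T (sechBCF A k)) this
  have h2 : Y t = sechBCF A k t + volterraMul k hk B Y t := by
    rw [← h1]; simp
  have h3 : sechBCF A k t = (Real.cosh (k * t))⁻¹ • (1 : A) := rfl
  have h4 : volterraMul k hk B Y t =
      (Real.cosh (k * t))⁻¹ • ∫ s in (0 : ℝ)..t, Real.cosh (k * s) • (B s * Y s) := rfl
  have hc := (Real.cosh_pos (k * t)).ne'
  have : ∀ s, fundamental k hk B s = Real.cosh (k * s) • Y s := fun s => rfl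
  simp_rw [this, h2, h3, h4, smul_add, smul_smul, mul_inv_cancel₀ hc, one_smul, mul_smul_comm]

theorem continuous_fundamental {k : ℝ} (hk : 0 < k) (B : ℝ →ᵇ A) :
    Continuous (fundamental k hk B) := by
  unfold fundamental
  fun_prop

theorem fundamental_zero {k : ℝ} (hk : 0 < k) {B : ℝ →ᵇ A} (hB : ‖B‖ < k) :
    fundamental k hk B 0 = 1 := by
  rw [fundamental_eq hk hB]; simp

theorem hasDerivAt_fundamental {k : ℝ} (hk : 0 < k) {B : ℝ →ᵇ A} (hB : ‖B‖ < k) (t : ℝ) :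
    HasDerivAt (fundamental k hk B) (B t * fundamental k hk B t) t := by
  have hc := continuous_fundamental hk B
  have : HasDerivAt (fun t => 1 + ∫ s in (0 : ℝ)..t, B s * fundamental k hk B s)
      (B t * fundamental k hk B t) t := by
    refine HasDerivAt.const_add _ ?_
    have hcont : Continuous fun s => B s * fundamental k hk B s := by fun_prop
    exact intervalIntegral.integral_hasDerivAt_right (hcont.intervalIntegrable _ _)
      (hcont.stronglyMeasurableAtFilter _ _) hcont.continuousAt
  exact this.congr_of_eventuallyEq (Eventually.of_forall fun t => fundamental_eq hk hB t)

end LinearODE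

/-! ### Smooth families of periodic functions as smooth curves in the space of bounded functions. -/

section PeriodicFamilies

open BoundedContinuousFunction MeasureTheory

variable {F : Type*} [NormedAddCommGroup F]

open Classical in
/-- A bounded continuous function as an element of `ℝ →ᵇ F` (junk value `0`). -/
noncomputable def toBCF (f : ℝ → F) : ℝ →ᵇ F :=
  if h : Continuous f ∧ ∃ C, ∀ t, ‖f t‖ ≤ C then
    BoundedContinuousFunction.ofNormedAddCommGroup f h.1 h.2.choose h.2.choose_spec else 0

theorem toBCF_apply {f : ℝ → F} (hf : Continuous f) {c : ℝ} (hc : 0 < c)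
    (hp : Function.Periodic f c) (t : ℝ) : toBCF f t = f t := by
  have h : Continuous f ∧ ∃ C, ∀ t, ‖f t‖ ≤ C := by
    refine ⟨hf, ?_⟩
    obtain ⟨C, hC⟩ := isCompact_Icc.exists_bound_of_continuousOn
      (hf.continuousOn (s := Icc 0 c))
    refine ⟨C, fun t => ?_⟩
    obtain ⟨s, hs, hst⟩ := hp.exists_mem_Ico₀ hc t
    rw [hst]
    exact hC s ⟨hs.1, hs.2.le⟩
  simp only [toBCF, dif_pos h]
  rfl

/-- One period is compact, so joint continuity is uniform in `t` by the tube lemma, and periodicity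
extends the estimate to all `t`. -/
theorem continuousOn_toBCF {f : ℝ → ℝ → F} {r c : ℝ} (hc : 0 < c)
    (hf : ContinuousOn (fun p : ℝ × ℝ => f p.1 p.2) (Ioo (-r) r ×ˢ univ))
    (hp : ∀ y ∈ Ioo (-r) r, Function.Periodic (f y) c) :
    ContinuousOn (fun y => toBCF (f y)) (Ioo (-r) r) := by
  have hcont : ∀ y ∈ Ioo (-r) r, Continuous (f y) := fun y hy => by
    rw [← continuousOn_univ]
    exact hf.comp (f := fun t : ℝ => (y, t)) (by fun_prop) (fun t _ => ⟨hy, mem_univ _⟩)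
  intro y hy
  rw [ContinuousWithinAt, Metric.tendsto_nhds]
  intro ε hε
  have htube : ∀ᶠ z in 𝓝[Ioo (-r) r] y, ∀ t ∈ Icc 0 c, dist (f z t) (f y t) < ε / 2 := by
    have hK : IsCompact (Icc 0 c : Set ℝ) := isCompact_Icc
    have := hK.eventually_forall_of_forall_eventually (x₀ := y)
      (P := fun z t => z ∈ Ioo (-r) r → dist (f z t) (f y t) < ε / 2) (fun t _ => by
        have h1 : ContinuousAt (fun p : ℝ × ℝ => f p.1 p.2) (y, t) :=
          hf.continuousAt ((isOpen_Ioo.prod isOpen_univ).mem_nhds ⟨hy, mem_univ _⟩)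
        have h2 : ContinuousAt (fun p : ℝ × ℝ => dist (f p.1 p.2) (f y p.2)) (y, t) :=
          h1.dist ((hcont y hy).continuousAt.comp (x := (y, t)) continuousAt_snd)
        have := h2.tendsto.eventually_lt_const (u := ε / 2) (by
          rw [dist_self]; positivity)
        filter_upwards [this] with p hp _ using hp)
    rw [eventually_nhdsWithin_iff]
    filter_upwards [this] with z hz hzm t ht using hz t ht hzm
  filter_upwards [htube, self_mem_nhdsWithin] with z hz hzm
  refine lt_of_le_of_lt ((BoundedContinuousFunction.dist_le (by positivity)).2 fun t => ?_)
    (half_lt_self hε)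
  rw [toBCF_apply (hcont z hzm) hc (hp z hzm), toBCF_apply (hcont y hy) hc (hp y hy)]
  have hper : Function.Periodic (fun t => dist (f z t) (f y t)) c := fun t => by
    simp only [hp z hzm t, hp y hy t]
  obtain ⟨s, hs, hst⟩ := hper.exists_mem_Ico₀ hc t
  exact hst.trans_le (hz s ⟨hs.1, hs.2.le⟩).le

variable [NormedSpace ℝ F]

/-- The mean value inequality is applied to `f x t - x • g y t` for each `t`. Its bound is uniform
in `t` because the partial derivative is already continuous in the sup norm. -/
theorem hasDerivAt_toBCF {f g : ℝ → ℝ → F} {r c : ℝ} (hc : 0 < c)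
    (hf : ∀ y ∈ Ioo (-r) r, Continuous (f y))
    (hg : ContinuousOn (fun p : ℝ × ℝ => g p.1 p.2) (Ioo (-r) r ×ˢ univ))
    (hfg : ∀ y ∈ Ioo (-r) r, ∀ t, HasDerivAt (fun y => f y t) (g y t) y)
    (hp : ∀ y ∈ Ioo (-r) r, Function.Periodic (f y) c)
    (hp' : ∀ y ∈ Ioo (-r) r, Function.Periodic (g y) c) {y : ℝ} (hy : y ∈ Ioo (-r) r) :
    HasDerivAt (fun y => toBCF (f y)) (toBCF (g y)) y := by
  have hcont : ∀ y ∈ Ioo (-r) r, Continuous (g y) := fun y hy => by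
    rw [← continuousOn_univ]
    exact hg.comp (f := fun t : ℝ => (y, t)) (by fun_prop) (fun t _ => ⟨hy, mem_univ _⟩)
  have hG : ContinuousAt (fun y => toBCF (g y)) y :=
    (continuousOn_toBCF hc hg hp').continuousAt (Ioo_mem_nhds hy.1 hy.2)
  rw [hasDerivAt_iff_isLittleO, isLittleO_iff]
  intro ε hε
  have h1 : ∀ᶠ z in 𝓝 y, dist (toBCF (g z)) (toBCF (g y)) < ε ∧ z ∈ Ioo (-r) r :=
    (Metric.tendsto_nhds.1 hG ε hε).and (Ioo_mem_nhds hy.1 hy.2)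
  obtain ⟨d, hd, hball⟩ := Metric.eventually_nhds_iff_ball.1 h1
  filter_upwards [Metric.ball_mem_nhds y hd] with z hz
  refine (BoundedContinuousFunction.norm_le (by positivity)).2 fun t => ?_
  have hzr := (hball z hz).2
  simp only [coe_sub, coe_smul, Pi.sub_apply]
  rw [toBCF_apply (hf z hzr) hc (hp z hzr), toBCF_apply (hf y hy) hc (hp y hy),
    toBCF_apply (hcont y hy) hc (hp' y hy)]
  have hmv := (convex_ball y d).norm_image_sub_le_of_norm_hasDerivWithin_le
    (f := fun x => f x t - x • g y t) (f' := fun x => g x t - g y t) (C := ε)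
    (fun x hx => (((hfg x (hball x hx).2 t).sub
      (by simpa using (hasDerivAt_id x).smul_const (g y t)))).hasDerivWithinAt)
    (fun x hx => by
      have h2 := (hball x hx).1.le
      have h3 := (BoundedContinuousFunction.dist_le hε.le).1 h2 t
      rwa [toBCF_apply (hcont x (hball x hx).2) hc (hp' x (hball x hx).2),
        toBCF_apply (hcont y hy) hc (hp' y hy), dist_eq_norm] at h3)
    (Metric.mem_ball_self hd) hz
  have e : f z t - f y t - (z - y) • g y t = f z t - z • g y t - (f y t - y • g y t) := by
    rw [sub_smul]; abel
  rw [e]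
  exact hmv

theorem hasDerivAt_fst_of_contDiffOn {f : ℝ → ℝ → F} {r : ℝ}
    (hf : ContDiffOn ℝ ∞ (fun p : ℝ × ℝ => f p.1 p.2) (Ioo (-r) r ×ˢ univ))
    {y : ℝ} (hy : y ∈ Ioo (-r) r) (t : ℝ) :
    HasDerivAt (fun y => f y t) (fderiv ℝ (fun p : ℝ × ℝ => f p.1 p.2) (y, t) (1, 0)) y := by
  have h1 : DifferentiableAt ℝ (fun p : ℝ × ℝ => f p.1 p.2) (y, t) :=
    (hf.contDiffAt ((isOpen_Ioo.prod isOpen_univ).mem_nhds ⟨hy, mem_univ _⟩)).differentiableAt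
      (by simp)
  exact h1.hasFDerivAt.comp_hasDerivAt (f := fun y => (y, t)) y
    ((hasDerivAt_id y).prodMk (hasDerivAt_const y t))

theorem hasDerivAt_snd_of_contDiffOn {f : ℝ → ℝ → F} {r : ℝ}
    (hf : ContDiffOn ℝ ∞ (fun p : ℝ × ℝ => f p.1 p.2) (Ioo (-r) r ×ˢ univ))
    {y : ℝ} (hy : y ∈ Ioo (-r) r) (t : ℝ) :
    HasDerivAt (f y) (fderiv ℝ (fun p : ℝ × ℝ => f p.1 p.2) (y, t) (0, 1)) t := by
  have h1 : DifferentiableAt ℝ (fun p : ℝ × ℝ => f p.1 p.2) (y, t) :=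
    (hf.contDiffAt ((isOpen_Ioo.prod isOpen_univ).mem_nhds ⟨hy, mem_univ _⟩)).differentiableAt
      (by simp)
  exact h1.hasFDerivAt.comp_hasDerivAt (f := fun t => (y, t)) t
    ((hasDerivAt_const t y).prodMk (hasDerivAt_id t))

theorem contDiffOn_fderiv_apply {f : ℝ × ℝ → F} {r : ℝ}
    (hf : ContDiffOn ℝ ∞ f (Ioo (-r) r ×ˢ univ)) (v : ℝ × ℝ) :
    ContDiffOn ℝ ∞ (fun p => fderiv ℝ f p v) (Ioo (-r) r ×ˢ univ) :=
  (hf.fderiv_of_isOpen (isOpen_Ioo.prod isOpen_univ) (by simp)).clm_apply contDiffOn_const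

/-- The partial derivative in `y` is again a jointly smooth periodic family, so induction on the
order applies. This lets the coefficients of the system be fed into the resolvent as a smooth curve.
-/
theorem contDiffOn_toBCF {f : ℝ → ℝ → F} {r c : ℝ} (hc : 0 < c)
    (hf : ContDiffOn ℝ ∞ (fun p : ℝ × ℝ => f p.1 p.2) (Ioo (-r) r ×ˢ univ))
    (hp : ∀ y ∈ Ioo (-r) r, Function.Periodic (f y) c) :
    ContDiffOn ℝ ∞ (fun y => toBCF (f y)) (Ioo (-r) r) := by
  rw [contDiffOn_infty]
  intro n
  induction n generalizing f with
  | zero => exact contDiffOn_zero.2 (continuousOn_toBCF hc hf.continuousOn hp)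
  | succ n ih =>
    set g : ℝ → ℝ → F := fun y t => fderiv ℝ (fun p : ℝ × ℝ => f p.1 p.2) (y, t) (1, 0) with hg
    have hgs : ContDiffOn ℝ ∞ (fun p : ℝ × ℝ => g p.1 p.2) (Ioo (-r) r ×ˢ univ) :=
      contDiffOn_fderiv_apply hf (1, 0)
    have hfg : ∀ y ∈ Ioo (-r) r, ∀ t, HasDerivAt (fun y => f y t) (g y t) y :=
      fun y hy t => hasDerivAt_fst_of_contDiffOn hf hy t
    have hgp : ∀ y ∈ Ioo (-r) r, Function.Periodic (g y) c := fun y hy t => by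
      refine (hfg y hy (t + c)).unique ((hfg y hy t).congr_of_eventuallyEq ?_)
      filter_upwards [Ioo_mem_nhds hy.1 hy.2] with z hz using hp z hz t
    have hcont : ∀ y ∈ Ioo (-r) r, Continuous (f y) := fun y hy => by
      rw [← continuousOn_univ]
      exact hf.continuousOn.comp (f := fun t : ℝ => (y, t)) (by fun_prop)
        (fun t _ => ⟨hy, mem_univ _⟩)
    have hder : ∀ y ∈ Ioo (-r) r, HasDerivAt (fun y => toBCF (f y)) (toBCF (g y)) y :=
      fun y hy => hasDerivAt_toBCF hc hcont hgs.continuousOn hfg hp hgp hy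
    have hn : ((n + 1 : ℕ) : ℕ∞ω) = (n : ℕ∞ω) + 1 := by push_cast; rfl
    rw [hn, contDiffOn_succ_iff_deriv_of_isOpen isOpen_Ioo]
    refine ⟨fun y hy => (hder y hy).differentiableAt.differentiableWithinAt, by simp, ?_⟩
    exact (ih hgs hgp).congr fun y hy => (hder y hy).deriv

end PeriodicFamilies

/-! ### Taylor coefficients determined from one side. -/

section OneSidedTaylor

/-- The limit at `0⁺` kills the constant term; then one divides by `y > 0` and inducts. -/
theorem eq_zero_of_sum_isLittleO {m : ℕ} {d : ℕ → ℝ}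
    (h : (fun y : ℝ => ∑ j ∈ Finset.range (m + 1), d j * y ^ j)
      =o[𝓝[>] 0] (fun y : ℝ => y ^ m)) : ∀ j ≤ m, d j = 0 := by
  induction m generalizing d with
  | zero =>
    intro j hj
    obtain rfl : j = 0 := by omega
    simpa [isLittleO_const_left] using h
  | succ m ih =>
    have h0 : d 0 = 0 := by
      have h1 : Tendsto (fun y : ℝ => ∑ j ∈ Finset.range (m + 1 + 1), d j * y ^ j)
          (𝓝[>] 0) (𝓝 0) := by
        refine h.trans_tendsto ?_
        have : Tendsto (fun y : ℝ => y ^ (m + 1)) (𝓝 0) (𝓝 (0 ^ (m + 1))) :=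
          (continuous_pow (m + 1)).tendsto 0
        rw [zero_pow (by omega)] at this
        exact this.mono_left nhdsWithin_le_nhds
      have h2 : Tendsto (fun y : ℝ => ∑ j ∈ Finset.range (m + 1 + 1), d j * y ^ j)
          (𝓝[>] 0) (𝓝 (∑ j ∈ Finset.range (m + 1 + 1), d j * (0 : ℝ) ^ j)) :=
        ((by fun_prop : Continuous fun y : ℝ => ∑ j ∈ Finset.range (m + 1 + 1), d j * y ^ j).tendsto
          0).mono_left nhdsWithin_le_nhds
      have := tendsto_nhds_unique h1 h2
      rw [Finset.sum_range_succ'] at this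
      simpa using this.symm
    have h1 : (fun y : ℝ => ∑ j ∈ Finset.range (m + 1), d (j + 1) * y ^ j)
        =o[𝓝[>] 0] (fun y : ℝ => y ^ m) := by
      rw [isLittleO_iff] at h ⊢
      intro ε hε
      filter_upwards [h hε, self_mem_nhdsWithin] with y hy hy0
      have hy0 : 0 < y := hy0
      rw [Finset.sum_range_succ', h0] at hy
      have e : ∑ k ∈ Finset.range (m + 1), d (k + 1) * y ^ (k + 1) + 0 * y ^ 0
          = y * ∑ k ∈ Finset.range (m + 1), d (k + 1) * y ^ k := by
        rw [Finset.mul_sum]; simp only [zero_mul, add_zero]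
        exact Finset.sum_congr rfl fun k _ => by ring
      rw [e, norm_mul, pow_succ, norm_mul, mul_comm (‖y ^ m‖), mul_left_comm] at hy
      exact le_of_mul_le_mul_left hy (norm_pos_iff.2 hy0.ne')
    intro j hj
    cases j with
    | zero => exact h0
    | succ j => exact ih h1 j (by omega)

theorem taylor_isLittleO_zero {f : ℝ → ℝ} {r : ℝ} (hr : 0 < r)
    (hf : ContDiffOn ℝ ∞ f (Ioo (-r) r)) (m : ℕ) :
    (fun y => f y - ∑ j ∈ Finset.range (m + 1), iteratedDeriv j f 0 / (j.factorial : ℝ) * y ^ j)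
      =o[𝓝[>] 0] (fun y : ℝ => y ^ m) := by
  have h0 : (0 : ℝ) ∈ Ioo (-r) r := ⟨by linarith, hr⟩
  have h := taylor_isLittleO (n := m) (convex_Ioo (-r) r) h0
    (hf.of_le (by exact_mod_cast le_top))
  rw [isOpen_Ioo.nhdsWithin_eq h0] at h
  refine (h.mono nhdsWithin_le_nhds).congr (fun y => ?_) (fun y => by simp)
  rw [taylor_within_apply]
  congr 1
  refine Finset.sum_congr rfl fun j _ => ?_
  rw [iteratedDerivWithin_of_isOpen isOpen_Ioo h0]
  simp; ring

theorem iteratedDeriv_eq_zero_of_isLittleO {f : ℝ → ℝ} {r a : ℝ} (hr : 0 < r)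
    (hf : ContDiffOn ℝ ∞ f (Ioo (-r) r)) {m : ℕ}
    (h : (fun y => f y - a * y ^ m) =o[𝓝[>] 0] (fun y : ℝ => y ^ m)) :
    (∀ j < m, iteratedDeriv j f 0 = 0) ∧ iteratedDeriv m f 0 / (m.factorial : ℝ) = a := by
  have h1 := (h.sub (taylor_isLittleO_zero hr hf m))
  have h2 : (fun y : ℝ => ∑ j ∈ Finset.range (m + 1),
      (iteratedDeriv j f 0 / (j.factorial : ℝ) - if j = m then a else 0) * y ^ j)
      =o[𝓝[>] 0] (fun y : ℝ => y ^ m) := by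
    refine h1.congr_left fun y => ?_
    simp only [sub_mul, Finset.sum_sub_distrib, ite_mul, zero_mul]
    rw [Finset.sum_ite_eq' (Finset.range (m + 1)) m, if_pos (by simp)]
    ring
  have h3 := eq_zero_of_sum_isLittleO h2
  refine ⟨fun j hj => ?_, ?_⟩
  · have := h3 j hj.le
    rw [if_neg hj.ne, sub_zero, div_eq_zero_iff] at this
    exact this.resolve_right (by exact_mod_cast j.factorial_ne_zero)
  · have := h3 m le_rfl
    rw [if_pos rfl] at this
    linarith

/-- Asymptotic relations cannot be differentiated in general. For a smooth function the relation
fixes the Taylor coefficients, and those of the derivative follow. -/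
theorem isLittleO_deriv_of_isLittleO {f : ℝ → ℝ} {r a : ℝ} (hr : 0 < r)
    (hf : ContDiffOn ℝ ∞ f (Ioo (-r) r)) {m : ℕ}
    (h : (fun y => f y - a * y ^ (m + 1)) =o[𝓝[>] 0] (fun y : ℝ => y ^ (m + 1))) :
    (fun y => deriv f y - (m + 1) * a * y ^ m) =o[𝓝[>] 0] (fun y : ℝ => y ^ m) := by
  obtain ⟨h1, h2⟩ := iteratedDeriv_eq_zero_of_isLittleO hr hf h
  refine (taylor_isLittleO_zero hr (hf.deriv_of_isOpen isOpen_Ioo (by simp)) m).congr_left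
    fun y => ?_
  rw [Finset.sum_range_succ, Finset.sum_eq_zero, zero_add]
  · rw [← iteratedDeriv_succ', ← h2, Nat.factorial_succ]
    have := m.factorial_ne_zero
    have : (m.factorial : ℝ) ≠ 0 := by exact_mod_cast this
    have : (m + 1 : ℝ) ≠ 0 := by positivity
    push_cast
    field_simp
  · intro j hj
    rw [← iteratedDeriv_succ', h1 (j + 1) (by simpa using hj)]
    simp

end OneSidedTaylor

/-! ### Zero curves of families even in one variable. -/

section EvenFamilies

/-- Two integrations: first `f' - m t`, then `f - m t² / 2`, is monotone. Increments are measured in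
`t² - s²`, the natural scale for functions even in `t`. -/
theorem sub_ge_of_second_deriv_ge {f f' f'' : ℝ → ℝ} {r m : ℝ}
    (hf : ∀ t ∈ Ico 0 r, HasDerivAt f (f' t) t) (hf' : ∀ t ∈ Ico 0 r, HasDerivAt f' (f'' t) t)
    (h0 : f' 0 = 0) (hm : ∀ t ∈ Ico 0 r, m ≤ f'' t) {s t : ℝ} (hs : 0 ≤ s) (hst : s ≤ t)
    (ht : t < r) : m / 2 * (t ^ 2 - s ^ 2) ≤ f t - f s := by
  have hmem : ∀ x ∈ Icc 0 t, x ∈ Ico 0 r := fun x hx => ⟨hx.1, hx.2.trans_lt ht⟩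
  have h0t : (0 : ℝ) ∈ Icc 0 t := ⟨le_rfl, hs.trans hst⟩
  have h1 : ∀ x ∈ Icc 0 t, 0 ≤ f' x - m * x := by
    have hmono : MonotoneOn (fun x => f' x - m * x) (Icc 0 t) := by
      refine monotoneOn_of_hasDerivWithinAt_nonneg (f' := fun x => f'' x - m) (convex_Icc 0 t)
        (fun x hx => ?_) (fun x hx => ?_) (fun x hx => ?_)
      · exact ((hf' x (hmem x hx)).continuousAt.sub (by fun_prop)).continuousWithinAt
      · have := ((hf' x (hmem x (interior_subset hx))).sub ((hasDerivAt_id x).const_mul m))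
        exact (this.congr_deriv (by simp)).hasDerivWithinAt
      · linarith [hm x (hmem x (interior_subset hx))]
    intro x hx
    have := hmono h0t hx hx.1
    simpa [h0] using this
  have h2 : MonotoneOn (fun x => f x - m / 2 * x ^ 2) (Icc 0 t) := by
    refine monotoneOn_of_hasDerivWithinAt_nonneg (f' := fun x => f' x - m * x) (convex_Icc 0 t)
        (fun x hx => ?_) (fun x hx => ?_) (fun x hx => h1 x (interior_subset hx))
    · exact ((hf x (hmem x hx)).continuousAt.sub (by fun_prop)).continuousWithinAt
    · have := ((hf x (hmem x (interior_subset hx))).sub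
        ((hasDerivAt_pow 2 x).const_mul (m / 2)))
      refine (this.congr_deriv ?_).hasDerivWithinAt
      rw [show 2 - 1 = 1 from rfl, pow_one]; push_cast; ring
  have := h2 ⟨hs, hst⟩ ⟨hs.trans hst, le_rfl⟩ hst
  simp only at this
  linarith

theorem abs_sub_le_of_second_deriv {f f' f'' : ℝ → ℝ} {r k η : ℝ}
    (hf : ∀ t ∈ Ico 0 r, HasDerivAt f (f' t) t) (hf' : ∀ t ∈ Ico 0 r, HasDerivAt f' (f'' t) t)
    (h0 : f' 0 = 0) (hm : ∀ t ∈ Ico 0 r, |f'' t - k| ≤ η) {s t : ℝ} (hs : 0 ≤ s) (hst : s ≤ t)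
    (ht : t < r) : |f t - f s - k / 2 * (t ^ 2 - s ^ 2)| ≤ η / 2 * (t ^ 2 - s ^ 2) := by
  have h1 := sub_ge_of_second_deriv_ge (m := k - η) hf hf' h0
    (fun t ht => by linarith [(abs_le.1 (hm t ht)).1]) hs hst ht
  have h2 := sub_ge_of_second_deriv_ge (f := fun x => -f x) (f' := fun x => -f' x)
    (f'' := fun x => -f'' x) (m := -k - η) (fun t ht => (hf t ht).neg) (fun t ht => (hf' t ht).neg)
    (by simp [h0]) (fun t ht => by linarith [(abs_le.1 (hm t ht)).2]) hs hst ht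
  rw [abs_le]
  constructor <;> nlinarith

/-- A smooth family `θ ↦ D θ y` of even functions is, to leading order, quadratic in `θ`,
uniformly in `y`. -/
theorem even_family_expansion {D : ℝ → ℝ → ℝ} {r κ : ℝ} (hr : 0 < r)
    (hD : ContDiffOn ℝ ∞ (fun p : ℝ × ℝ => D p.1 p.2) (Ioo (-r) r ×ˢ Ioo (-r) r))
    (heven : ∀ θ ∈ Ioo (-r) r, ∀ y ∈ Ioo (-r) r, D (-θ) y = D θ y)
    (hκ : Tendsto (fun θ => (D θ 0 - D 0 0) / θ ^ 2) (𝓝[>] 0) (𝓝 κ)) :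
    (∀ η > 0, ∃ r' > 0, r' ≤ r ∧ ∀ y ∈ Ioo (-r') r', ∀ s t, 0 ≤ s → s ≤ t → t < r' →
      |D t y - D s y - κ * (t ^ 2 - s ^ 2)| ≤ η * (t ^ 2 - s ^ 2)) ∧
    ∃ r' > 0, r' ≤ r ∧ ∃ K > 0, ∀ y ∈ Ioo (-r') r', ∀ z ∈ Ioo (-r') r', ∀ t, 0 ≤ t → t < r' →
      |(D t z - D t y) - (D 0 z - D 0 y)| ≤ K * t ^ 2 * |z - y| := by
  have hopen : IsOpen (Ioo (-r) r ×ˢ Ioo (-r) r) := isOpen_Ioo.prod isOpen_Ioo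
  set F : ℝ × ℝ → ℝ := fun p => D p.1 p.2 with hF
  set E₁ : ℝ × ℝ → ℝ := fun p => fderiv ℝ F p (1, 0) with hE₁
  set E₂ : ℝ × ℝ → ℝ := fun p => fderiv ℝ E₁ p (1, 0) with hE₂
  have hs₁ : ContDiffOn ℝ ∞ E₁ (Ioo (-r) r ×ˢ Ioo (-r) r) :=
    (hD.fderiv_of_isOpen hopen (by simp)).clm_apply contDiffOn_const
  have hs₂ : ContDiffOn ℝ ∞ E₂ (Ioo (-r) r ×ˢ Ioo (-r) r) :=
    (hs₁.fderiv_of_isOpen hopen (by simp)).clm_apply contDiffOn_const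
  have hline : ∀ G : ℝ × ℝ → ℝ, ContDiffOn ℝ ∞ G (Ioo (-r) r ×ˢ Ioo (-r) r) →
      ∀ θ ∈ Ioo (-r) r, ∀ y ∈ Ioo (-r) r,
        HasDerivAt (fun θ => G (θ, y)) (fderiv ℝ G (θ, y) (1, 0)) θ := by
    intro G hG θ hθ y hy
    have h1 : DifferentiableAt ℝ G (θ, y) :=
      (hG.contDiffAt (hopen.mem_nhds ⟨hθ, hy⟩)).differentiableAt (by simp)
    exact h1.hasFDerivAt.comp_hasDerivAt (f := fun θ => (θ, y)) θ
      ((hasDerivAt_id θ).prodMk (hasDerivAt_const θ y))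
  have hmem0 : (0 : ℝ) ∈ Ioo (-r) r := ⟨by linarith, hr⟩
  -- Evenness kills the first `θ`-derivative at `θ = 0`, for every `y`.
  have hE0 : ∀ y ∈ Ioo (-r) r, E₁ (0, y) = 0 := by
    intro y hy
    have h1 := hline F hD 0 hmem0 y hy
    have h2 : HasDerivAt (fun θ => F (θ, y)) (-(fderiv ℝ F (0, y) (1, 0))) 0 := by
      have h3 : HasDerivAt (fun θ => F (-θ, y)) (-(fderiv ℝ F (0, y) (1, 0))) 0 := by
        have := HasDerivAt.scomp (g₁ := fun θ => F (θ, y)) (h := fun θ => -θ) (0 : ℝ)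
          (by simpa using h1) (hasDerivAt_neg (0 : ℝ))
        simpa [Function.comp_def] using this
      refine h3.congr_of_eventuallyEq ?_
      filter_upwards [Ioo_mem_nhds hmem0.1 hmem0.2] with θ hθ using (heven θ hθ y hy).symm
    have := h1.unique h2
    simp only [hE₁]; linarith
  have hc₂ : ContinuousAt E₂ (0, 0) :=
    hs₂.continuousOn.continuousAt (hopen.mem_nhds ⟨hmem0, hmem0⟩)
  have hA : ∀ η > 0, ∃ r' > 0, r' ≤ r ∧ ∀ y ∈ Ioo (-r') r', ∀ s t, 0 ≤ s → s ≤ t → t < r' →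
      |D t y - D s y - E₂ (0, 0) / 2 * (t ^ 2 - s ^ 2)| ≤ η / 2 * (t ^ 2 - s ^ 2) := by
    intro η hη
    obtain ⟨d, hd, hball⟩ := Metric.continuousAt_iff.1 hc₂ η hη
    refine ⟨min d r, lt_min hd hr, min_le_right _ _, fun y hy s t hs hst ht => ?_⟩
    have hyr : y ∈ Ioo (-r) r := ⟨by linarith [hy.1, min_le_right d r], hy.2.trans_le
      (min_le_right _ _)⟩
    have hin : ∀ x ∈ Ico 0 (min d r), x ∈ Ioo (-r) r := fun x hx =>
      ⟨by linarith [hx.1], hx.2.trans_le (min_le_right _ _)⟩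
    refine abs_sub_le_of_second_deriv (f' := fun θ => E₁ (θ, y)) (f'' := fun θ => E₂ (θ, y))
      (r := min d r) (fun x hx => hline F hD x (hin x hx) y hyr)
      (fun x hx => hline E₁ hs₁ x (hin x hx) y hyr) (hE0 y hyr) (fun x hx => ?_) hs hst ht
    have : dist (x, y) ((0 : ℝ), (0 : ℝ)) < d := by
      rw [Prod.dist_eq, max_lt_iff]
      simp only [Real.dist_eq, sub_zero]
      refine ⟨?_, (abs_lt.2 hy).trans_le (min_le_left _ _)⟩
      rw [abs_of_nonneg hx.1]; exact hx.2.trans_le (min_le_left _ _)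
    exact (hball this).le
  -- The quotient at `y = 0` identifies the coefficient, so no second derivative has to be computed
  -- in applications.
  have hκ' : E₂ (0, 0) / 2 = κ := by
    refine tendsto_nhds_unique ?_ hκ
    rw [Metric.tendsto_nhds]
    intro ε hε
    obtain ⟨r', hr', -, h⟩ := hA ε hε
    filter_upwards [Ioo_mem_nhdsGT hr'] with θ hθ
    have h1 := h 0 ⟨by linarith, hr'⟩ 0 θ le_rfl hθ.1.le hθ.2
    have hθ2 : 0 < θ ^ 2 := pow_pos hθ.1 2
    rw [Real.dist_eq]
    have e : (D θ 0 - D 0 0) / θ ^ 2 - E₂ (0, 0) / 2 =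
        (D θ 0 - D 0 0 - E₂ (0, 0) / 2 * (θ ^ 2 - 0 ^ 2)) / θ ^ 2 := by
      have := hθ.1.ne'
      field_simp; ring
    rw [e, abs_div, abs_of_pos hθ2, div_lt_iff₀ hθ2]
    nlinarith
  refine ⟨fun η hη => ?_, ?_⟩
  · obtain ⟨r', h1, h2, h3⟩ := hA (2 * η) (by linarith)
    refine ⟨r', h1, h2, fun y hy s t hs hst ht => ?_⟩
    have := h3 y hy s t hs hst ht
    rw [hκ'] at this
    linarith
  -- The difference of two members of the family is again even in `θ`, and its second derivative is
  -- at most a Lipschitz constant times `|z - y|`. `K + 1` replaces `K` to make the constant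
  -- positive.
  · obtain ⟨K, t, ht, hK⟩ := (ContDiffAt.exists_lipschitzOnWith (f := E₂) (x := (0, 0))
      ((hs₂.contDiffAt (hopen.mem_nhds ⟨hmem0, hmem0⟩)).of_le (by exact_mod_cast le_top)))
    obtain ⟨d, hd, hball⟩ := Metric.mem_nhds_iff.1 ht
    refine ⟨min d r, lt_min hd hr, min_le_right _ _, (K + 1) / 2, by positivity,
      fun y hy z hz t ht ht' => ?_⟩
    have hyr : y ∈ Ioo (-r) r := ⟨by linarith [hy.1, min_le_right d r], hy.2.trans_le
      (min_le_right _ _)⟩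
    have hzr : z ∈ Ioo (-r) r := ⟨by linarith [hz.1, min_le_right d r], hz.2.trans_le
      (min_le_right _ _)⟩
    have hin : ∀ x ∈ Ico 0 (min d r), x ∈ Ioo (-r) r := fun x hx =>
      ⟨by linarith [hx.1], hx.2.trans_le (min_le_right _ _)⟩
    have hb : ∀ x ∈ Ico 0 (min d r), ∀ w ∈ Ioo (-min d r) (min d r),
        ((x, w) : ℝ × ℝ) ∈ Metric.ball ((0 : ℝ), (0 : ℝ)) d := by
      intro x hx w hw
      rw [Metric.mem_ball, Prod.dist_eq, max_lt_iff]
      simp only [Real.dist_eq, sub_zero]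
      refine ⟨?_, (abs_lt.2 hw).trans_le (min_le_left _ _)⟩
      rw [abs_of_nonneg hx.1]; exact hx.2.trans_le (min_le_left _ _)
    have := abs_sub_le_of_second_deriv (f := fun θ => F (θ, z) - F (θ, y))
      (f' := fun θ => E₁ (θ, z) - E₁ (θ, y)) (f'' := fun θ => E₂ (θ, z) - E₂ (θ, y))
      (k := 0) (η := (K + 1) * |z - y|) (r := min d r)
      (fun x hx => (hline F hD x (hin x hx) z hzr).sub (hline F hD x (hin x hx) y hyr))
      (fun x hx => (hline E₁ hs₁ x (hin x hx) z hzr).sub (hline E₁ hs₁ x (hin x hx) y hyr))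
      (by simp only [hE0 y hyr, hE0 z hzr, sub_zero]) (fun x hx => by
        have h1 := hK.dist_le_mul _ (hball (hb x hx z hz)) _ (hball (hb x hx y hy))
        rw [Real.dist_eq, Prod.dist_eq] at h1
        simp only [dist_self, Real.dist_eq] at h1
        rw [max_eq_right (abs_nonneg _)] at h1
        rw [sub_zero]
        nlinarith [abs_nonneg (z - y)]) le_rfl ht ht'
    simp only [hF] at this
    calc _ = |D t z - D t y - (D 0 z - D 0 y) - 0 / 2 * (t ^ 2 - 0 ^ 2)| := by congr 1; ring
      _ ≤ _ := this
      _ = _ := by ring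

/-- The model is `D ≈ c y^m + κ θ²`, with `c > 0 > κ`. For each small `y > 0` the function decreases
strictly in `θ` from a positive to a negative value, hence has one zero. Working with `θ²` directly,
through the uniform quadratic expansion, gives the asymptotics, the monotonicity and the range of
the zero without solving for `θ` implicitly. -/
theorem exists_transition_curve {D : ℝ → ℝ → ℝ} {r κ c : ℝ} {m : ℕ} (hr : 0 < r) (hκ0 : κ < 0)
    (hc : 0 < c) (hm : 1 ≤ m)
    (hD : ContDiffOn ℝ ∞ (fun p : ℝ × ℝ => D p.1 p.2) (Ioo (-r) r ×ˢ Ioo (-r) r))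
    (heven : ∀ θ ∈ Ioo (-r) r, ∀ y ∈ Ioo (-r) r, D (-θ) y = D θ y)
    (hκ : Tendsto (fun θ => (D θ 0 - D 0 0) / θ ^ 2) (𝓝[>] 0) (𝓝 κ))
    (h0 : (fun y => D 0 y - c * y ^ m) =o[𝓝[>] 0] (fun y : ℝ => y ^ m)) :
    ∃ y₁ θ₁ : ℝ, ∃ θs : ℝ → ℝ, 0 < y₁ ∧ y₁ ≤ r ∧ 0 < θ₁ ∧ θ₁ ≤ r ∧
      (∀ y ∈ Ioo 0 y₁, θs y ∈ Ioo 0 θ₁) ∧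
      (∀ y ∈ Ioo 0 y₁, D (θs y) y = 0) ∧
      (∀ y ∈ Ioo 0 y₁, StrictAntiOn (fun θ => D θ y) (Ico 0 θ₁)) ∧
      ((fun y => θs y ^ 2 - -c / κ * y ^ m) =o[𝓝[>] 0] (fun y : ℝ => y ^ m)) ∧
      StrictMonoOn θs (Ioo 0 y₁) ∧
      ∃ θ₂ > 0, ∀ θ ∈ Ioo 0 θ₂, ∃ y ∈ Ioo 0 y₁, θs y = θ := by
  obtain ⟨hA, rB, hrB, hrBr, K, hK, hB⟩ := even_family_expansion hr hD heven hκ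
  -- The error `-κ / 2` leaves half of the quadratic decrease.
  obtain ⟨rA, hrA, hrAr, hA1⟩ := hA (-κ / 2) (by linarith)
  have hmem0 : (0 : ℝ) ∈ Ioo (-r) r := ⟨by linarith, hr⟩
  have hopen : IsOpen (Ioo (-r) r ×ˢ Ioo (-r) r) := isOpen_Ioo.prod isOpen_Ioo
  have hslice : ∀ θ ∈ Ioo (-r) r, ContDiffOn ℝ ∞ (D θ) (Ioo (-r) r) := fun θ hθ =>
    hD.comp (f := fun y : ℝ => (θ, y)) (by fun_prop) (fun y hy => ⟨hθ, hy⟩)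
  have hslice' : ∀ y ∈ Ioo (-r) r, ContinuousOn (fun θ => D θ y) (Ioo (-r) r) := fun y hy =>
    hD.continuousOn.comp (f := fun θ : ℝ => (θ, y)) (by fun_prop) (fun θ hθ => ⟨hθ, hy⟩)
  have hD00 : D 0 0 = 0 := by
    have h1 : Tendsto (D 0) (𝓝[>] 0) (𝓝 (D 0 0)) :=
      ((hslice 0 hmem0).continuousOn.continuousAt (Ioo_mem_nhds hmem0.1 hmem0.2)).tendsto.mono_left
        nhdsWithin_le_nhds
    have hp : Tendsto (fun y : ℝ => y ^ m) (𝓝[>] 0) (𝓝 0) := by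
      have := ((continuous_pow m).tendsto (0 : ℝ))
      rw [zero_pow (by omega)] at this
      exact this.mono_left nhdsWithin_le_nhds
    have h2 : Tendsto (fun y => (D 0 y - c * y ^ m) + c * y ^ m) (𝓝[>] 0) (𝓝 (0 + c * 0)) :=
      (h0.trans_tendsto hp).add (hp.const_mul c)
    simpa using tendsto_nhds_unique h1 (by simpa using h2)
  -- decrease in `θ`
  have hdec : ∀ y ∈ Ioo (-rA) rA, ∀ s t, 0 ≤ s → s ≤ t → t < rA →
      D t y - D s y ≤ κ / 2 * (t ^ 2 - s ^ 2) := by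
    intro y hy s t hs hst ht
    have := (abs_le.1 (hA1 y hy s t hs hst ht)).2
    nlinarith
  set θ₁ := rA / 2 with hθ₁
  have hθ₁0 : 0 < θ₁ := by positivity
  -- size of `D 0`
  have hev1 : ∀ᶠ y in 𝓝[>] (0 : ℝ), |D 0 y - c * y ^ m| ≤ c / 2 * y ^ m := by
    filter_upwards [h0.bound (show (0 : ℝ) < c / 2 by positivity), self_mem_nhdsWithin] with y hy hy0
    have hy0 : 0 < y := hy0
    rwa [Real.norm_eq_abs, Real.norm_of_nonneg (by positivity)] at hy
  have hev2 : ∀ᶠ y in 𝓝[>] (0 : ℝ), D θ₁ y < 0 := by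
    have h1 : D θ₁ 0 < 0 := by
      have := hdec 0 ⟨by linarith, hrA⟩ 0 θ₁ le_rfl hθ₁0.le (by linarith)
      rw [hD00] at this
      nlinarith [pow_pos hθ₁0 2]
    have hθr : θ₁ ∈ Ioo (-r) r := ⟨by linarith, by linarith⟩
    exact (((hslice θ₁ hθr).continuousOn.continuousAt
      (Ioo_mem_nhds hmem0.1 hmem0.2)).eventually_lt_const h1).filter_mono nhdsWithin_le_nhds
  have hev3 : ∀ᶠ y in 𝓝[>] (0 : ℝ), (m : ℝ) * c / 2 * y ^ (m - 1) ≤ deriv (D 0) y := by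
    obtain ⟨m, rfl⟩ : ∃ k, m = k + 1 := ⟨m - 1, by omega⟩
    have := isLittleO_deriv_of_isLittleO hr (hslice 0 hmem0) h0
    have hpos : (0 : ℝ) < (m + 1) * c / 2 := by positivity
    filter_upwards [this.bound hpos, self_mem_nhdsWithin] with y hy hy0
    have hy0 : 0 < y := hy0
    rw [Real.norm_eq_abs, Real.norm_of_nonneg (by positivity)] at hy
    have := (abs_le.1 hy).1
    push_cast
    linarith
  -- `(-3 c / κ) y^m` will bound `θs²`: it is `D 0 y ≤ (3c/2) y^m` divided by `-κ / 2`. This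
  -- condition makes the growth of `D 0` in `y` beat the mixed error `K θ² |z - y|`.
  have hev4 : ∀ᶠ y in 𝓝[>] (0 : ℝ), K * (-3 * c / κ) * y < m * c / 2 := by
    have h1 : Tendsto (fun y : ℝ => K * (-3 * c / κ) * y) (𝓝 0) (𝓝 (K * (-3 * c / κ) * 0)) :=
      (by fun_prop : Continuous fun y : ℝ => K * (-3 * c / κ) * y).tendsto 0
    have h2 : K * (-3 * c / κ) * 0 < m * c / 2 := by
      have : (0 : ℝ) < m := by exact_mod_cast hm
      rw [mul_zero]; positivity
    exact (h1.eventually_lt_const h2).filter_mono nhdsWithin_le_nhds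
  have hev5 : ∀ᶠ y in 𝓝[>] (0 : ℝ), -3 * c / κ * y ^ m < rB ^ 2 := by
    have h1 : Tendsto (fun y : ℝ => -3 * c / κ * y ^ m) (𝓝 0) (𝓝 (-3 * c / κ * 0 ^ m)) :=
      (by fun_prop : Continuous fun y : ℝ => -3 * c / κ * y ^ m).tendsto 0
    have h2 : -3 * c / κ * 0 ^ m < rB ^ 2 := by
      rw [zero_pow (by omega), mul_zero]; positivity
    exact (h1.eventually_lt_const h2).filter_mono nhdsWithin_le_nhds
  obtain ⟨y₀, hy₀, hall⟩ := mem_nhdsGT_iff_exists_Ioo_subset.1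
    (hev1.and (hev2.and (hev3.and (hev4.and hev5))))
  have hy₀ : 0 < y₀ := hy₀
  set y₁ := min y₀ (min rA rB) with hy₁
  have hy₁0 : 0 < y₁ := lt_min hy₀ (lt_min hrA hrB)
  have hyA : ∀ y ∈ Ioo 0 y₁, y ∈ Ioo (-rA) rA := fun y hy =>
    ⟨by linarith [hy.1], hy.2.trans_le ((min_le_right _ _).trans (min_le_left _ _))⟩
  have hyB : ∀ y ∈ Ioo 0 y₁, y ∈ Ioo (-rB) rB := fun y hy =>
    ⟨by linarith [hy.1], hy.2.trans_le ((min_le_right _ _).trans (min_le_right _ _))⟩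
  have hyr : ∀ y ∈ Ioo 0 y₁, y ∈ Ioo (-r) r := fun y hy =>
    ⟨by linarith [hy.1], (hyA y hy).2.trans_le hrAr⟩
  have hy0 : ∀ y ∈ Ioo 0 y₁, y ∈ Ioo 0 y₀ := fun y hy => ⟨hy.1, hy.2.trans_le (min_le_left _ _)⟩
  have hanti : ∀ y ∈ Ioo (-rA) rA, StrictAntiOn (fun θ => D θ y) (Ico 0 θ₁) := by
    intro y hy s hs t ht hst
    have := hdec y hy s t hs.1 hst.le (by linarith [ht.2])
    have h2 : 0 < t ^ 2 - s ^ 2 := by nlinarith [hs.1]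
    simp only
    nlinarith
  have hex : ∀ y ∈ Ioo 0 y₁, ∃ θ ∈ Ioo 0 θ₁, D θ y = 0 := by
    intro y hy
    have h1 := (hall (hy0 y hy)).1
    have hpos : 0 < D 0 y := by
      have := (abs_le.1 h1).1
      have : 0 < y ^ m := pow_pos hy.1 m
      nlinarith
    have hneg : D θ₁ y < 0 := (hall (hy0 y hy)).2.1
    have hcont : ContinuousOn (fun θ => D θ y) (Icc 0 θ₁) :=
      (hslice' y (hyr y hy)).mono fun θ hθ => ⟨by linarith [hθ.1], by linarith [hθ.2]⟩
    obtain ⟨θ, hθ, hθ0⟩ := intermediate_value_Ioo' hθ₁0.le hcont ⟨hneg, hpos⟩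
    exact ⟨θ, hθ, hθ0⟩
  choose! θs hθs hθs0 using hex
  have hsq : ∀ y ∈ Ioo 0 y₁, θs y ^ 2 ≤ -3 * c / κ * y ^ m := by
    intro y hy
    have h1 := hdec y (hyA y hy) 0 (θs y) le_rfl (hθs y hy).1.le (by linarith [(hθs y hy).2])
    rw [hθs0 y hy] at h1
    have h2 := (abs_le.1 (hall (hy0 y hy)).1).2
    rw [div_mul_eq_mul_div, le_div_iff_of_neg hκ0]
    nlinarith
  refine ⟨y₁, θ₁, θs, hy₁0, (min_le_right _ _).trans ((min_le_left _ _).trans hrAr), hθ₁0,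
    by linarith, hθs, hθs0, fun y hy => hanti y (hyA y hy), ?_, ?_, ?_⟩
  · rw [isLittleO_iff]
    intro ε hε
    have hκne : κ ≠ 0 := hκ0.ne
    -- Chosen so that `η (-3 c / κ) = -κ ε / 2`: the quadratic error and the error in `D 0` then
    -- each take half of `|κ| ε y^m`.
    have hη : 0 < κ ^ 2 * ε / (6 * c) := by positivity
    set η := κ ^ 2 * ε / (6 * c) with hηdef
    obtain ⟨r', hr', -, h'⟩ := hA η hη
    have hsm : ∀ᶠ y in 𝓝[>] (0 : ℝ), -3 * c / κ * y ^ m < r' ^ 2 := by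
      have h1 : Tendsto (fun y : ℝ => -3 * c / κ * y ^ m) (𝓝 0) (𝓝 (-3 * c / κ * 0 ^ m)) :=
        (by fun_prop : Continuous fun y : ℝ => -3 * c / κ * y ^ m).tendsto 0
      have h2 : -3 * c / κ * 0 ^ m < r' ^ 2 := by
        rw [zero_pow (by omega), mul_zero]; positivity
      exact (h1.eventually_lt_const h2).filter_mono nhdsWithin_le_nhds
    have hlin := h0.bound (show 0 < -κ * ε / 2 by nlinarith)
    filter_upwards [Ioo_mem_nhdsGT hy₁0, Ioo_mem_nhdsGT hr', hsm, hlin] with y hy hy' hsm hlin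
    have hym : 0 < y ^ m := pow_pos hy.1 m
    rw [Real.norm_eq_abs, Real.norm_of_nonneg hym.le] at hlin ⊢
    have hlt : θs y < r' := lt_of_pow_lt_pow_left₀ 2 hr'.le ((hsq y hy).trans_lt hsm)
    have h1 := h' y ⟨by linarith [hy'.1], hy'.2⟩ 0 (θs y) le_rfl (hθs y hy).1.le hlt
    rw [hθs0 y hy] at h1
    have hq : η * (θs y ^ 2 - 0 ^ 2) ≤ -κ * ε / 2 * y ^ m := by
      have h3 := mul_le_mul_of_nonneg_left (hsq y hy) hη.le
      have : η * (-3 * c / κ * y ^ m) = -κ * ε / 2 * y ^ m := by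
        rw [hηdef]; field_simp; ring
      linarith
    have e2 : θs y ^ 2 - -c / κ * y ^ m = -((0 - D 0 y - κ * (θs y ^ 2 - 0 ^ 2))
        + (D 0 y - c * y ^ m)) / κ := by
      field_simp; ring
    rw [e2, abs_div, abs_neg, abs_of_neg hκ0, div_le_iff₀ (by linarith)]
    calc _ ≤ |0 - D 0 y - κ * (θs y ^ 2 - 0 ^ 2)| + |D 0 y - c * y ^ m| := abs_add_le _ _
      _ ≤ -κ * ε / 2 * y ^ m + -κ * ε / 2 * y ^ m := add_le_add (h1.trans hq) hlin
      _ = _ := by ring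
  -- At the zero `θs y`, moving from `y` to `z > y` makes `D` positive, so the zero for `z` lies at
  -- a larger `θ`.
  · intro y hy z hz hyz
    have hθB : θs y < rB :=
      lt_of_pow_lt_pow_left₀ 2 hrB.le ((hsq y hy).trans_lt (hall (hy0 y hy)).2.2.2.2)
    have h1 := (abs_le.1 (hB y (hyB y hy) z (hyB z hz) (θs y) (hθs y hy).1.le hθB)).1
    rw [abs_of_pos (by linarith), hθs0 y hy] at h1
    have h2 : m * c / 2 * y ^ (m - 1) * (z - y) ≤ D 0 z - D 0 y := by
      have hIcc : ∀ x ∈ Icc y z, x ∈ Ioo 0 y₁ := fun x hx => ⟨hy.1.trans_le hx.1, hx.2.trans_lt hz.2⟩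
      refine (convex_Icc y z).mul_sub_le_image_sub_of_le_deriv
        ((hslice 0 hmem0).continuousOn.mono fun x hx => hyr x (hIcc x hx))
        (((hslice 0 hmem0).differentiableOn (by simp)).mono fun x hx =>
          hyr x (hIcc x (interior_subset hx))) (fun x hx => ?_) y ⟨le_rfl, hyz.le⟩ z
        ⟨hyz.le, le_rfl⟩ hyz.le
      have hx' := hIcc x (interior_subset hx)
      refine le_trans ?_ (hall (hy0 x hx')).2.2.1
      have := (interior_subset hx).1
      have := hy.1
      gcongr
    have h3 : K * θs y ^ 2 ≤ K * (-3 * c / κ) * y * y ^ (m - 1) := by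
      have e : y * y ^ (m - 1) = y ^ m := by rw [← pow_succ']; congr 1; omega
      rw [mul_assoc _ y, e, mul_assoc]
      exact mul_le_mul_of_nonneg_left (hsq y hy) hK.le
    have h4 : K * (-3 * c / κ) * y * y ^ (m - 1) < m * c / 2 * y ^ (m - 1) :=
      mul_lt_mul_of_pos_right (hall (hy0 y hy)).2.2.2.1 (pow_pos hy.1 _)
    have h5 : 0 < D (θs y) z := by nlinarith
    by_contra hle
    push Not at hle
    have := (hanti z (hyA z hz)).antitoneOn ⟨(hθs z hz).1.le, (hθs z hz).2⟩
      ⟨(hθs y hy).1.le, (hθs y hy).2⟩ hle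
    simp only [hθs0 z hz] at this
    linarith
  -- For fixed small `θ > 0`, `D θ` is negative at `y = 0` and positive at `y₁ / 2`; the
  -- intermediate value theorem in `y` gives a point of the curve at this height.
  · have hyh : y₁ / 2 ∈ Ioo 0 y₁ := ⟨by linarith, by linarith⟩
    refine ⟨θs (y₁ / 2), (hθs _ hyh).1, fun θ hθ => ?_⟩
    have hθ₁' : θ ∈ Ico 0 θ₁ := ⟨hθ.1.le, hθ.2.trans (hθs _ hyh).2⟩
    have hpos : 0 < D θ (y₁ / 2) := by
      have := hanti _ (hyA _ hyh) hθ₁' ⟨(hθs _ hyh).1.le, (hθs _ hyh).2⟩ hθ.2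
      simpa only [hθs0 _ hyh] using this
    have hneg : D θ 0 < 0 := by
      have := hanti 0 ⟨by linarith, hrA⟩ ⟨le_rfl, hθ₁0⟩ hθ₁' hθ.1
      simpa only [hD00] using this
    have hθr : θ ∈ Ioo (-r) r := ⟨by linarith [hθ.1], by linarith [hθ₁'.2]⟩
    have hcont : ContinuousOn (D θ) (Icc 0 (y₁ / 2)) :=
      (hslice θ hθr).continuousOn.mono fun y hy =>
        ⟨by linarith [hy.1], by linarith [hy.2, (hyr _ hyh).2]⟩
    obtain ⟨y, hy, hy'⟩ := intermediate_value_Ioo (by linarith) hcont ⟨hneg, hpos⟩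
    have hyy : y ∈ Ioo 0 y₁ := ⟨hy.1, hy.2.trans hyh.2⟩
    refine ⟨y, hyy, ?_⟩
    refine (hanti y (hyA y hyy)).injOn ⟨(hθs y hyy).1.le, (hθs y hyy).2⟩ hθ₁' ?_
    simp only [hθs0 y hyy, hy']

end EvenFamilies

/-! ### Symmetries of Hermitian second-order systems and of their fundamental matrices. -/

open scoped Matrix

attribute [local instance] Matrix.linftyOpNormedRing Matrix.linftyOpNormedAlgebra

/-- Complex `2 × 2` matrices. -/
abbrev Mat2 := Matrix (Fin 2) (Fin 2) ℂ

/-- Complex `4 × 4` matrices, in `2 × 2` blocks. -/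
abbrev Mat4 := Matrix (Fin 2 ⊕ Fin 2) (Fin 2 ⊕ Fin 2) ℂ

/-- The matrix of the first-order form of `u'' + a u = 0`. -/
def firstOrder (a : Mat2) : Mat4 := Matrix.fromBlocks 0 1 (-a) 0

/-- The standard symplectic matrix. -/
def symplJ : Mat4 := Matrix.fromBlocks 0 1 (-1) 0

/-- Time reversal `(u, u') ↦ (u, -u')`. -/
def timeRev : Mat4 := Matrix.fromBlocks 1 0 0 (-1)

/-- The sign change of the first component. -/
def flip2 : Mat2 := !![-1, 0; 0, 1]

/-- The sign change of the first component of `u` and `u'`. -/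
def flip4 : Mat4 := Matrix.fromBlocks flip2 0 0 flip2

theorem flip2_mul_self : flip2 * flip2 = 1 := by
  ext i j; fin_cases i <;> fin_cases j <;> simp [flip2]

theorem flip2_conjTranspose : flip2ᴴ = flip2 := by
  ext i j; fin_cases i <;> fin_cases j <;> simp [flip2, Matrix.conjTranspose_apply]

theorem flip4_mul_self : flip4 * flip4 = 1 := by
  simp [flip4, Matrix.fromBlocks_multiply, flip2_mul_self]

theorem symplJ_mul_self : symplJ * symplJ = -1 := by
  simp only [symplJ, Matrix.fromBlocks_multiply, ← Matrix.fromBlocks_one, Matrix.fromBlocks_neg]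
  simp

theorem timeRev_mul_self : timeRev * timeRev = 1 := by
  simp [timeRev, Matrix.fromBlocks_multiply]

theorem timeRev_mul_flip4 : timeRev * flip4 = flip4 * timeRev := by
  simp [timeRev, flip4, Matrix.fromBlocks_multiply]

theorem flip4_conjTranspose : flip4ᴴ = flip4 := by
  simp [flip4, Matrix.fromBlocks_conjTranspose, flip2_conjTranspose]

theorem flip4_mul_symplJ : flip4 * symplJ = symplJ * flip4 := by
  simp [symplJ, flip4, Matrix.fromBlocks_multiply]

theorem timeRev_mul_firstOrder (a : Mat2) : timeRev * firstOrder a = -(firstOrder a * timeRev) := by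
  simp [timeRev, firstOrder, Matrix.fromBlocks_multiply, Matrix.fromBlocks_neg]

theorem flip4_mul_firstOrder (a : Mat2) :
    flip4 * firstOrder (flip2 * a * flip2) = firstOrder a * flip4 := by
  simp [flip4, firstOrder, Matrix.fromBlocks_multiply, mul_assoc]
  rw [← mul_assoc, flip2_mul_self, one_mul]

/-- Infinitesimal form of symplecticity; it is exactly where Hermitian symmetry of `a` enters. -/
theorem firstOrder_symplJ {a : Mat2} (ha : aᴴ = a) :
    (firstOrder a)ᴴ * symplJ = -(symplJ * firstOrder a) := by
  simp [symplJ, firstOrder, Matrix.fromBlocks_multiply, Matrix.fromBlocks_conjTranspose,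
    Matrix.fromBlocks_neg, ha]

theorem hasDerivAt_conjTranspose {Z : ℝ → Mat4} {Z' : Mat4} {t : ℝ} (h : HasDerivAt Z Z' t) :
    HasDerivAt (fun t => (Z t)ᴴ) Z'ᴴ t :=
  hasDerivAt_pi.2 fun i => hasDerivAt_pi.2 fun j =>
    (hasDerivAt_pi.1 (hasDerivAt_pi.1 h j) i).star

theorem hasDerivAt_replicateCol {X : ℝ → Fin 2 ⊕ Fin 2 → ℂ} {X' : Fin 2 ⊕ Fin 2 → ℂ} {t : ℝ}
    (h : HasDerivAt X X' t) :
    HasDerivAt (fun t => (Matrix.replicateCol (Fin 2 ⊕ Fin 2) (X t) : Mat4))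
      (Matrix.replicateCol (Fin 2 ⊕ Fin 2) X') t :=
  hasDerivAt_pi.2 fun i => hasDerivAt_pi.2 fun _ => hasDerivAt_pi.1 h i

theorem hasDerivAt_mulVec {Z : ℝ → Mat4} {Z' : Mat4} {t : ℝ} (h : HasDerivAt Z Z' t)
    (v : Fin 2 ⊕ Fin 2 → ℂ) : HasDerivAt (fun t => Z t *ᵥ v) (Z' *ᵥ v) t := by
  refine hasDerivAt_pi.2 fun i => ?_
  simp only [Matrix.mulVec, dotProduct]
  exact HasDerivAt.fun_sum fun j _ => (hasDerivAt_pi.1 (hasDerivAt_pi.1 h i) j).mul_const _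

/-- `Z` is the fundamental matrix of `u'' + a(t) u = 0` with `a` Hermitian. -/
structure IsFundamental (a : ℝ → Mat2) (Z : ℝ → Mat4) : Prop where
  hermitian : ∀ t, (a t)ᴴ = a t
  hasDerivAt : ∀ t, HasDerivAt Z (firstOrder (a t) * Z t) t
  zero : Z 0 = 1

namespace IsFundamental

variable {a : ℝ → Mat2} {Z : ℝ → Mat4}

/-- The symplectic pairing of two solutions has derivative zero. Pairing `Z` with an arbitrary
solution `W`, rather than with itself only, also yields uniqueness: the pairing determines `W`,
since `Z` has an explicit symplectic inverse. -/
theorem conjTranspose_symplJ_mul (h : IsFundamental a Z) {W : ℝ → Mat4}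
    (hW : ∀ t, HasDerivAt W (firstOrder (a t) * W t) t) (t : ℝ) :
    (Z t)ᴴ * symplJ * W t = symplJ * W 0 := by
  have hd : ∀ t, HasDerivAt (fun t => (Z t)ᴴ * symplJ * W t) 0 t := by
    intro t
    have h1 := ((hasDerivAt_conjTranspose (h.hasDerivAt t)).mul_const symplJ).mul (hW t)
    refine h1.congr_deriv ?_
    rw [Matrix.conjTranspose_mul, mul_assoc (Z t)ᴴ, firstOrder_symplJ (h.hermitian t)]
    simp only [mul_neg, neg_mul, mul_assoc]
    simp
  have := is_const_of_deriv_eq_zero (fun t => (hd t).differentiableAt) (fun t => (hd t).deriv) t 0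
  simpa [h.zero] using this

theorem conjTranspose_symplJ_mul_self (h : IsFundamental a Z) (t : ℝ) :
    (Z t)ᴴ * symplJ * Z t = symplJ := by
  rw [h.conjTranspose_symplJ_mul h.hasDerivAt, h.zero, mul_one]

theorem mul_inverse (h : IsFundamental a Z) (t : ℝ) :
    Z t * (-(symplJ * (Z t)ᴴ * symplJ)) = 1 := by
  rw [mul_eq_one_comm, neg_mul, mul_assoc, mul_assoc, ← mul_assoc (Z t)ᴴ,
    h.conjTranspose_symplJ_mul_self, symplJ_mul_self, neg_neg]

theorem eq_mul (h : IsFundamental a Z) {W : ℝ → Mat4}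
    (hW : ∀ t, HasDerivAt W (firstOrder (a t) * W t) t) (t : ℝ) : W t = Z t * W 0 := by
  calc W t = Z t * (-(symplJ * (Z t)ᴴ * symplJ)) * W t := by rw [h.mul_inverse, one_mul]
    _ = -(Z t * (symplJ * ((Z t)ᴴ * symplJ * W t))) := by simp only [mul_assoc, neg_mul, mul_neg]
    _ = Z t * W 0 := by
      rw [h.conjTranspose_symplJ_mul hW, ← mul_assoc symplJ, symplJ_mul_self]; simp

theorem eq_mulVec (h : IsFundamental a Z) {X : ℝ → Fin 2 ⊕ Fin 2 → ℂ}
    (hX : ∀ t, HasDerivAt X (firstOrder (a t) *ᵥ X t) t) (t : ℝ) : X t = Z t *ᵥ X 0 := by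
  have hW : ∀ t, HasDerivAt (fun t => (Matrix.replicateCol (Fin 2 ⊕ Fin 2) (X t) : Mat4))
      (firstOrder (a t) * Matrix.replicateCol (Fin 2 ⊕ Fin 2) (X t)) t := fun t =>
    (hasDerivAt_replicateCol (hX t)).congr_deriv (Matrix.replicateCol_mulVec _ _)
  have := h.eq_mul hW t
  rw [← Matrix.replicateCol_mulVec] at this
  exact Matrix.replicateCol_injective this

theorem hasDerivAt_comp_neg (h : IsFundamental a Z) (t : ℝ) :
    HasDerivAt (fun t => Z (-t)) (-(firstOrder (a (-t)) * Z (-t))) t := by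
  have := HasDerivAt.scomp (g₁ := Z) (h := fun t => -t) t (h.hasDerivAt (-t)) (hasDerivAt_neg t)
  exact this.congr_deriv (by simp)

/-- For even `a`, the time-reversed matrix solves the same initial value problem. -/
theorem neg (h : IsFundamental a Z) (heven : ∀ t, a (-t) = a t) (t : ℝ) :
    Z (-t) = timeRev * Z t * timeRev := by
  have hW : ∀ t, HasDerivAt (fun t => timeRev * Z (-t) * timeRev)
      (firstOrder (a t) * (timeRev * Z (-t) * timeRev)) t := by
    intro t
    refine (((h.hasDerivAt_comp_neg t).const_mul timeRev).mul_const timeRev).congr_deriv ?_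
    rw [heven, mul_neg, ← mul_assoc, timeRev_mul_firstOrder]
    simp only [neg_mul, neg_neg, mul_assoc]
  have h1 := h.eq_mul hW t
  simp only [neg_zero, h.zero, mul_one, timeRev_mul_self] at h1
  rw [← h1]
  simp only [mul_assoc, timeRev_mul_self, mul_one]
  rw [← mul_assoc, timeRev_mul_self, one_mul]

theorem hasDerivAt_flip (h : IsFundamental a Z)
    (hshift : ∀ t, a (t + Real.pi) = flip2 * a t * flip2) (t : ℝ) :
    HasDerivAt (fun t => flip4 * Z (t + Real.pi)) (firstOrder (a t) * (flip4 * Z (t + Real.pi))) t := by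
  refine (((h.hasDerivAt (t + Real.pi)).comp_add_const t Real.pi).const_mul flip4).congr_deriv ?_
  rw [hshift, ← mul_assoc, flip4_mul_firstOrder, mul_assoc]

theorem shift (h : IsFundamental a Z) (hshift : ∀ t, a (t + Real.pi) = flip2 * a t * flip2)
    (t : ℝ) : flip4 * Z (t + Real.pi) = Z t * (flip4 * Z Real.pi) := by
  simpa using h.eq_mul (h.hasDerivAt_flip hshift) t

/-- Long-time behaviour is reduced to powers of the half-period matrix; the left factor `flip4 ^ k`
only changes signs. -/
theorem shift_iterate (h : IsFundamental a Z)
    (hshift : ∀ t, a (t + Real.pi) = flip2 * a t * flip2) (k : ℕ) (t : ℝ) :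
    Z (t + k * Real.pi) = flip4 ^ k * Z t * (flip4 * Z Real.pi) ^ k := by
  induction k generalizing t with
  | zero => simp
  | succ k ih =>
    have e : t + ((k + 1 : ℕ) : ℝ) * Real.pi = (t + Real.pi) + k * Real.pi := by push_cast; ring
    have e2 : Z (t + Real.pi) = flip4 * (Z t * (flip4 * Z Real.pi)) := by
      rw [← h.shift hshift, ← mul_assoc, flip4_mul_self, one_mul]
    rw [e, ih, e2, pow_succ flip4, pow_succ' (flip4 * Z Real.pi)]
    simp only [mul_assoc]

/-- The half-period monodromy, composed with the sign change, in block form. -/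
theorem exists_blocks (h : IsFundamental a Z) (heven : ∀ t, a (-t) = a t)
    (hshift : ∀ t, a (t + Real.pi) = flip2 * a t * flip2) :
    ∃ P B C : Mat2, flip4 * Z Real.pi = Matrix.fromBlocks P B C Pᴴ ∧ Bᴴ = B ∧ Cᴴ = C ∧
      P * P - B * C = 1 ∧ P * B = B * Pᴴ ∧ C * P = Pᴴ * C := by
  set M := flip4 * Z Real.pi with hM
  -- The shift relation at `-π`, combined with reversibility, expresses `M⁻¹` through time reversal.
  have h1 : timeRev * M * timeRev * M = 1 := by
    have := h.shift hshift (-Real.pi)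
    rw [neg_add_cancel, h.zero, mul_one, h.neg heven, ← hM] at this
    calc timeRev * M * timeRev * M = flip4 * (timeRev * Z Real.pi * timeRev * M) := by
          rw [hM]; simp only [← mul_assoc]; rw [timeRev_mul_flip4]
      _ = 1 := by rw [← this, flip4_mul_self]
  have h2 : Mᴴ * symplJ * M = symplJ := by
    calc Mᴴ * symplJ * M = (Z Real.pi)ᴴ * (flip4 * symplJ * flip4) * Z Real.pi := by
          rw [hM, Matrix.conjTranspose_mul, flip4_conjTranspose]; simp only [mul_assoc]
      _ = symplJ := by
          rw [flip4_mul_symplJ, mul_assoc symplJ, flip4_mul_self, mul_one,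
            h.conjTranspose_symplJ_mul_self]
  -- Both sides are the inverse of `M`, one by reversibility and one by symplecticity. Comparing
  -- blocks gives the Hermitian structure.
  have h3 : timeRev * M * timeRev = -(symplJ * Mᴴ * symplJ) := by
    have h4 : -(symplJ * Mᴴ * symplJ) * M = 1 := by
      rw [neg_mul, mul_assoc, mul_assoc, ← mul_assoc Mᴴ, h2, symplJ_mul_self, neg_neg]
    rw [mul_eq_one_comm] at h4
    calc timeRev * M * timeRev = timeRev * M * timeRev * (M * (-(symplJ * Mᴴ * symplJ))) := by
          rw [h4, mul_one]
      _ = _ := by rw [← mul_assoc, h1, one_mul]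
  obtain ⟨P, B, C, E, hblocks⟩ : ∃ P B C E, M = Matrix.fromBlocks P B C E :=
    ⟨_, _, _, _, (Matrix.fromBlocks_toBlocks M).symm⟩
  rw [hblocks] at h1 h3
  simp only [timeRev, symplJ, Matrix.fromBlocks_multiply, Matrix.fromBlocks_conjTranspose,
    Matrix.fromBlocks_neg, Matrix.fromBlocks_inj, ← Matrix.fromBlocks_one] at h1 h3
  simp at h1 h3
  obtain ⟨k1, k2, k3, -⟩ := h1
  obtain ⟨l1, l2, l3, l4⟩ := h3
  refine ⟨P, B, C, by rw [hblocks, l4], l2.symm, l3.symm, ?_, ?_, ?_⟩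
  · rw [← k1]; abel
  · rw [← l4]
    rw [add_eq_zero_iff_eq_neg, neg_neg] at k2
    exact k2
  · rw [← l4]
    rw [neg_add_eq_zero] at k3
    exact k3

end IsFundamental

/-! ### Boundedness and growth of powers of the half-period matrix. -/

section Floquet

variable {P B C : Mat2}

/-- With `μ = cos φ` this is the Chebyshev recurrence, solved by sines of multiples of `φ`.
Multiplying by `sin φ > 0` avoids denominators. -/
theorem exists_bound_of_recurrence {E : Type*} [NormedAddCommGroup E] [NormedSpace ℝ E]
    {s : ℕ → E} {μ : ℝ} (hμ : |μ| < 1)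
    (hs : ∀ k, s (k + 2) = (2 * μ) • s (k + 1) - s k) : ∃ K, ∀ k, ‖s k‖ ≤ K := by
  obtain ⟨h1, h2⟩ := abs_lt.1 hμ
  set φ := Real.arccos μ with hφ
  have hcos : Real.cos φ = μ := Real.cos_arccos h1.le h2.le
  have hsin : 0 < Real.sin φ := by
    rw [hφ, Real.sin_arccos]
    exact Real.sqrt_pos.2 (by nlinarith)
  -- Two consecutive terms are carried through the induction. `k - 1` is a real subtraction, equal
  -- to `-1` at `k = 0`.
  have key : ∀ k : ℕ, Real.sin φ • s k = Real.sin (k * φ) • s 1 - Real.sin ((k - 1) * φ) • s 0 ∧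
      Real.sin φ • s (k + 1) = Real.sin ((k + 1) * φ) • s 1 - Real.sin (k * φ) • s 0 := by
    intro k
    induction k with
    | zero => simp
    | succ k ih =>
      obtain ⟨ih1, ih2⟩ := ih
      have e1 : Real.sin ((k + 1 + 1) * φ) =
          2 * μ * Real.sin ((k + 1) * φ) - Real.sin (k * φ) := by
        have a1 : ((k : ℝ) + 1 + 1) * φ = (k + 1) * φ + φ := by ring
        have a2 : (k : ℝ) * φ = (k + 1) * φ - φ := by ring
        rw [a1, a2, Real.sin_add, Real.sin_sub, hcos]; ring
      have e2 : Real.sin ((k + 1) * φ) =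
          2 * μ * Real.sin (k * φ) - Real.sin ((k - 1) * φ) := by
        have a1 : ((k : ℝ) + 1) * φ = k * φ + φ := by ring
        have a2 : ((k : ℝ) - 1) * φ = k * φ - φ := by ring
        rw [a1, a2, Real.sin_add, Real.sin_sub, hcos]; ring
      push_cast
      refine ⟨by rw [ih2]; simp, ?_⟩
      rw [hs k, smul_sub, smul_comm, ih1, ih2, e1, e2]
      module
  refine ⟨(‖s 1‖ + ‖s 0‖) / Real.sin φ, fun k => ?_⟩
  rw [le_div_iff₀ hsin]
  calc ‖s k‖ * Real.sin φ = ‖Real.sin φ • s k‖ := by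
        rw [norm_smul, Real.norm_of_nonneg hsin.le, mul_comm]
    _ ≤ ‖Real.sin (k * φ) • s 1‖ + ‖Real.sin ((k - 1) * φ) • s 0‖ := by
        rw [(key k).1]; exact norm_sub_le _ _
    _ ≤ ‖s 1‖ + ‖s 0‖ := by
        simp only [norm_smul, Real.norm_eq_abs]
        exact add_le_add (mul_le_of_le_one_left (norm_nonneg _) (Real.abs_sin_le_one _))
          (mul_le_of_le_one_left (norm_nonneg _) (Real.abs_sin_le_one _))

/-- These are the Chebyshev values `T_k(μ)`; for `μ > 1` each ratio of consecutive terms is at least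
`μ`. -/
theorem pow_le_of_recurrence {τ : ℕ → ℝ} {μ : ℝ} (hμ : 1 < μ) (h0 : τ 0 = 1) (h1 : τ 1 = μ)
    (h : ∀ k, τ (k + 2) = 2 * μ * τ (k + 1) - τ k) (k : ℕ) : μ ^ k ≤ τ k := by
  have key : ∀ k, 0 < τ k ∧ μ * τ k ≤ τ (k + 1) := by
    intro k
    induction k with
    | zero => rw [h0, h1]; simp
    | succ k ih =>
      refine ⟨lt_of_lt_of_le (mul_pos (by linarith) ih.1) ih.2, ?_⟩
      rw [h k]
      have a1 : τ k ≤ μ * τ k := le_mul_of_one_le_left ih.1.le hμ.le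
      have a2 : τ (k + 1) ≤ μ * τ (k + 1) := le_mul_of_one_le_left (by linarith [ih.1]) hμ.le
      linarith [ih.2]
  induction k with
  | zero => simp [h0]
  | succ k ih =>
    rw [pow_succ']
    exact (mul_le_mul_of_nonneg_left ih (by linarith)).trans (key k).2

/-- Determinants of `(1 - P)(1 + P) = -BC`; in dimension two the sign disappears. The left factors
are the characteristic polynomial of `P` at `1` and at `-1`. -/
theorem det_sub_one_mul_det_add_one (h : P * P - B * C = 1) :
    (1 - P.trace + P.det) * (1 + P.trace + P.det) = B.det * C.det := by
  have h1 : (1 - P) * (1 + P) = -(B * C) := by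
    have : P * P = 1 + B * C := by rw [← h]; abel
    rw [sub_mul, one_mul, mul_add, mul_one, this]; abel
  have h2 := congrArg Matrix.det h1
  rw [Matrix.det_mul, Matrix.det_neg, Matrix.det_mul] at h2
  simp only [Fintype.card_fin, even_two, Even.neg_pow, one_pow, one_mul] at h2
  rw [← h2]
  simp [Matrix.det_fin_two, Matrix.trace_fin_two]
  ring

theorem im_det_eq_zero (hB : Bᴴ = B) : B.det.im = 0 := by
  have : star B.det = B.det := by rw [← Matrix.det_conjTranspose, hB]
  exact Complex.conj_eq_iff_im.1 this

/-- An invertible `B` conjugates `P` to `Pᴴ`, so the characteristic polynomial of `P` is real. -/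
theorem im_trace_det_eq_zero (hB : B.det ≠ 0) (hPB : P * B = B * Pᴴ) :
    P.trace.im = 0 ∧ P.det.im = 0 := by
  have hu : IsUnit B.det := isUnit_iff_ne_zero.2 hB
  have h1 : Pᴴ = B⁻¹ * (P * B) := by
    rw [hPB, ← mul_assoc, Matrix.nonsing_inv_mul _ hu, one_mul]
  constructor
  · have : star P.trace = P.trace := by
      rw [← Matrix.trace_conjTranspose, h1, Matrix.trace_mul_comm, mul_assoc,
        Matrix.mul_nonsing_inv _ hu, mul_one]
    exact Complex.conj_eq_iff_im.1 this
  · have : star P.det = P.det := by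
      have h2 := congrArg Matrix.det hPB
      rw [Matrix.det_mul, Matrix.det_mul, Matrix.det_conjTranspose, mul_comm] at h2
      exact (mul_left_cancel₀ hB h2).symm
    exact Complex.conj_eq_iff_im.1 this

theorem sq_eq_of_trace_det (P : Mat2) : P * P = P.trace • P - P.det • (1 : Mat2) := by
  ext i j
  fin_cases i <;> fin_cases j <;>
    simp [Matrix.mul_apply, Fin.sum_univ_two, Matrix.trace_fin_two, Matrix.det_fin_two] <;> ring

/-- `M + M⁻¹` for the half-period monodromy `M`. -/
def symSum (P : Mat2) : Mat4 := Matrix.fromBlocks ((2 : ℂ) • P) 0 0 ((2 : ℂ) • Pᴴ)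

/-- Multiplied out, this is `M + M⁻¹ = symSum P`; it makes the powers of `M` satisfy a two-term
recurrence with block diagonal coefficient. -/
theorem fromBlocks_sq (hP : P * P - B * C = 1) (hPB : P * B = B * Pᴴ) (hCP : C * P = Pᴴ * C)
    (hB : Bᴴ = B) (hC : Cᴴ = C) :
    (Matrix.fromBlocks P B C Pᴴ) * (Matrix.fromBlocks P B C Pᴴ) =
      symSum P * (Matrix.fromBlocks P B C Pᴴ) - 1 := by
  have hP' : B * C = P * P - 1 := by rw [← hP]; abel
  have hPP : C * B = Pᴴ * Pᴴ - 1 := by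
    have := congrArg Matrix.conjTranspose hP'
    simpa [Matrix.conjTranspose_mul, hB, hC] using this
  rw [eq_sub_iff_add_eq, symSum, ← Matrix.fromBlocks_one]
  simp only [Matrix.fromBlocks_multiply, Matrix.fromBlocks_add, Matrix.fromBlocks_inj]
  rw [hP', hPP, ← hPB, hCP]
  refine ⟨?_, ?_, ?_, ?_⟩ <;> simp [two_smul, add_mul]
  · abel
  · abel

/-- The hypotheses say that `P` has two distinct real eigenvalues `μ`, `ν` in `(-1, 1)`. On each
eigenspace of `M + M⁻¹` the powers of `M` obey a scalar recurrence with bounded solutions; as `μ ≠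
ν`, the eigenprojections recombine to `M ^ k`. -/
theorem exists_bound_pow {t d : ℝ} (hP : P * P - B * C = 1) (hPB : P * B = B * Pᴴ)
    (hCP : C * P = Pᴴ * C) (hB : Bᴴ = B) (hC : Cᴴ = C) (ht : P.trace = t) (hd : P.det = d)
    (hdisc : 4 * d < t ^ 2) (ht2 : |t| < 2) (hneg : 0 < 1 + t + d) (hpos : 0 < 1 - t + d) :
    ∃ K : ℝ, ∀ k : ℕ, ‖(Matrix.fromBlocks P B C Pᴴ : Mat4) ^ k‖ ≤ K := by
  set M : Mat4 := Matrix.fromBlocks P B C Pᴴ with hM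
  set s := √(t ^ 2 - 4 * d) with hs
  have hs0 : 0 < s := Real.sqrt_pos.2 (by linarith)
  have hs2 : s ^ 2 = t ^ 2 - 4 * d := Real.sq_sqrt (by linarith)
  obtain ⟨ht3, ht4⟩ := abs_lt.1 ht2
  have hs3 : s < 2 - t := lt_of_pow_lt_pow_left₀ 2 (by linarith) (by rw [hs2]; nlinarith)
  have hs4 : s < 2 + t := lt_of_pow_lt_pow_left₀ 2 (by linarith) (by rw [hs2]; nlinarith)
  set μ := (t + s) / 2 with hμ
  set ν := (t - s) / 2 with hν
  have hsum : μ + ν = t := by rw [hμ, hν]; ring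
  have hprod : μ * ν = d := by rw [hμ, hν]; linear_combination -hs2 / 4
  have hμ1 : |μ| < 1 := abs_lt.2 ⟨by linarith, by linarith⟩
  have hν1 : |ν| < 1 := abs_lt.2 ⟨by linarith, by linarith⟩
  have hM2 : M * M = symSum P * M - 1 := fromBlocks_sq hP hPB hCP hB hC
  have hPsq : P * P = (t : ℂ) • P - (d : ℂ) • (1 : Mat2) := by
    rw [← ht, ← hd]; exact sq_eq_of_trace_det P
  have hPsq' : Pᴴ * Pᴴ = (t : ℂ) • Pᴴ - (d : ℂ) • (1 : Mat2) := by
    have := congrArg Matrix.conjTranspose hPsq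
    simpa [Matrix.conjTranspose_mul] using this
  have hN : symSum P * symSum P = (2 * t) • symSum P - (4 * d) • (1 : Mat4) := by
    rw [symSum, Matrix.fromBlocks_multiply]
    simp only [Matrix.smul_mul, Matrix.mul_smul, hPsq, hPsq', ← Matrix.fromBlocks_one,
      Matrix.fromBlocks_smul, Matrix.mul_zero, Matrix.zero_mul, smul_zero, add_zero, zero_add]
    rw [sub_eq_add_neg (Matrix.fromBlocks _ _ _ _), Matrix.fromBlocks_neg, Matrix.fromBlocks_add]
    rw [Matrix.fromBlocks_inj]
    refine ⟨?_, by simp, by simp, ?_⟩ <;>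
    · ext i j
      simp
      ring
  -- Cayley–Hamilton for `symSum P`, whose eigenvalues are `2μ` and `2ν`.
  have hcomb : ∀ x y : ℝ, x + y = t → x * y = d →
      (symSum P - (2 * x) • (1 : Mat4)) * (symSum P - (2 * y) • (1 : Mat4)) = 0 := by
    intro x y hxy hxy'
    simp only [sub_mul, mul_sub, hN, smul_mul_assoc, mul_smul_comm, one_mul, mul_one, ← hxy,
      ← hxy']
    module
  have hrec : ∀ x y : ℝ, x + y = t → x * y = d → |x| < 1 →
      ∃ K, ∀ k : ℕ, ‖(symSum P - (2 * y) • (1 : Mat4)) * M ^ k‖ ≤ K := by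
    intro x y hxy hxy' hx
    refine exists_bound_of_recurrence hx fun k => ?_
    have h1 : M ^ (k + 2) = symSum P * M ^ (k + 1) - M ^ k := by
      rw [show k + 2 = 2 + k by ring, pow_add, pow_two, hM2, sub_mul, one_mul, mul_assoc, ← pow_succ']
    have h2 : (symSum P - (2 * y) • (1 : Mat4)) * (symSum P * M ^ (k + 1)) =
        (2 * x) • ((symSum P - (2 * y) • (1 : Mat4)) * M ^ (k + 1)) := by
      have := congrArg (· * M ^ (k + 1)) (hcomb y x (by linarith) (by linarith))
      simp only [zero_mul] at this
      rw [mul_assoc, sub_mul (symSum P) ((2 * x) • (1 : Mat4)), smul_mul_assoc, one_mul, mul_sub,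
        mul_smul_comm, sub_eq_zero] at this
      exact this
    rw [h1, mul_sub, h2]
  obtain ⟨K1, hK1⟩ := hrec μ ν hsum hprod hμ1
  obtain ⟨K2, hK2⟩ := hrec ν μ (by linarith) (by linarith) hν1
  refine ⟨(K1 + K2) / (2 * s), fun k => ?_⟩
  rw [le_div_iff₀ (by positivity)]
  have e : (2 * s) • M ^ k = (symSum P - (2 * ν) • (1 : Mat4)) * M ^ k
      - (symSum P - (2 * μ) • (1 : Mat4)) * M ^ k := by
    simp only [sub_mul, smul_mul_assoc, one_mul]
    have : s = μ - ν := by rw [hμ, hν]; ring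
    rw [this]
    module
  calc ‖M ^ k‖ * (2 * s) = ‖(2 * s) • M ^ k‖ := by
        rw [norm_smul, Real.norm_of_nonneg (by positivity), mul_comm]
    _ ≤ _ := by rw [e]; exact (norm_sub_le _ _).trans (add_le_add (hK1 k) (hK2 k))

/-- A negative value of the characteristic polynomial at `1` gives a real eigenvalue `μ > 1` of `P`.
Starting from `(v, 0)` with `P v = μ v`, the upper half of the `k`-th iterate is `T_k(μ) v`. -/
theorem exists_unbounded_pow {t d : ℝ} (hP : P * P - B * C = 1) (hPB : P * B = B * Pᴴ)
    (hCP : C * P = Pᴴ * C) (hB : Bᴴ = B) (hC : Cᴴ = C) (ht : P.trace = t) (hd : P.det = d)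
    (hneg : 1 - t + d < 0) :
    ∃ v : Fin 2 → ℂ, v ≠ 0 ∧ ∃ μ : ℝ, 1 < μ ∧ ∀ k : ℕ, ∃ τ : ℝ, μ ^ k ≤ τ ∧ ∀ i,
      ((Matrix.fromBlocks P B C Pᴴ : Mat4) ^ k *ᵥ Sum.elim v 0) (Sum.inl i) = τ * v i := by
  set M : Mat4 := Matrix.fromBlocks P B C Pᴴ with hM
  have hdisc : (t - 2) ^ 2 < t ^ 2 - 4 * d := by nlinarith
  set s := √(t ^ 2 - 4 * d) with hs
  have hs2 : s ^ 2 = t ^ 2 - 4 * d := Real.sq_sqrt (by nlinarith [sq_nonneg (t - 2)])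
  set μ := (t + s) / 2 with hμ
  have hs3 : 2 - t < s := lt_of_pow_lt_pow_left₀ 2 (Real.sqrt_nonneg _) (by rw [hs2]; nlinarith)
  have hμ1 : 1 < μ := by linarith
  have hroot : μ ^ 2 - t * μ + d = 0 := by rw [hμ]; linear_combination hs2 / 4
  have hdet : (P - (μ : ℂ) • (1 : Mat2)).det = 0 := by
    have : (P - (μ : ℂ) • (1 : Mat2)).det = (μ : ℂ) ^ 2 - P.trace * μ + P.det := by
      simp [Matrix.det_fin_two, Matrix.trace_fin_two]; ring
    rw [this, ht, hd]
    exact_mod_cast hroot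
  obtain ⟨v, hv, hPv⟩ := Matrix.exists_mulVec_eq_zero_iff.2 hdet
  rw [Matrix.sub_mulVec, Matrix.smul_mulVec, Matrix.one_mulVec, sub_eq_zero] at hPv
  have hM2 : M * M = symSum P * M - 1 := fromBlocks_sq hP hPB hCP hB hC
  set X : ℕ → Fin 2 ⊕ Fin 2 → ℂ := fun k => M ^ k *ᵥ Sum.elim v 0 with hX
  have hrec : ∀ k, X (k + 2) = symSum P *ᵥ X (k + 1) - X k := by
    intro k
    have : M ^ (k + 2) = symSum P * M ^ (k + 1) - M ^ k := by
      rw [show k + 2 = 2 + k by ring, pow_add, pow_two, hM2, sub_mul, one_mul, mul_assoc, ← pow_succ']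
    simp only [hX, this, Matrix.sub_mulVec, Matrix.mulVec_mulVec]
  -- The pair of consecutive values turns the two-term recurrence into a first-order one.
  let τ : ℕ → ℝ × ℝ := fun k => Nat.rec (1, μ) (fun _ p => (p.2, 2 * μ * p.2 - p.1)) k
  have hτ : ∀ k, (τ (k + 1)).1 = (τ k).2 := fun k => rfl
  have hτ2 : ∀ k, (τ (k + 1)).2 = 2 * μ * (τ k).2 - (τ k).1 := fun k => rfl
  have htop : ∀ k, (X k ∘ Sum.inl = ((τ k).1 : ℂ) • v) ∧ (X (k + 1) ∘ Sum.inl = ((τ k).2 : ℂ) • v) := by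
    intro k
    induction k with
    | zero =>
      constructor
      · simp [hX, τ]
      · simp [hX, τ, hM, Matrix.fromBlocks_mulVec, hPv]
    | succ k ih =>
      refine ⟨ih.2, ?_⟩
      rw [show k + 1 + 1 = k + 2 from rfl, hrec k, hτ2]
      have : (symSum P *ᵥ X (k + 1)) ∘ Sum.inl = (2 : ℂ) • P *ᵥ (X (k + 1) ∘ Sum.inl) := by
        rw [symSum, Matrix.fromBlocks_mulVec]
        simp [Matrix.smul_mulVec]
      have e : (symSum P *ᵥ X (k + 1) - X k) ∘ Sum.inl
          = (symSum P *ᵥ X (k + 1)) ∘ Sum.inl - X k ∘ Sum.inl := rfl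
      rw [e, this, ih.1, ih.2, Matrix.mulVec_smul, hPv]
      push_cast
      module
  refine ⟨v, hv, μ, hμ1, fun k => ⟨(τ k).1, ?_, fun i => ?_⟩⟩
  · exact pow_le_of_recurrence (τ := fun k => (τ k).1) hμ1 rfl rfl (fun k => hτ2 k) k
  · exact congrFun (htop k).1 i

end Floquet

/-! ### From real solutions of the variational system to the half-period matrix. -/

section Translation

variable {V W : ℝ → ℝ} {Q₀ Qπ : ℝ → ℝ → ℝ} {T : ℝ → ℝ} {δ y : ℝ}

/-- The Hermitian coefficient matrix of the variational system in the complex variables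
`(rπ + i jπ, r₀ + i j₀)`. -/
noncomputable def coeffMatrix (V W : ℝ → ℝ) (Q₀ Qπ : ℝ → ℝ → ℝ) (T : ℝ → ℝ) (δ y τ : ℝ) : Mat2 :=
  !![(coeff₁ V W Q₀ Qπ T δ y τ : ℂ),
      coeff₂ V W Q₀ Qπ T y τ + Complex.I * coeff₃ V W Qπ T δ y τ;
    coeff₂ V W Q₀ Qπ T y τ - Complex.I * coeff₃ V W Qπ T δ y τ,
      (coeff₄ V W Q₀ Qπ T δ y τ : ℂ)]

/-- The first-order complex state of a real motion. -/
noncomputable def complexState (rπ jπ r₀ j₀ : ℝ → ℝ) (t : ℝ) : Fin 2 ⊕ Fin 2 → ℂ :=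
  Sum.elim ![rπ t + Complex.I * jπ t, r₀ t + Complex.I * j₀ t]
    ![deriv rπ t + Complex.I * deriv jπ t, deriv r₀ t + Complex.I * deriv j₀ t]

theorem hasDerivAt_of_contDiff_two {f : ℝ → ℝ} (hf : ContDiff ℝ 2 f) (t : ℝ) :
    HasDerivAt f (deriv f t) t ∧ HasDerivAt (deriv f) (iteratedDeriv 2 f t) t := by
  have h1 : ContDiff ℝ 1 (deriv f) := by
    have : ContDiff ℝ (1 + 1) f := by norm_num; exact hf
    exact this.deriv'
  refine ⟨(hf.differentiable (by simp) t).hasDerivAt, ?_⟩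
  rw [iteratedDeriv_succ, iteratedDeriv_one]
  exact (h1.differentiable (by simp) t).hasDerivAt

theorem contDiff_two_of_hasDerivAt {f f' f'' : ℝ → ℝ} (hf : ∀ t, HasDerivAt f (f' t) t)
    (hf' : ∀ t, HasDerivAt f' (f'' t) t) (hc : Continuous f'') :
    ContDiff ℝ 2 f ∧ iteratedDeriv 2 f = f'' := by
  have e1 : deriv f = f' := funext fun t => (hf t).deriv
  have e2 : deriv f' = f'' := funext fun t => (hf' t).deriv
  constructor
  · have h1 : ContDiff ℝ 1 f' :=
      contDiff_one_iff_deriv.2 ⟨fun t => (hf' t).differentiableAt, e2 ▸ hc⟩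
    have : ContDiff ℝ (1 + 1) f := contDiff_succ_iff_deriv.2
      ⟨fun t => (hf t).differentiableAt, by simp, e1 ▸ h1⟩
    norm_num at this
    exact this
  · rw [iteratedDeriv_succ, iteratedDeriv_one, e1, e2]

theorem hasDerivAt_ofReal_add {f g : ℝ → ℝ} {f' g' t : ℝ} (hf : HasDerivAt f f' t)
    (hg : HasDerivAt g g' t) :
    HasDerivAt (fun t => (f t : ℂ) + Complex.I * g t) (f' + Complex.I * g') t :=
  hf.ofReal_comp.add (hg.ofReal_comp.const_mul Complex.I)

theorem firstOrder_mulVec (a : Mat2) (v w : Fin 2 → ℂ) :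
    firstOrder a *ᵥ Sum.elim v w = Sum.elim w (-(a *ᵥ v)) := by
  rw [firstOrder, Matrix.fromBlocks_mulVec]
  simp [Matrix.neg_mulVec]

theorem IsSolution.hasDerivAt_complexState {rπ jπ r₀ j₀ : ℝ → ℝ}
    (h : IsSolution V W Q₀ Qπ T δ y rπ jπ r₀ j₀) (t : ℝ) :
    HasDerivAt (complexState rπ jπ r₀ j₀)
      (firstOrder (coeffMatrix V W Q₀ Qπ T δ y t) *ᵥ complexState rπ jπ r₀ j₀ t) t := by
  obtain ⟨a1, a2⟩ := hasDerivAt_of_contDiff_two h.contDiff_rπ t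
  obtain ⟨b1, b2⟩ := hasDerivAt_of_contDiff_two h.contDiff_jπ t
  obtain ⟨c1, c2⟩ := hasDerivAt_of_contDiff_two h.contDiff_r₀ t
  obtain ⟨d1, d2⟩ := hasDerivAt_of_contDiff_two h.contDiff_j₀ t
  have e1 := congrArg (fun x : ℝ => (x : ℂ)) (h.eq_rπ t)
  have e2 := congrArg (fun x : ℝ => (x : ℂ)) (h.eq_jπ t)
  have e3 := congrArg (fun x : ℝ => (x : ℂ)) (h.eq_r₀ t)
  have e4 := congrArg (fun x : ℝ => (x : ℂ)) (h.eq_j₀ t)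
  push_cast at e1 e2 e3 e4
  have hI := Complex.I_sq
  rw [complexState, firstOrder_mulVec]
  refine hasDerivAt_pi.2 ?_
  rintro (i | i) <;> fin_cases i
  · exact hasDerivAt_ofReal_add a1 b1
  · exact hasDerivAt_ofReal_add c1 d1
  · refine (hasDerivAt_ofReal_add a2 b2).congr_deriv ?_
    simp [coeffMatrix, Matrix.vecHead, Matrix.vecTail]
    linear_combination e1 + Complex.I * e2 + coeff₃ V W Qπ T δ y t * j₀ t * hI
  · refine (hasDerivAt_ofReal_add c2 d2).congr_deriv ?_
    simp [coeffMatrix, Matrix.vecHead, Matrix.vecTail]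
    linear_combination e3 + Complex.I * e4 - coeff₃ V W Qπ T δ y t * jπ t * hI

theorem continuous_coeffMatrix_apply (hc : Continuous (coeffMatrix V W Q₀ Qπ T δ y)) :
    Continuous (coeff₁ V W Q₀ Qπ T δ y) ∧ Continuous (coeff₂ V W Q₀ Qπ T y) ∧
      Continuous (coeff₃ V W Qπ T δ y) ∧ Continuous (coeff₄ V W Q₀ Qπ T δ y) := by
  have h1 : Continuous fun t => coeffMatrix V W Q₀ Qπ T δ y t 0 0 := hc.matrix_elem 0 0
  have h2 : Continuous fun t => coeffMatrix V W Q₀ Qπ T δ y t 0 1 := hc.matrix_elem 0 1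
  have h4 : Continuous fun t => coeffMatrix V W Q₀ Qπ T δ y t 1 1 := hc.matrix_elem 1 1
  have e1 := Complex.continuous_re.comp h1
  have e2 := Complex.continuous_re.comp h2
  have e3 := Complex.continuous_im.comp h2
  have e4 := Complex.continuous_re.comp h4
  simp [coeffMatrix, Function.comp_def] at e1 e2 e3 e4
  exact ⟨e1, e2, e3, e4⟩

/-- Real and imaginary parts of a complex solution; continuity of the coefficients supplies the `C²`
regularity. -/
theorem isSolution_of_hasDerivAt (hc : Continuous (coeffMatrix V W Q₀ Qπ T δ y))
    {X : ℝ → Fin 2 ⊕ Fin 2 → ℂ}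
    (hX : ∀ t, HasDerivAt X (firstOrder (coeffMatrix V W Q₀ Qπ T δ y t) *ᵥ X t) t) :
    IsSolution V W Q₀ Qπ T δ y (fun t => (X t (Sum.inl 0)).re) (fun t => (X t (Sum.inl 0)).im)
      (fun t => (X t (Sum.inl 1)).re) (fun t => (X t (Sum.inl 1)).im) := by
  obtain ⟨k1, k2, k3, k4⟩ := continuous_coeffMatrix_apply hc
  have hre : ∀ (i : Fin 2 ⊕ Fin 2) (t : ℝ) (z : ℂ), HasDerivAt (fun t => X t i) z t →
      HasDerivAt (fun t => (X t i).re) z.re t := fun i t z h =>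
    (Complex.reCLM.hasFDerivAt.comp_hasDerivAt t h)
  have him : ∀ (i : Fin 2 ⊕ Fin 2) (t : ℝ) (z : ℂ), HasDerivAt (fun t => X t i) z t →
      HasDerivAt (fun t => (X t i).im) z.im t := fun i t z h =>
    (Complex.imCLM.hasFDerivAt.comp_hasDerivAt t h)
  have hXc : Continuous X := continuous_iff_continuousAt.2 fun t => (hX t).continuousAt
  have hd : ∀ i t, HasDerivAt (fun t => X t i)
      ((firstOrder (coeffMatrix V W Q₀ Qπ T δ y t) *ᵥ X t) i) t := fun i t =>
    hasDerivAt_pi.1 (hX t) i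
  have hval : ∀ t, firstOrder (coeffMatrix V W Q₀ Qπ T δ y t) *ᵥ X t =
      Sum.elim (X t ∘ Sum.inr) (-(coeffMatrix V W Q₀ Qπ T δ y t *ᵥ (X t ∘ Sum.inl))) := fun t => by
    conv_lhs => rw [← Sum.elim_comp_inl_inr (X t)]
    rw [firstOrder_mulVec]
  simp only [hval] at hd
  have l0 : ∀ t, HasDerivAt (fun t => X t (Sum.inl 0)) (X t (Sum.inr 0)) t := fun t => hd _ t
  have l1 : ∀ t, HasDerivAt (fun t => X t (Sum.inl 1)) (X t (Sum.inr 1)) t := fun t => hd _ t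
  have m0 : ∀ t, HasDerivAt (fun t => X t (Sum.inr 0))
      (-((coeff₁ V W Q₀ Qπ T δ y t : ℂ) * X t (Sum.inl 0) + (coeff₂ V W Q₀ Qπ T y t
        + Complex.I * coeff₃ V W Qπ T δ y t) * X t (Sum.inl 1))) t := fun t =>
    (hd (Sum.inr 0) t).congr_deriv (by simp [coeffMatrix, Matrix.vecHead, Matrix.vecTail])
  have m1 : ∀ t, HasDerivAt (fun t => X t (Sum.inr 1))
      (-((coeff₂ V W Q₀ Qπ T y t - Complex.I * coeff₃ V W Qπ T δ y t) * X t (Sum.inl 0)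
        + (coeff₄ V W Q₀ Qπ T δ y t : ℂ) * X t (Sum.inl 1))) t := fun t =>
    (hd (Sum.inr 1) t).congr_deriv (by simp [coeffMatrix, Matrix.vecHead, Matrix.vecTail])
  obtain ⟨p1, p2⟩ := contDiff_two_of_hasDerivAt (fun t => hre _ t _ (l0 t))
    (fun t => hre _ t _ (m0 t)) (by fun_prop)
  obtain ⟨q1, q2⟩ := contDiff_two_of_hasDerivAt (fun t => him _ t _ (l0 t))
    (fun t => him _ t _ (m0 t)) (by fun_prop)
  obtain ⟨r1, r2⟩ := contDiff_two_of_hasDerivAt (fun t => hre _ t _ (l1 t))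
    (fun t => hre _ t _ (m1 t)) (by fun_prop)
  obtain ⟨s1, s2⟩ := contDiff_two_of_hasDerivAt (fun t => him _ t _ (l1 t))
    (fun t => him _ t _ (m1 t)) (by fun_prop)
  refine ⟨p1, q1, r1, s1, fun t => ?_, fun t => ?_, fun t => ?_, fun t => ?_⟩
  · rw [p2]; simp
  · rw [q2]; simp
  · rw [r2]; simp
  · rw [s2]; simp

theorem deriv_zero_of_even {f : ℝ → ℝ} (hf : Function.Even f) : deriv f 0 = 0 := by
  have h := deriv_comp_neg f 0
  have e : (fun x => f (-x)) = f := funext hf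
  rw [e, neg_zero] at h
  linarith

theorem deriv_pi_of_even_periodic {f : ℝ → ℝ} (hf : Function.Even f)
    (hp : Function.Periodic f (2 * Real.pi)) : deriv f Real.pi = 0 := by
  have h := deriv_comp_const_sub (f := f) (2 * Real.pi) Real.pi
  have e : (fun x => f (2 * Real.pi - x)) = f := funext fun x => by
    rw [← hf, neg_sub, ← hp, sub_add_cancel]
  rw [e, show 2 * Real.pi - Real.pi = Real.pi by ring] at h
  linarith

theorem im_re_eq_zero_of_add_I_mul {x y : ℝ} (h : (x : ℂ) + Complex.I * y = 0) :
    x = 0 ∧ y = 0 := by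
  have h1 := congrArg Complex.re h
  have h2 := congrArg Complex.im h
  simpa using And.intro h1 h2

variable {Z : ℝ → Mat4} {P B C : Mat2}

theorem fromBlocks_mulVec_elim_zero (A B C D : Mat2) (w : Fin 2 → ℂ) :
    Matrix.fromBlocks A B C D *ᵥ Sum.elim w 0 = Sum.elim (A *ᵥ w) (C *ᵥ w) := by
  rw [Matrix.fromBlocks_mulVec, Sum.elim_comp_inl, Sum.elim_comp_inr, Matrix.mulVec_zero,
    Matrix.mulVec_zero, add_zero, add_zero]

/-- An even `2π`-periodic motion has zero velocity at `0` and at `π`, so its initial state is `(v,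
0)` with `C v = 0`. Conversely, if `C v = 0`, then `P² = 1 + BC` and `CP = PᴴC` give `M² (v, 0) =
(v, 0)`, which is `2π`-periodicity. -/
theorem hasSymmetricPeriodicSolution_iff (hZ : IsFundamental (coeffMatrix V W Q₀ Qπ T δ y) Z)
    (hc : Continuous (coeffMatrix V W Q₀ Qπ T δ y))
    (heven : ∀ t, coeffMatrix V W Q₀ Qπ T δ y (-t) = coeffMatrix V W Q₀ Qπ T δ y t)
    (hshift : ∀ t, coeffMatrix V W Q₀ Qπ T δ y (t + Real.pi) =
      flip2 * coeffMatrix V W Q₀ Qπ T δ y t * flip2)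
    (hM : flip4 * Z Real.pi = Matrix.fromBlocks P B C Pᴴ) (hP : P * P - B * C = 1)
    (hCP : C * P = Pᴴ * C) :
    HasSymmetricPeriodicSolution V W Q₀ Qπ T δ y ↔ C.det = 0 := by
  rw [← Matrix.exists_mulVec_eq_zero_iff]
  constructor
  · rintro ⟨rπ, jπ, r₀, j₀, hsol, hsym, hne⟩
    have h1 := hsym rπ (by simp)
    have h2 := hsym jπ (by simp)
    have h3 := hsym r₀ (by simp)
    have h4 := hsym j₀ (by simp)
    have hX := hZ.eq_mulVec hsol.hasDerivAt_complexState
    set X := complexState rπ jπ r₀ j₀ with hXdef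
    have hX0 : X 0 = Sum.elim ![rπ 0 + Complex.I * jπ 0, r₀ 0 + Complex.I * j₀ 0] 0 := by
      rw [hXdef, complexState]
      simp only [deriv_zero_of_even h1.2, deriv_zero_of_even h2.2, deriv_zero_of_even h3.2,
        deriv_zero_of_even h4.2]
      congr 1
      ext i; fin_cases i <;> simp
    have hXpi : ∀ i, X Real.pi (Sum.inr i) = 0 := by
      intro i
      rw [hXdef, complexState]
      simp only [deriv_pi_of_even_periodic h1.2 h1.1, deriv_pi_of_even_periodic h2.2 h2.1,
        deriv_pi_of_even_periodic h3.2 h3.1, deriv_pi_of_even_periodic h4.2 h4.1]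
      fin_cases i <;> simp
    refine ⟨![rπ 0 + Complex.I * jπ 0, r₀ 0 + Complex.I * j₀ 0], fun hv => hne ?_, ?_⟩
    · have hXz : ∀ t, X t = 0 := fun t => by
        rw [hX t, hX0, hv]
        have : (Sum.elim (0 : Fin 2 → ℂ) (0 : Fin 2 → ℂ)) = 0 := by
          ext i; rcases i with i | i <;> rfl
        rw [this, Matrix.mulVec_zero]
      have ha : ∀ t, rπ t = 0 ∧ jπ t = 0 := fun t =>
        im_re_eq_zero_of_add_I_mul (congrFun (hXz t) (Sum.inl 0))
      have hb : ∀ t, r₀ t = 0 ∧ j₀ t = 0 := fun t =>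
        im_re_eq_zero_of_add_I_mul (congrFun (hXz t) (Sum.inl 1))
      exact ⟨funext fun t => (ha t).1, funext fun t => (ha t).2, funext fun t => (hb t).1,
        funext fun t => (hb t).2⟩
    · have h5 : flip4 *ᵥ X Real.pi = Matrix.fromBlocks P B C Pᴴ *ᵥ X 0 := by
        rw [hX Real.pi, ← hM, Matrix.mulVec_mulVec]
      rw [hX0] at h5
      conv_lhs at h5 => rw [← Sum.elim_comp_inl_inr (X Real.pi)]
      have h6 : X Real.pi ∘ Sum.inr = 0 := funext hXpi
      rw [h6, flip4, Matrix.fromBlocks_mulVec, Matrix.fromBlocks_mulVec] at h5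
      ext i
      have := congrFun h5 (Sum.inr i)
      simpa using this.symm
  · rintro ⟨v, hv, hCv⟩
    set X : ℝ → Fin 2 ⊕ Fin 2 → ℂ := fun t => Z t *ᵥ Sum.elim v 0 with hXdef
    have hX : ∀ t, HasDerivAt X (firstOrder (coeffMatrix V W Q₀ Qπ T δ y t) *ᵥ X t) t := fun t =>
      (hasDerivAt_mulVec (hZ.hasDerivAt t) _).congr_deriv (by rw [Matrix.mulVec_mulVec])
    have hM2 : Matrix.fromBlocks P B C Pᴴ *ᵥ (Matrix.fromBlocks P B C Pᴴ *ᵥ Sum.elim v 0)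
        = Sum.elim v 0 := by
      have hPP : P * P = 1 + B * C := by rw [← hP]; abel
      have h0 : (0 : Fin 2 → ℂ) = C *ᵥ (P *ᵥ v) := by
        rw [Matrix.mulVec_mulVec, hCP, ← Matrix.mulVec_mulVec, hCv, Matrix.mulVec_zero]
      rw [fromBlocks_mulVec_elim_zero, hCv, fromBlocks_mulVec_elim_zero, ← h0,
        Matrix.mulVec_mulVec, hPP, Matrix.add_mulVec, ← Matrix.mulVec_mulVec, hCv,
        Matrix.mulVec_zero, Matrix.one_mulVec, add_zero]
    have hper : ∀ t, X (t + 2 * Real.pi) = X t := fun t => by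
      have := hZ.shift_iterate hshift 2 t
      push_cast at this
      rw [hXdef]
      simp only [this, pow_two, flip4_mul_self, one_mul, hM]
      rw [← Matrix.mulVec_mulVec, ← Matrix.mulVec_mulVec, hM2]
    have hev : ∀ t i, X (-t) (Sum.inl i) = X t (Sum.inl i) := fun t i => by
      rw [hXdef]
      simp only [hZ.neg heven t]
      rw [← Matrix.mulVec_mulVec, ← Matrix.mulVec_mulVec]
      have e1 : timeRev *ᵥ Sum.elim v (0 : Fin 2 → ℂ) = Sum.elim v 0 := by
        simp [timeRev, Matrix.fromBlocks_mulVec]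
      have e2 : ∀ w : Fin 2 ⊕ Fin 2 → ℂ, (timeRev *ᵥ w) (Sum.inl i) = w (Sum.inl i) := fun w => by
        simp [timeRev, Matrix.fromBlocks_mulVec]
      rw [e1, e2]
    refine ⟨_, _, _, _, isSolution_of_hasDerivAt hc hX, ?_, ?_⟩
    · intro f hf
      simp only [mem_insert_iff, mem_singleton_iff] at hf
      rcases hf with rfl | rfl | rfl | rfl <;>
        exact ⟨fun t => by simp only [hper t], fun t => by simp only [hev t]⟩
    · rintro ⟨h1, h2, h3, h4⟩
      apply hv
      have hX0 : X 0 = Sum.elim v 0 := by rw [hXdef]; simp [hZ.zero]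
      have e0 : X 0 (Sum.inl 0) = 0 := Complex.ext (congrFun h1 0) (congrFun h2 0)
      have e1 : X 0 (Sum.inl 1) = 0 := Complex.ext (congrFun h3 0) (congrFun h4 0)
      rw [hX0] at e0 e1
      ext i; fin_cases i
      · exact e0
      · exact e1

theorem norm_flip4_pow_le (k : ℕ) : ‖flip4 ^ k‖ ≤ max 1 ‖flip4‖ := by
  rcases Nat.even_or_odd' k with ⟨m, rfl | rfl⟩
  · rw [pow_mul, pow_two, flip4_mul_self, one_pow]
    refine le_max_of_le_left (le_of_eq ?_)
    exact norm_one
  · rw [pow_succ, pow_mul, pow_two, flip4_mul_self, one_pow, one_mul]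
    exact le_max_right _ _

/-- Every time is `s + kπ` with `s` in the compact interval `[0, π]`, so bounded powers bound all
motions. -/
theorem isStable_of_bound (hZ : IsFundamental (coeffMatrix V W Q₀ Qπ T δ y) Z)
    (hshift : ∀ t, coeffMatrix V W Q₀ Qπ T δ y (t + Real.pi) =
      flip2 * coeffMatrix V W Q₀ Qπ T δ y t * flip2)
    {K : ℝ} (hK : ∀ k : ℕ, ‖(flip4 * Z Real.pi) ^ k‖ ≤ K) : IsStable V W Q₀ Qπ T δ y := by
  intro rπ jπ r₀ j₀ hsol
  have hX := hZ.eq_mulVec hsol.hasDerivAt_complexState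
  set X := complexState rπ jπ r₀ j₀ with hXdef
  have hZc : Continuous Z := continuous_iff_continuousAt.2 fun t => (hZ.hasDerivAt t).continuousAt
  obtain ⟨K', hK'⟩ := isCompact_Icc.exists_bound_of_continuousOn
    (hZc.continuousOn (s := Icc 0 Real.pi))
  have hK0 : 0 ≤ K := (norm_nonneg _).trans (hK 0)
  have hK'0 : 0 ≤ K' := (norm_nonneg _).trans (hK' 0 ⟨le_rfl, Real.pi_pos.le⟩)
  refine ⟨max 1 ‖flip4‖ * K' * K * ‖X 0‖, fun τ hτ => ?_⟩
  have hbound : ‖X τ‖ ≤ max 1 ‖flip4‖ * K' * K * ‖X 0‖ := by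
    set k := ⌊τ / Real.pi⌋₊ with hk
    set s := τ - k * Real.pi with hs
    have hs0 : s ∈ Icc 0 Real.pi := by
      have h1 := Nat.floor_le (div_nonneg hτ Real.pi_pos.le)
      have h2 := Nat.lt_floor_add_one (τ / Real.pi)
      rw [le_div_iff₀ Real.pi_pos] at h1
      rw [div_lt_iff₀ Real.pi_pos] at h2
      exact ⟨by rw [hs]; linarith, by rw [hs]; linarith⟩
    have hτs : τ = s + k * Real.pi := by rw [hs]; ring
    rw [hX τ, hτs, hZ.shift_iterate hshift]
    refine (Matrix.linfty_opNorm_mulVec _ _).trans ?_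
    gcongr
    refine (norm_mul_le _ _).trans ?_
    gcongr
    · refine (norm_mul_le _ _).trans ?_
      gcongr
      · exact norm_flip4_pow_le k
      · exact hK' s hs0
    · exact hK k
  have h0 := (norm_le_pi_norm (X τ) (Sum.inl 0)).trans hbound
  have h1 := (norm_le_pi_norm (X τ) (Sum.inl 1)).trans hbound
  have e0 : X τ (Sum.inl 0) = rπ τ + Complex.I * jπ τ := rfl
  have e1 : X τ (Sum.inl 1) = r₀ τ + Complex.I * j₀ τ := rfl
  rw [e0] at h0
  rw [e1] at h1
  refine ⟨?_, ?_, ?_, ?_⟩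
  · simpa using (Complex.abs_re_le_norm _).trans h0
  · simpa using (Complex.abs_im_le_norm _).trans h0
  · simpa using (Complex.abs_re_le_norm _).trans h1
  · simpa using (Complex.abs_im_le_norm _).trans h1

theorem not_isStable_of_unbounded (hZ : IsFundamental (coeffMatrix V W Q₀ Qπ T δ y) Z)
    (hc : Continuous (coeffMatrix V W Q₀ Qπ T δ y))
    (hshift : ∀ t, coeffMatrix V W Q₀ Qπ T δ y (t + Real.pi) =
      flip2 * coeffMatrix V W Q₀ Qπ T δ y t * flip2)
    {v : Fin 2 → ℂ} (hv : v ≠ 0) {μ : ℝ} (hμ : 1 < μ)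
    (hgrow : ∀ k : ℕ, ∃ τ : ℝ, μ ^ k ≤ τ ∧ ∀ i,
      ((flip4 * Z Real.pi) ^ k *ᵥ Sum.elim v 0) (Sum.inl i) = τ * v i) :
    ¬ IsStable V W Q₀ Qπ T δ y := by
  intro hst
  set X : ℝ → Fin 2 ⊕ Fin 2 → ℂ := fun t => Z t *ᵥ Sum.elim v 0 with hXdef
  have hX : ∀ t, HasDerivAt X (firstOrder (coeffMatrix V W Q₀ Qπ T δ y t) *ᵥ X t) t := fun t =>
    (hasDerivAt_mulVec (hZ.hasDerivAt t) _).congr_deriv (by rw [Matrix.mulVec_mulVec])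
  obtain ⟨K, hK⟩ := hst _ _ _ _ (isSolution_of_hasDerivAt hc hX)
  have hKall : ∀ τ : ℝ, 0 ≤ τ → ∀ i, ‖X τ (Sum.inl i)‖ ≤ 2 * K := by
    intro τ hτ i
    obtain ⟨h1, h2, h3, h4⟩ := hK τ hτ
    refine (Complex.norm_le_abs_re_add_abs_im _).trans ?_
    fin_cases i
    · simp only [Fin.zero_eta]; linarith
    · simp only [Fin.mk_one]; linarith
  obtain ⟨i, hi⟩ : ∃ i, v i ≠ 0 := by
    by_contra hcon
    push Not at hcon
    exact hv (funext hcon)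
  have hflip : ∀ (k : ℕ) (w : Fin 2 ⊕ Fin 2 → ℂ), ‖(flip4 ^ k *ᵥ w) (Sum.inl i)‖ = ‖w (Sum.inl i)‖ := by
    intro k
    induction k with
    | zero => simp
    | succ k ih =>
      intro w
      rw [pow_succ, ← Matrix.mulVec_mulVec, ih, flip4, Matrix.fromBlocks_mulVec]
      fin_cases i <;> simp [flip2, dotProduct, Fin.sum_univ_two]
  have hlow : ∀ k : ℕ, μ ^ k * ‖v i‖ ≤ 2 * K := by
    intro k
    obtain ⟨τ, hτ, hτ2⟩ := hgrow k
    have h1 := hKall (k * Real.pi) (by positivity) i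
    have h2 := hZ.shift_iterate hshift k 0
    rw [zero_add, hZ.zero, mul_one] at h2
    have h3 : X (k * Real.pi) = flip4 ^ k *ᵥ ((flip4 * Z Real.pi) ^ k *ᵥ Sum.elim v 0) := by
      rw [hXdef]; simp only [h2, Matrix.mulVec_mulVec]
    rw [h3, hflip, hτ2 i, norm_mul, Complex.norm_real] at h1
    refine le_trans ?_ h1
    gcongr
    exact hτ.trans (le_abs_self τ)
  obtain ⟨k, hk⟩ := pow_unbounded_of_one_lt (2 * K / ‖v i‖) hμ
  have hvi : 0 < ‖v i‖ := norm_pos_iff.2 hi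
  rw [div_lt_iff₀ hvi] at hk
  exact absurd (hlow k) (not_le.2 hk)

end Translation

/-! ### A nonresonance estimate for two nearly harmonic oscillators. -/

section Uniqueness

/-- Variation of constants: `f'(s) sin(a(t - s))/a + f(s) cos(a(t - s))` interpolates between `f 0 *
cos (a t)` at `s = 0` and `f t` at `s = t`, and its derivative contains only the defect `f'' + a²
f`. -/
theorem abs_sub_cos_le {f f' f'' : ℝ → ℝ} {a κ t : ℝ} (ha : 0 < a)
    (hf : ∀ s, HasDerivAt f (f' s) s) (hf' : ∀ s, HasDerivAt f' (f'' s) s) (h0 : f' 0 = 0)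
    (ht : t ∈ Icc 0 Real.pi) (hκ : ∀ s ∈ Icc 0 Real.pi, |f'' s + a ^ 2 * f s| ≤ κ) :
    |f t - f 0 * Real.cos (a * t)| ≤ κ / a * Real.pi := by
  have hκ0 : 0 ≤ κ := (abs_nonneg _).trans (hκ 0 ⟨le_rfl, Real.pi_pos.le⟩)
  have hd : ∀ s ∈ Icc 0 t, HasDerivWithinAt
      (fun s => f' s * (Real.sin (a * (t - s)) / a) + f s * Real.cos (a * (t - s)))
      ((f'' s + a ^ 2 * f s) * (Real.sin (a * (t - s)) / a)) (Icc 0 t) s := by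
    intro s _
    have e : HasDerivAt (fun s => a * (t - s)) (-a) s := by
      simpa using ((hasDerivAt_id s).const_sub t).const_mul a
    have h1 := ((hf' s).mul ((e.sin).div_const a)).add ((hf s).mul e.cos)
    refine (h1.congr_deriv ?_).hasDerivWithinAt
    field_simp
    ring
  have h := Convex.norm_image_sub_le_of_norm_hasDerivWithin_le (C := κ / a) hd (fun s hs => by
      rw [norm_mul, Real.norm_eq_abs, norm_div, Real.norm_of_nonneg ha.le]
      have h1 := hκ s ⟨hs.1, hs.2.trans ht.2⟩
      have h2 : ‖Real.sin (a * (t - s))‖ ≤ 1 := Real.abs_sin_le_one _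
      calc _ ≤ κ * (1 / a) := by gcongr
        _ = κ / a := by ring) (convex_Icc 0 t) ⟨le_rfl, ht.1⟩ ⟨ht.1, le_rfl⟩
  simp only [sub_self, mul_zero, Real.sin_zero, zero_div, Real.cos_zero, mul_one, zero_add, h0,
    zero_mul, sub_zero, Real.norm_eq_abs] at h
  refine h.trans ?_
  rw [abs_of_nonneg ht.1]
  exact mul_le_mul_of_nonneg_left ht.2 (by positivity)

/-- The unperturbed solutions are `cos s` and `cos (Ω s)`. At `s = π` the first changes sign,
against `f π = f 0`, and the second is not the negative of its initial value because `Ω < 1`. Both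
initial values must vanish, and this survives a small perturbation. -/
theorem exists_uniqueness_threshold {Ω : ℝ} (h0 : 0 < Ω) (h1 : Ω < 1) :
    ∃ η > 0, ∀ f f' f'' g g' g'' : ℝ → ℝ,
      (∀ s, HasDerivAt f (f' s) s) → (∀ s, HasDerivAt f' (f'' s) s) →
      (∀ s, HasDerivAt g (g' s) s) → (∀ s, HasDerivAt g' (g'' s) s) →
      f' 0 = 0 → g' 0 = 0 → f Real.pi = f 0 → g Real.pi = - g 0 →
      (∀ s ∈ Icc 0 Real.pi, |f'' s + f s| ≤ η * (|f s| + |g s|)) →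
      (∀ s ∈ Icc 0 Real.pi, |g'' s + Ω ^ 2 * g s| ≤ η * (|f s| + |g s|)) →
      ∀ s ∈ Icc 0 Real.pi, f s = 0 ∧ g s = 0 := by
  have hpi := Real.pi_pos
  have hcos : 0 < 1 + Real.cos (Ω * Real.pi) := by
    have : Real.cos Real.pi < Real.cos (Ω * Real.pi) :=
      Real.cos_lt_cos_of_nonneg_of_le_pi (by positivity) le_rfl (by nlinarith)
    rw [Real.cos_pi] at this
    linarith
  set c := 1 + Real.cos (Ω * Real.pi) with hc
  set K := 2 * Real.pi + (1 / c + 1) * (Real.pi / Ω) with hK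
  have hK0 : 0 < K := by positivity
  -- `K` collects the constants in the bounds for `f` and `g`; half its inverse turns them into `m ≤
  -- m / 2` for the maximum `m`.
  refine ⟨1 / (2 * K), by positivity, fun f f' f'' g g' g'' hf hf' hg hg' hf0 hg0 hfp hgp hfe hge => ?_⟩
  have hfc : Continuous f := continuous_iff_continuousAt.2 fun s => (hf s).continuousAt
  have hgc : Continuous g := continuous_iff_continuousAt.2 fun s => (hg s).continuousAt
  obtain ⟨s₀, hs₀, hmax⟩ := isCompact_Icc.exists_isMaxOn (s := Icc 0 Real.pi)
    ⟨0, le_rfl, hpi.le⟩ (f := fun s => |f s| + |g s|) (by fun_prop)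
  set m := |f s₀| + |g s₀| with hm
  have hle : ∀ s ∈ Icc 0 Real.pi, |f s| + |g s| ≤ m := fun s hs => hmax hs
  have hη : 0 < 1 / (2 * K) := by positivity
  set η := 1 / (2 * K) with hηd
  have hm0 : 0 ≤ m := by positivity
  have a1 : ∀ t ∈ Icc 0 Real.pi, |f t - f 0 * Real.cos (1 * t)| ≤ η * m / 1 * Real.pi := fun t ht =>
    abs_sub_cos_le one_pos hf hf' hf0 ht fun s hs => by
      rw [one_pow, one_mul]
      exact (hfe s hs).trans (mul_le_mul_of_nonneg_left (hle s hs) hη.le)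
  have a2 : ∀ t ∈ Icc 0 Real.pi, |g t - g 0 * Real.cos (Ω * t)| ≤ η * m / Ω * Real.pi := fun t ht =>
    abs_sub_cos_le h0 hg hg' hg0 ht fun s hs =>
      (hge s hs).trans (mul_le_mul_of_nonneg_left (hle s hs) hη.le)
  have hpmem : Real.pi ∈ Icc 0 Real.pi := ⟨hpi.le, le_rfl⟩
  have b1 : |f 0| ≤ η * m * Real.pi := by
    have := a1 _ hpmem
    rw [hfp, one_mul, Real.cos_pi, div_one] at this
    have e : f 0 - f 0 * -1 = 2 * f 0 := by ring
    rw [e, abs_mul, abs_two] at this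
    linarith [abs_nonneg (f 0)]
  have b2 : |g 0| ≤ 1 / c * (η * m / Ω * Real.pi) := by
    have := a2 _ hpmem
    rw [hgp] at this
    have e : -g 0 - g 0 * Real.cos (Ω * Real.pi) = -(c * g 0) := by rw [hc]; ring
    rw [e, abs_neg, abs_mul, abs_of_pos hcos] at this
    rw [one_div, ← div_eq_inv_mul, le_div_iff₀ hcos]
    linarith
  have c1 : ∀ (w a t : ℝ), |w * Real.cos (a * t)| ≤ |w| := fun w a t => by
    rw [abs_mul]
    exact mul_le_of_le_one_right (abs_nonneg _) (Real.abs_cos_le_one _)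
  have hmz : m ≤ η * K * m := by
    have d1 : |f s₀| ≤ 2 * Real.pi * (η * m) := by
      have k1 := a1 s₀ hs₀
      have k2 := abs_add_le (f s₀ - f 0 * Real.cos (1 * s₀)) (f 0 * Real.cos (1 * s₀))
      rw [sub_add_cancel] at k2
      have k3 := c1 (f 0) 1 s₀
      rw [div_one] at k1
      linarith
    have d2 : |g s₀| ≤ (1 / c + 1) * (Real.pi / Ω) * (η * m) := by
      have k1 := a2 s₀ hs₀
      have k2 := abs_add_le (g s₀ - g 0 * Real.cos (Ω * s₀)) (g 0 * Real.cos (Ω * s₀))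
      rw [sub_add_cancel] at k2
      have k3 := c1 (g 0) Ω s₀
      have e : (1 / c + 1) * (Real.pi / Ω) * (η * m) =
          1 / c * (η * m / Ω * Real.pi) + η * m / Ω * Real.pi := by ring
      rw [e]
      linarith
    rw [hm]
    calc _ ≤ 2 * Real.pi * (η * m) + (1 / c + 1) * (Real.pi / Ω) * (η * m) := add_le_add d1 d2
      _ = η * K * m := by rw [hK]; ring
  have hηK : η * K = 1 / 2 := by rw [hηd]; field_simp
  rw [hηK] at hmz
  have hm00 : m = 0 := by linarith
  intro s hs
  have := hle s hs
  rw [hm00] at this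
  constructor
  · exact abs_eq_zero.1 (le_antisymm (by linarith [abs_nonneg (g s)]) (abs_nonneg _))
  · exact abs_eq_zero.1 (le_antisymm (by linarith [abs_nonneg (f s)]) (abs_nonneg _))

end Uniqueness

/-! ### Small amplitudes and the half-period symmetry of the mode. -/

section LocalMode

variable {V W : ℝ → ℝ} {Q₀ Qπ : ℝ → ℝ → ℝ} {T : ℝ → ℝ} {ρ : ℝ}

theorem omegaSq_pos (hV : IsPotential V) (hW : IsPotential W) : 0 < omegaSq V W := by
  have h1 := hV.pos
  have h2 := hW.pos
  unfold omegaSq harmonicCoeff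
  positivity

/-- The squared linear frequency `Ω₀² = v₂ / (v₂ + 4 φ₂)` of the in-phase component. -/
noncomputable def inPhaseFreq (V W : ℝ → ℝ) : ℝ := √(harmonicCoeff V / omegaSq V W)

theorem inPhaseFreq_sq (hV : IsPotential V) (hW : IsPotential W) :
    inPhaseFreq V W ^ 2 = harmonicCoeff V / omegaSq V W :=
  Real.sq_sqrt (div_nonneg hV.pos.le (omegaSq_pos hV hW).le)

theorem inPhaseFreq_pos (hV : IsPotential V) (hW : IsPotential W) : 0 < inPhaseFreq V W :=
  Real.sqrt_pos.2 (div_pos hV.pos (omegaSq_pos hV hW))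

theorem inPhaseFreq_lt_one (hV : IsPotential V) (hW : IsPotential W) : inPhaseFreq V W < 1 := by
  rw [inPhaseFreq, Real.sqrt_lt' one_pos, one_pow, div_lt_one (omegaSq_pos hV hW)]
  have h2 : 0 < harmonicCoeff W := hW.pos
  unfold omegaSq
  linarith

theorem IsPotential.exists_contDiffOn {U : ℝ → ℝ} (hU : IsPotential U) (c : ℝ) :
    ∃ R > 0, ContDiffOn ℝ ∞ (fun x => U x / c) (Ioo (-R) R) := by
  obtain ⟨R, hR, h⟩ := Metric.eventually_nhds_iff_ball.1 hU.analyticAt.eventually_analyticAt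
  refine ⟨R, hR, fun x hx => ?_⟩
  have hx' : x ∈ Metric.ball (0 : ℝ) R := by
    rw [Metric.mem_ball, Real.dist_eq, sub_zero]; exact abs_lt.2 hx
  exact ((h x hx').contDiffAt.div_const c).contDiffWithinAt

theorem deriv_div_const_zero {U : ℝ → ℝ} (hU : IsPotential U) (c : ℝ) :
    deriv (fun x => U x / c) 0 = 0 := by
  rw [deriv_div_const, hU.deriv_zero, zero_div]

theorem iteratedDeriv_two_div_const {U : ℝ → ℝ} (c : ℝ) :
    iteratedDeriv 2 (fun x => U x / c) 0 = harmonicCoeff U / c := by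
  rw [harmonicCoeff, iteratedDeriv_succ, iteratedDeriv_one, iteratedDeriv_succ, iteratedDeriv_one]
  have : deriv (fun x => U x / c) = fun x => deriv U x / c := by
    ext x; rw [deriv_div_const]
  rw [this, deriv_div_const]

theorem contDiffOn_deriv_Ioo {f : ℝ → ℝ} {R : ℝ} (hf : ContDiffOn ℝ ∞ f (Ioo (-R) R)) :
    ContDiffOn ℝ ∞ (deriv f) (Ioo (-R) R) :=
  hf.deriv_of_isOpen isOpen_Ioo (by simp)

theorem hasStrictDerivAt_deriv {f : ℝ → ℝ} {R : ℝ} (hR : 0 < R)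
    (hf : ContDiffOn ℝ ∞ f (Ioo (-R) R)) :
    HasStrictDerivAt (deriv f) (iteratedDeriv 2 f 0) 0 := by
  rw [iteratedDeriv_succ, iteratedDeriv_one]
  exact ((contDiffOn_deriv_Ioo hf).contDiffAt (Ioo_mem_nhds (by linarith) hR)).hasStrictDerivAt
    (by simp)

/-- The mode is uniformly small for small amplitudes. -/
theorem IsMode.exists_small (hmode : IsMode V W Q₀ Qπ T ρ) {ε : ℝ} (hε : 0 < ε) :
    ∃ r > 0, r ≤ ρ ∧ ∀ y ∈ Ioo (-r) r, ∀ τ, |Q₀ y τ| < ε ∧ |Qπ y τ| < ε := by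
  have h2π := Real.two_pi_pos
  have key : ∀ Q : ℝ → ℝ → ℝ,
      ContDiffOn ℝ ∞ (fun p : ℝ × ℝ => Q p.1 p.2) (Ioo (-ρ) ρ ×ˢ univ) →
      (∀ y ∈ Ioo (-ρ) ρ, Function.Periodic (Q y) (2 * Real.pi)) → (∀ τ, Q 0 τ = 0) →
      ∀ᶠ y in 𝓝 (0 : ℝ), y ∈ Ioo (-ρ) ρ ∧ ∀ τ, |Q y τ| < ε := by
    intro Q hQ hp h0
    have hmem : (0 : ℝ) ∈ Ioo (-ρ) ρ := ⟨by linarith [hmode.radius_pos], hmode.radius_pos⟩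
    have hcont : ∀ y ∈ Ioo (-ρ) ρ, Continuous (Q y) := fun y hy => by
      rw [← continuousOn_univ]
      exact hQ.continuousOn.comp (f := fun t : ℝ => (y, t)) (by fun_prop)
        (fun t _ => ⟨hy, mem_univ _⟩)
    have hc := ((continuousOn_toBCF h2π hQ.continuousOn hp).continuousAt
      (Ioo_mem_nhds hmem.1 hmem.2))
    filter_upwards [Metric.tendsto_nhds.1 hc ε hε, Ioo_mem_nhds hmem.1 hmem.2] with y hy hyρ
    refine ⟨hyρ, fun τ => ?_⟩
    have := (BoundedContinuousFunction.dist_coe_le_dist (f := toBCF (Q y)) (g := toBCF (Q 0)) τ).trans_lt hy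
    rwa [toBCF_apply (hcont y hyρ) h2π (hp y hyρ), toBCF_apply (hcont 0 hmem) h2π (hp 0 hmem), h0,
      Real.dist_eq, sub_zero] at this
  obtain ⟨r, hr, h⟩ := Metric.eventually_nhds_iff_ball.1
    ((key Q₀ hmode.smooth_Q₀ hmode.periodic_Q₀ hmode.order_zero_Q₀).and
      (key Qπ hmode.smooth_Qπ hmode.periodic_Qπ hmode.order_zero_Qπ))
  refine ⟨min r ρ, lt_min hr hmode.radius_pos, min_le_right _ _, fun y hy τ => ?_⟩
  have hy' : y ∈ Metric.ball (0 : ℝ) r := by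
    rw [Metric.mem_ball, Real.dist_eq, sub_zero]
    exact (abs_lt.2 hy).trans_le (min_le_left _ _)
  exact ⟨(h y hy').1.2 τ, (h y hy').2.2 τ⟩

theorem contDiff_of_contDiffOn_prod {F : Type*} [NormedAddCommGroup F] [NormedSpace ℝ F]
    {Q : ℝ → ℝ → F}
    (hQ : ContDiffOn ℝ ∞ (fun p : ℝ × ℝ => Q p.1 p.2) (Ioo (-ρ) ρ ×ˢ univ)) {y : ℝ}
    (hy : y ∈ Ioo (-ρ) ρ) : ContDiff ℝ ∞ (Q y) := by
  rw [← contDiffOn_univ]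
  exact hQ.comp (f := fun t : ℝ => (y, t)) (by fun_prop) (fun t _ => ⟨hy, mem_univ _⟩)

/-- The motion `(Q₀, -Qπ)` delayed by `π` solves the same equations. The differences `f = Qπ + Qπ(·
+ π)` and `g = Q₀ - Q₀(· + π)` solve nearly harmonic equations of frequencies `1` and `Ω`, with `f`
`π`-periodic and `g` `π`-antiperiodic, so the nonresonance estimate makes them vanish. -/
theorem IsMode.eventually_shift (hV : IsPotential V) (hW : IsPotential W)
    (hmode : IsMode V W Q₀ Qπ T ρ) :
    ∃ r > 0, r ≤ ρ ∧ ∀ y ∈ Ioo (-r) r, ∀ τ,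
      Q₀ y (τ + Real.pi) = Q₀ y τ ∧ Qπ y (τ + Real.pi) = -Qπ y τ := by
  have hω := omegaSq_pos hV hW
  obtain ⟨η₀, hη₀, huniq⟩ := exists_uniqueness_threshold (inPhaseFreq_pos hV hW)
    (inPhaseFreq_lt_one hV hW)
  set v := harmonicCoeff V / omegaSq V W with hv
  set w := harmonicCoeff W / omegaSq V W with hw
  have hvw : v + 4 * w = 1 := by rw [hv, hw]; unfold omegaSq at *; field_simp
  have hv0 : 0 < v := div_pos hV.pos hω
  have hw0 : 0 < w := div_pos hW.pos hω
  -- The forces contribute an error of at most `5 η`, and the deviation of `T²` from `1` at most `6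
  -- η`; `20 η ≤ η₀` covers both.
  set η := min 1 (η₀ / 20) with hη
  have hη0 : 0 < η := lt_min one_pos (by positivity)
  have hη1 : η ≤ 1 := min_le_left _ _
  have hη2 : 20 * η ≤ η₀ := by have := min_le_right 1 (η₀ / 20); linarith
  -- Strict differentiability compares the force at two small arguments, so the error is
  -- proportional to the difference of the two motions and not to their size.
  have hstrict : ∀ U : ℝ → ℝ, IsPotential U → ∃ ε > 0, ∀ x z : ℝ, |x| < ε → |z| < ε →
      |deriv (fun x => U x / omegaSq V W) x - deriv (fun x => U x / omegaSq V W) z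
        - harmonicCoeff U / omegaSq V W * (x - z)| ≤ η * |x - z| := by
    intro U hU
    obtain ⟨R, hR, hUR⟩ := hU.exists_contDiffOn (omegaSq V W)
    have h := hasStrictDerivAt_deriv hR hUR
    rw [iteratedDeriv_two_div_const] at h
    have h2 := h.isLittleO.def hη0
    obtain ⟨ε, hε, hb⟩ := Metric.eventually_nhds_iff_ball.1 h2
    refine ⟨ε, hε, fun x z hx hz => ?_⟩
    have := hb (x, z) (by
      rw [Metric.mem_ball, Prod.dist_eq, max_lt_iff]
      simpa [Real.dist_eq] using And.intro hx hz)
    simpa [mul_comm] using this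
  obtain ⟨ε₁, hε₁, hsV⟩ := hstrict V hV
  obtain ⟨ε₂, hε₂, hsW⟩ := hstrict W hW
  rw [← hv] at hsV
  rw [← hw] at hsW
  obtain ⟨r₁, hr₁, hr₁ρ, hsmall⟩ := hmode.exists_small (ε := min ε₁ ε₂ / 2)
    (by have := lt_min hε₁ hε₂; positivity)
  have hmem : (0 : ℝ) ∈ Ioo (-ρ) ρ := ⟨by linarith [hmode.radius_pos], hmode.radius_pos⟩
  have hTc : ContinuousAt (fun y => T y ^ 2) 0 :=
    (hmode.smooth_T.continuousOn.continuousAt (Ioo_mem_nhds hmem.1 hmem.2)).pow 2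
  obtain ⟨r₂, hr₂, hTb⟩ := Metric.continuousAt_iff.1 hTc η hη0
  simp only [hmode.order_zero_T, one_pow, Real.dist_eq, sub_zero] at hTb
  refine ⟨min r₁ r₂, lt_min hr₁ hr₂, (min_le_left _ _).trans hr₁ρ, fun y hy => ?_⟩
  have hy1 : y ∈ Ioo (-r₁) r₁ := by
    have := (abs_lt.2 hy).trans_le (min_le_left r₁ r₂); exact abs_lt.1 this
  have hyρ : y ∈ Ioo (-ρ) ρ := ⟨by linarith [hy1.1], hy1.2.trans_le hr₁ρ⟩
  have hT := (hTb ((abs_lt.2 hy).trans_le (min_le_right r₁ r₂))).le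
  have hsm := hsmall y hy1
  have hC0 : ContDiff ℝ 2 (Q₀ y) := by
    exact_mod_cast contDiff_infty.1 (contDiff_of_contDiffOn_prod hmode.smooth_Q₀ hyρ) 2
  have hCπ : ContDiff ℝ 2 (Qπ y) := by
    exact_mod_cast contDiff_infty.1 (contDiff_of_contDiffOn_prod hmode.smooth_Qπ hyρ) 2
  have d0 := hasDerivAt_of_contDiff_two hC0
  have dπ := hasDerivAt_of_contDiff_two hCπ
  have hper0 := hmode.periodic_Q₀ y hyρ
  have hperπ := hmode.periodic_Qπ y hyρ
  have hev0 := hmode.even_Q₀ y hyρ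
  have hevπ := hmode.even_Qπ y hyρ
  set f : ℝ → ℝ := fun s => Qπ y s + Qπ y (s + Real.pi) with hf
  set g : ℝ → ℝ := fun s => Q₀ y s - Q₀ y (s + Real.pi) with hg
  set f' : ℝ → ℝ := fun s => deriv (Qπ y) s + deriv (Qπ y) (s + Real.pi) with hf'
  set g' : ℝ → ℝ := fun s => deriv (Q₀ y) s - deriv (Q₀ y) (s + Real.pi) with hg'
  set f'' : ℝ → ℝ := fun s => iteratedDeriv 2 (Qπ y) s + iteratedDeriv 2 (Qπ y) (s + Real.pi) with hf''
  set g'' : ℝ → ℝ := fun s => iteratedDeriv 2 (Q₀ y) s - iteratedDeriv 2 (Q₀ y) (s + Real.pi) with hg''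
  have kf : ∀ s, HasDerivAt f (f' s) s := fun s =>
    (dπ s).1.add ((dπ (s + Real.pi)).1.comp_add_const s Real.pi)
  have kf' : ∀ s, HasDerivAt f' (f'' s) s := fun s =>
    (dπ s).2.add ((dπ (s + Real.pi)).2.comp_add_const s Real.pi)
  have kg : ∀ s, HasDerivAt g (g' s) s := fun s =>
    (d0 s).1.sub ((d0 (s + Real.pi)).1.comp_add_const s Real.pi)
  have kg' : ∀ s, HasDerivAt g' (g'' s) s := fun s =>
    (d0 s).2.sub ((d0 (s + Real.pi)).2.comp_add_const s Real.pi)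
  have e2 : ∀ s : ℝ, s + Real.pi + Real.pi = s + 2 * Real.pi := fun s => by ring
  have fper : Function.Periodic f Real.pi := fun s => by
    simp only [hf, e2, hperπ s]; ring
  have ganti : ∀ s, g (s + Real.pi) = -g s := fun s => by
    simp only [hg, e2, hper0 s]; ring
  have hf'0 : f' 0 = 0 := by
    simp only [hf', zero_add, deriv_zero_of_even hevπ, deriv_pi_of_even_periodic hevπ hperπ]
  have hg'0 : g' 0 = 0 := by
    simp only [hg', zero_add, deriv_zero_of_even hev0, deriv_pi_of_even_periodic hev0 hper0,
      sub_zero]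
  have herr : ∀ s, |f'' s + f s| ≤ η₀ * (|f s| + |g s|) ∧
      |g'' s + inPhaseFreq V W ^ 2 * g s| ≤ η₀ * (|f s| + |g s|) := by
    intro s
    have hq := hsm s
    have hq' := hsm (s + Real.pi)
    have hm1 : min ε₁ ε₂ ≤ ε₁ := min_le_left _ _
    have hm2 : min ε₁ ε₂ ≤ ε₂ := min_le_right _ _
    have mπ := hmode.motion_Qπ y hyρ s
    have mπ' := hmode.motion_Qπ y hyρ (s + Real.pi)
    have m0 := hmode.motion_Q₀ y hyρ s
    have m0' := hmode.motion_Q₀ y hyρ (s + Real.pi)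
    have hVt : Vt V W = fun x => V x / omegaSq V W := rfl
    have hWt : Wt V W = fun x => W x / omegaSq V W := rfl
    rw [hVt, hWt] at mπ mπ'
    rw [hVt] at m0 m0'
    obtain ⟨⟨a1, a2⟩, a3, a4⟩ := And.intro (abs_lt.1 hq.1) (abs_lt.1 hq.2)
    obtain ⟨⟨b1, b2⟩, b3, b4⟩ := And.intro (abs_lt.1 hq'.1) (abs_lt.1 hq'.2)
    have s1 := hsV (Q₀ y s + Qπ y s) (Q₀ y (s + Real.pi) - Qπ y (s + Real.pi))
      (abs_lt.2 ⟨by linarith, by linarith⟩) (abs_lt.2 ⟨by linarith, by linarith⟩)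
    have s2 := hsV (Q₀ y s - Qπ y s) (Q₀ y (s + Real.pi) + Qπ y (s + Real.pi))
      (abs_lt.2 ⟨by linarith, by linarith⟩) (abs_lt.2 ⟨by linarith, by linarith⟩)
    have s3 := hsW (2 * Qπ y s) (-2 * Qπ y (s + Real.pi))
      (abs_lt.2 ⟨by linarith, by linarith⟩) (abs_lt.2 ⟨by linarith, by linarith⟩)
    have s4 := hsW (-2 * Qπ y s) (2 * Qπ y (s + Real.pi))
      (abs_lt.2 ⟨by linarith, by linarith⟩) (abs_lt.2 ⟨by linarith, by linarith⟩)
    have t1 : Q₀ y s + Qπ y s - (Q₀ y (s + Real.pi) - Qπ y (s + Real.pi)) = g s + f s := by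
      simp only [hf, hg]; ring
    have t2 : Q₀ y s - Qπ y s - (Q₀ y (s + Real.pi) + Qπ y (s + Real.pi)) = g s - f s := by
      simp only [hf, hg]; ring
    have t3 : 2 * Qπ y s - -2 * Qπ y (s + Real.pi) = 2 * f s := by simp only [hf]; ring
    have t4 : -2 * Qπ y s - 2 * Qπ y (s + Real.pi) = -(2 * f s) := by simp only [hf]; ring
    rw [t1] at s1
    rw [t2] at s2
    rw [t3] at s3
    rw [t4, abs_neg] at s4
    have u1 : |g s + f s| ≤ |f s| + |g s| := by rw [add_comm |f s|]; exact abs_add_le _ _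
    have u2 : |g s - f s| ≤ |f s| + |g s| := by rw [add_comm |f s|]; exact abs_sub _ _
    have u3 : |2 * f s| = 2 * |f s| := by rw [abs_mul, abs_two]
    rw [u3] at s3 s4
    set N := |f s| + |g s| with hN
    have hfN : |f s| ≤ N := by rw [hN]; linarith [abs_nonneg (g s)]
    have hgN : |g s| ≤ N := by rw [hN]; linarith [abs_nonneg (f s)]
    have hN0 : 0 ≤ N := (abs_nonneg _).trans hfN
    set x1 := deriv (fun x => V x / omegaSq V W) (Q₀ y s + Qπ y s)
      - deriv (fun x => V x / omegaSq V W) (Q₀ y (s + Real.pi) - Qπ y (s + Real.pi)) with hx1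
    set x2 := deriv (fun x => V x / omegaSq V W) (Q₀ y s - Qπ y s)
      - deriv (fun x => V x / omegaSq V W) (Q₀ y (s + Real.pi) + Qπ y (s + Real.pi)) with hx2
    set x3 := deriv (fun x => W x / omegaSq V W) (2 * Qπ y s)
      - deriv (fun x => W x / omegaSq V W) (-2 * Qπ y (s + Real.pi)) with hx3
    set x4 := deriv (fun x => W x / omegaSq V W) (-2 * Qπ y s)
      - deriv (fun x => W x / omegaSq V W) (2 * Qπ y (s + Real.pi)) with hx4
    have hff : f'' s = -(T y ^ 2 * ((1 / 2) * (x1 - x2) + (x3 - x4))) := by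
      simp only [hf'', hx1, hx2, hx3, hx4]; linear_combination mπ + mπ'
    have hgg : g'' s = -(T y ^ 2 * ((1 / 2) * (x1 + x2))) := by
      simp only [hg'', hx1, hx2]; linear_combination m0 - m0'
    have hηN : 0 ≤ η * N := by positivity
    have s1' : |x1 - v * (g s + f s)| ≤ η * N := s1.trans (mul_le_mul_of_nonneg_left u1 hη0.le)
    have s2' : |x2 - v * (g s - f s)| ≤ η * N := s2.trans (mul_le_mul_of_nonneg_left u2 hη0.le)
    have s3' : |x3 - w * (2 * f s)| ≤ η * (2 * N) :=
      s3.trans (mul_le_mul_of_nonneg_left (by linarith) hη0.le)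
    have s4' : |x4 - w * -(2 * f s)| ≤ η * (2 * N) :=
      s4.trans (mul_le_mul_of_nonneg_left (by linarith) hη0.le)
    have hT' : ∀ z c : ℝ, |z - c| ≤ 5 * (η * N) → |c| ≤ N → |-(T y ^ 2 * z) + c| ≤ η₀ * N := by
      intro z c h1 h2
      have e : -(T y ^ 2 * z) + c = -((T y ^ 2 - 1) * z) - (z - c) := by ring
      have h3 : |z| ≤ 6 * N := by
        have := abs_add_le (z - c) c
        rw [sub_add_cancel] at this
        have : η * N ≤ 1 * N := mul_le_mul_of_nonneg_right hη1 hN0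
        linarith
      have h4 : |(T y ^ 2 - 1) * z| ≤ η * (6 * N) := by
        rw [abs_mul]; exact mul_le_mul hT h3 (abs_nonneg _) hη0.le
      rw [e]
      calc |-((T y ^ 2 - 1) * z) - (z - c)| ≤ |(T y ^ 2 - 1) * z| + |z - c| := by
            have := abs_sub (-((T y ^ 2 - 1) * z)) (z - c)
            rwa [abs_neg] at this
        _ ≤ 20 * η * N := by linarith
        _ ≤ η₀ * N := mul_le_mul_of_nonneg_right hη2 hN0
    constructor
    · rw [hff]
      refine hT' _ _ ?_ hfN
      have e : 1 / 2 * (x1 - x2) + (x3 - x4) - f s = 1 / 2 * (x1 - v * (g s + f s))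
          - 1 / 2 * (x2 - v * (g s - f s)) + (x3 - w * (2 * f s)) - (x4 - w * -(2 * f s)) := by
        linear_combination (f s) * hvw
      rw [e, abs_le]
      obtain ⟨p1, p2⟩ := abs_le.1 s1'
      obtain ⟨p3, p4⟩ := abs_le.1 s2'
      obtain ⟨p5, p6⟩ := abs_le.1 s3'
      obtain ⟨p7, p8⟩ := abs_le.1 s4'
      constructor <;> linarith
    · rw [hgg, inPhaseFreq_sq hV hW, ← hv]
      refine hT' _ _ ?_ ?_
      · have e : 1 / 2 * (x1 + x2) - v * g s = 1 / 2 * (x1 - v * (g s + f s))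
            + 1 / 2 * (x2 - v * (g s - f s)) := by ring
        rw [e, abs_le]
        obtain ⟨p1, p2⟩ := abs_le.1 s1'
        obtain ⟨p3, p4⟩ := abs_le.1 s2'
        constructor <;> linarith
      · rw [abs_mul, abs_of_pos hv0]
        have : v ≤ 1 := by linarith
        exact (mul_le_of_le_one_left (abs_nonneg _) this).trans hgN
  have hz := huniq f f' f'' g g' g'' kf kf' kg kg' hf'0 hg'0
    (by simpa using fper 0) (by simpa using ganti 0)
    (fun s _ => (herr s).1) (fun s _ => (herr s).2)
  have hf0 : ∀ s, f s = 0 := fun s => by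
    obtain ⟨t, ht, hst⟩ := fper.exists_mem_Ico₀ Real.pi_pos s
    rw [hst]; exact (hz t ⟨ht.1, ht.2.le⟩).1
  have hg0 : ∀ s, g s = 0 := fun s => by
    have gper : Function.Periodic (fun s => |g s|) Real.pi := fun s => by
      simp only [ganti s, abs_neg]
    obtain ⟨t, ht, hst⟩ := gper.exists_mem_Ico₀ Real.pi_pos s
    simp only [(hz t ⟨ht.1, ht.2.le⟩).2, abs_zero] at hst
    exact abs_eq_zero.1 hst
  intro τ
  have h1 := hf0 τ
  have h2 := hg0 τ
  simp only [hf] at h1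
  simp only [hg] at h2
  exact ⟨by linarith, by linarith⟩

/-- The properties of the mode on a range `|y| < r` of small amplitudes. -/
structure IsLocalMode (V W : ℝ → ℝ) (Q₀ Qπ : ℝ → ℝ → ℝ) (T : ℝ → ℝ) (ρ r R : ℝ) : Prop where
  mode : IsMode V W Q₀ Qπ T ρ
  pos_V : IsPotential V
  pos_W : IsPotential W
  radius_pos : 0 < r
  radius_le : r ≤ ρ
  range_pos : 0 < R
  smooth_V : ContDiffOn ℝ ∞ (Vt V W) (Ioo (-R) R)
  smooth_W : ContDiffOn ℝ ∞ (Wt V W) (Ioo (-R) R)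
  small : ∀ y ∈ Ioo (-r) r, ∀ τ, |Q₀ y τ| < R / 2 ∧ |Qπ y τ| < R / 2
  shift : ∀ y ∈ Ioo (-r) r, ∀ τ, Q₀ y (τ + Real.pi) = Q₀ y τ ∧ Qπ y (τ + Real.pi) = -Qπ y τ

theorem IsMode.exists_isLocalMode (hV : IsPotential V) (hW : IsPotential W)
    (hmode : IsMode V W Q₀ Qπ T ρ) : ∃ r R, IsLocalMode V W Q₀ Qπ T ρ r R := by
  obtain ⟨R₁, hR₁, h1⟩ := hV.exists_contDiffOn (omegaSq V W)
  obtain ⟨R₂, hR₂, h2⟩ := hW.exists_contDiffOn (omegaSq V W)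
  obtain ⟨r₁, hr₁, hr₁ρ, h3⟩ := hmode.exists_small (ε := min R₁ R₂ / 2)
    (by have := lt_min hR₁ hR₂; positivity)
  obtain ⟨r₂, hr₂, hr₂ρ, h4⟩ := hmode.eventually_shift hV hW
  have m1 := min_le_left R₁ R₂
  have m2 := min_le_right R₁ R₂
  have m3 := min_le_left r₁ r₂
  have m4 := min_le_right r₁ r₂
  exact ⟨min r₁ r₂, min R₁ R₂, hmode, hV, hW, lt_min hr₁ hr₂, m3.trans hr₁ρ, lt_min hR₁ hR₂,
    h1.mono (Ioo_subset_Ioo (by linarith) m1), h2.mono (Ioo_subset_Ioo (by linarith) m2),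
    fun y hy => h3 y (Ioo_subset_Ioo (by linarith) m3 hy),
    fun y hy => h4 y (Ioo_subset_Ioo (by linarith) m4 hy)⟩

end LocalMode

/-! ### The half-period matrix as a smooth function of `θ` and `y`. -/

section Monodromy

/-- The Hermitian matrix with real entries `x₁, x₄` on and `x₂ ± i x₃` off the diagonal. -/
noncomputable def hermMatrix (x₁ x₂ x₃ x₄ : ℝ) : Mat2 :=
  !![(x₁ : ℂ), x₂ + Complex.I * x₃; x₂ - Complex.I * x₃, (x₄ : ℂ)]

theorem hermMatrix_conjTranspose (x₁ x₂ x₃ x₄ : ℝ) :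
    (hermMatrix x₁ x₂ x₃ x₄)ᴴ = hermMatrix x₁ x₂ x₃ x₄ := by
  ext i j
  fin_cases i <;> fin_cases j <;> simp [hermMatrix, Matrix.conjTranspose_apply, sub_eq_add_neg]

theorem hermMatrix_map_star (x₁ x₂ x₃ x₄ : ℝ) :
    (hermMatrix x₁ x₂ x₃ x₄).map star = hermMatrix x₁ x₂ (-x₃) x₄ := by
  ext i j
  fin_cases i <;> fin_cases j <;> simp [hermMatrix, sub_eq_add_neg]

theorem flip2_mul_hermMatrix (x₁ x₂ x₃ x₄ : ℝ) :
    flip2 * hermMatrix x₁ x₂ x₃ x₄ * flip2 = hermMatrix x₁ (-x₂) (-x₃) x₄ := by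
  ext i j
  fin_cases i <;> fin_cases j <;>
    simp [flip2, hermMatrix, Matrix.mul_apply, Fin.sum_univ_two] <;> ring

/-- The lower left block `-a` of `firstOrder a`, as a `4 × 4` matrix. -/
noncomputable def lowerLeft (a : Mat2) : Mat4 := Matrix.fromBlocks 0 0 (-a) 0

theorem firstOrder_hermMatrix (x₁ x₂ x₃ x₄ : ℝ) :
    firstOrder (hermMatrix x₁ x₂ x₃ x₄) = firstOrder 0 + x₁ • lowerLeft (hermMatrix 1 0 0 0)
      + x₂ • lowerLeft (hermMatrix 0 1 0 0) + x₃ • lowerLeft (hermMatrix 0 0 1 0)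
      + x₄ • lowerLeft (hermMatrix 0 0 0 1) := by
  ext i j
  rcases i with i | i <;> rcases j with j | j <;> fin_cases i <;> fin_cases j <;>
    simp [firstOrder, lowerLeft, hermMatrix]
  all_goals ring

theorem IsFundamental.map_star {a a' : ℝ → Mat2} {Z Z' : ℝ → Mat4} (h : IsFundamental a Z)
    (h' : IsFundamental a' Z') (ha : ∀ t, a' t = (a t).map star) (t : ℝ) :
    Z' t = (Z t).map star := by
  have hW : ∀ t, HasDerivAt (fun t => (Z t).map star) (firstOrder (a' t) * (Z t).map star) t := by
    intro t
    have h1 : HasDerivAt (fun t => (Z t).map star) ((firstOrder (a t) * Z t).map star) t :=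
      hasDerivAt_pi.2 fun i => hasDerivAt_pi.2 fun j =>
        (hasDerivAt_pi.1 (hasDerivAt_pi.1 (h.hasDerivAt t) i) j).star
    refine h1.congr_deriv ?_
    have e : firstOrder (a' t) = (firstOrder (a t)).map star := by
      rw [ha, firstOrder, firstOrder, Matrix.fromBlocks_map]
      congr 1
      all_goals ext i j; fin_cases i <;> fin_cases j <;> simp
    rw [e]
    exact Matrix.map_mul (f := starRingEnd ℂ)
  have := h'.eq_mul hW t
  rw [h.zero] at this
  have e1 : (1 : Mat4).map star = 1 := Matrix.map_one star (star_zero _) (star_one _)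
  rw [e1, mul_one] at this
  exact this.symm

variable {V W : ℝ → ℝ} {Q₀ Qπ : ℝ → ℝ → ℝ} {T : ℝ → ℝ} {ρ r R : ℝ}

/-- The onsite part of the diagonal coefficients. -/
noncomputable def onsiteCoeff (V W : ℝ → ℝ) (Q₀ Qπ : ℝ → ℝ → ℝ) (T : ℝ → ℝ) (y τ : ℝ) : ℝ :=
  T y ^ 2 / 2 * (iteratedDeriv 2 (Vt V W) (Q₀ y τ + Qπ y τ)
    + iteratedDeriv 2 (Vt V W) (Q₀ y τ - Qπ y τ))

/-- The interaction part of the diagonal coefficients. -/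
noncomputable def interCoeff (V W : ℝ → ℝ) (Qπ : ℝ → ℝ → ℝ) (T : ℝ → ℝ) (y τ : ℝ) : ℝ :=
  T y ^ 2 / 2 * (iteratedDeriv 2 (Wt V W) (2 * Qπ y τ) + iteratedDeriv 2 (Wt V W) (-2 * Qπ y τ))

/-- The odd interaction coefficient. -/
noncomputable def oddCoeff (V W : ℝ → ℝ) (Qπ : ℝ → ℝ → ℝ) (T : ℝ → ℝ) (y τ : ℝ) : ℝ :=
  T y ^ 2 * (iteratedDeriv 2 (Wt V W) (2 * Qπ y τ) - iteratedDeriv 2 (Wt V W) (-2 * Qπ y τ))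

/-- The coefficient matrix in terms of `θ`, where `δ = 4 sin² θ`. -/
noncomputable def thetaMatrix (V W : ℝ → ℝ) (Q₀ Qπ : ℝ → ℝ → ℝ) (T : ℝ → ℝ) (θ y τ : ℝ) : Mat2 :=
  hermMatrix (onsiteCoeff V W Q₀ Qπ T y τ + (4 - 4 * Real.sin θ ^ 2) * interCoeff V W Qπ T y τ)
    (coeff₂ V W Q₀ Qπ T y τ) (Real.sin (2 * θ) * oddCoeff V W Qπ T y τ)
    (onsiteCoeff V W Q₀ Qπ T y τ + 4 * Real.sin θ ^ 2 * interCoeff V W Qπ T y τ)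

/-- The substitution `δ = 4 sin² θ` resolves the square root singularity at `δ = 0`: for these `θ`
the root is `sin 2θ`, which extends smoothly and oddly to negative `θ`. -/
theorem coeffMatrix_eq_thetaMatrix {θ : ℝ} (hθ : θ ∈ Icc 0 (Real.pi / 2)) (y τ : ℝ) :
    coeffMatrix V W Q₀ Qπ T (4 * Real.sin θ ^ 2) y τ = thetaMatrix V W Q₀ Qπ T θ y τ := by
  have hsqrt : √(4 * Real.sin θ ^ 2 * (1 - 4 * Real.sin θ ^ 2 / 4)) = Real.sin (2 * θ) := by
    have h0 : 0 ≤ Real.sin (2 * θ) :=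
      Real.sin_nonneg_of_nonneg_of_le_pi (by linarith [hθ.1]) (by linarith [hθ.2])
    rw [← Real.sqrt_sq h0, Real.sin_two_mul]
    congr 1
    linear_combination -4 * Real.sin θ ^ 2 * Real.sin_sq_add_cos_sq θ
  have e1 : coeff₁ V W Q₀ Qπ T (4 * Real.sin θ ^ 2) y τ = onsiteCoeff V W Q₀ Qπ T y τ
      + (4 - 4 * Real.sin θ ^ 2) * interCoeff V W Qπ T y τ := by
    unfold coeff₁ onsiteCoeff interCoeff; ring
  have e3 : coeff₃ V W Qπ T (4 * Real.sin θ ^ 2) y τ =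
      Real.sin (2 * θ) * oddCoeff V W Qπ T y τ := by
    unfold coeff₃ oddCoeff; rw [hsqrt]; ring
  have e4 : coeff₄ V W Q₀ Qπ T (4 * Real.sin θ ^ 2) y τ = onsiteCoeff V W Q₀ Qπ T y τ
      + 4 * Real.sin θ ^ 2 * interCoeff V W Qπ T y τ := by
    unfold coeff₄ onsiteCoeff interCoeff; ring
  rw [coeffMatrix, e1, e3, e4]
  rfl

theorem IsLocalMode.smooth_coeffs (h : IsLocalMode V W Q₀ Qπ T ρ r R) :
    ContDiffOn ℝ ∞ (fun p : ℝ × ℝ => onsiteCoeff V W Q₀ Qπ T p.1 p.2) (Ioo (-r) r ×ˢ univ) ∧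
    ContDiffOn ℝ ∞ (fun p : ℝ × ℝ => interCoeff V W Qπ T p.1 p.2) (Ioo (-r) r ×ˢ univ) ∧
    ContDiffOn ℝ ∞ (fun p : ℝ × ℝ => oddCoeff V W Qπ T p.1 p.2) (Ioo (-r) r ×ˢ univ) ∧
    ContDiffOn ℝ ∞ (fun p : ℝ × ℝ => coeff₂ V W Q₀ Qπ T p.1 p.2) (Ioo (-r) r ×ˢ univ) := by
  have hsub : Ioo (-r) r ⊆ Ioo (-ρ) ρ := Ioo_subset_Ioo (by linarith [h.radius_le]) h.radius_le
  have hsub2 : Ioo (-r) r ×ˢ univ ⊆ Ioo (-ρ) ρ ×ˢ (univ : Set ℝ) := prod_mono hsub le_rfl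
  have hQ0 := h.mode.smooth_Q₀.mono hsub2
  have hQπ := h.mode.smooth_Qπ.mono hsub2
  have hT : ContDiffOn ℝ ∞ (fun p : ℝ × ℝ => T p.1) (Ioo (-r) r ×ˢ univ) :=
    (h.mode.smooth_T.mono hsub).comp contDiffOn_fst fun p hp => hp.1
  have hdd : ∀ f : ℝ → ℝ, ContDiffOn ℝ ∞ f (Ioo (-R) R) →
      ContDiffOn ℝ ∞ (iteratedDeriv 2 f) (Ioo (-R) R) := fun f hf => by
    rw [iteratedDeriv_succ, iteratedDeriv_one]
    exact contDiffOn_deriv_Ioo (contDiffOn_deriv_Ioo hf)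
  have hVV := hdd _ h.smooth_V
  have hWW := hdd _ h.smooth_W
  have hin : ∀ p ∈ Ioo (-r) r ×ˢ (univ : Set ℝ), |Q₀ p.1 p.2| < R / 2 ∧ |Qπ p.1 p.2| < R / 2 :=
    fun p hp => h.small p.1 hp.1 p.2
  have c1 : ContDiffOn ℝ ∞ (fun p : ℝ × ℝ => iteratedDeriv 2 (Vt V W) (Q₀ p.1 p.2 + Qπ p.1 p.2))
      (Ioo (-r) r ×ˢ univ) := hVV.comp (hQ0.add hQπ) fun p hp => by
    obtain ⟨a, b⟩ := hin p hp
    rw [abs_lt] at a b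
    exact ⟨by linarith, by linarith⟩
  have c2 : ContDiffOn ℝ ∞ (fun p : ℝ × ℝ => iteratedDeriv 2 (Vt V W) (Q₀ p.1 p.2 - Qπ p.1 p.2))
      (Ioo (-r) r ×ˢ univ) := hVV.comp (hQ0.sub hQπ) fun p hp => by
    obtain ⟨a, b⟩ := hin p hp
    rw [abs_lt] at a b
    exact ⟨by linarith, by linarith⟩
  have c3 : ContDiffOn ℝ ∞ (fun p : ℝ × ℝ => iteratedDeriv 2 (Wt V W) (2 * Qπ p.1 p.2))
      (Ioo (-r) r ×ˢ univ) := hWW.comp (contDiffOn_const.mul hQπ) fun p hp => by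
    obtain ⟨a, b⟩ := hin p hp
    rw [abs_lt] at a b
    exact ⟨by linarith, by linarith⟩
  have c4 : ContDiffOn ℝ ∞ (fun p : ℝ × ℝ => iteratedDeriv 2 (Wt V W) (-2 * Qπ p.1 p.2))
      (Ioo (-r) r ×ˢ univ) := hWW.comp (contDiffOn_const.mul hQπ) fun p hp => by
    obtain ⟨a, b⟩ := hin p hp
    rw [abs_lt] at a b
    exact ⟨by linarith, by linarith⟩
  have t1 := (hT.pow 2)
  have t2 := t1.div_const 2
  exact ⟨t2.mul (c1.add c2), t2.mul (c3.add c4), t1.mul (c3.sub c4), t2.mul (c1.sub c2)⟩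

theorem IsLocalMode.periodic (h : IsLocalMode V W Q₀ Qπ T ρ r R) {y : ℝ} (hy : y ∈ Ioo (-r) r)
    (τ : ℝ) : Q₀ y (τ + 2 * Real.pi) = Q₀ y τ ∧ Qπ y (τ + 2 * Real.pi) = Qπ y τ := by
  have hyρ : y ∈ Ioo (-ρ) ρ := Ioo_subset_Ioo (by linarith [h.radius_le]) h.radius_le hy
  exact ⟨h.mode.periodic_Q₀ y hyρ τ, h.mode.periodic_Qπ y hyρ τ⟩

theorem thetaMatrix_conjTranspose (θ y τ : ℝ) :
    (thetaMatrix V W Q₀ Qπ T θ y τ)ᴴ = thetaMatrix V W Q₀ Qπ T θ y τ :=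
  hermMatrix_conjTranspose _ _ _ _

/-- Only the factor `sin 2θ` is odd in `θ`, and it multiplies the imaginary unit. This is why the
real determinants are even in `θ`. -/
theorem thetaMatrix_neg_theta (θ y τ : ℝ) :
    thetaMatrix V W Q₀ Qπ T (-θ) y τ = (thetaMatrix V W Q₀ Qπ T θ y τ).map star := by
  rw [thetaMatrix, thetaMatrix, hermMatrix_map_star]
  simp

theorem IsLocalMode.thetaMatrix_neg (h : IsLocalMode V W Q₀ Qπ T ρ r R) (θ : ℝ) {y : ℝ}
    (hy : y ∈ Ioo (-r) r) (τ : ℝ) :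
    thetaMatrix V W Q₀ Qπ T θ y (-τ) = thetaMatrix V W Q₀ Qπ T θ y τ := by
  have hyρ : y ∈ Ioo (-ρ) ρ := Ioo_subset_Ioo (by linarith [h.radius_le]) h.radius_le hy
  simp only [thetaMatrix, onsiteCoeff, interCoeff, oddCoeff, coeff₂, h.mode.even_Q₀ y hyρ τ,
    h.mode.even_Qπ y hyρ τ]

theorem IsLocalMode.thetaMatrix_shift (h : IsLocalMode V W Q₀ Qπ T ρ r R) (θ : ℝ) {y : ℝ}
    (hy : y ∈ Ioo (-r) r) (τ : ℝ) :
    thetaMatrix V W Q₀ Qπ T θ y (τ + Real.pi) =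
      flip2 * thetaMatrix V W Q₀ Qπ T θ y τ * flip2 := by
  obtain ⟨h0, hπ⟩ := h.shift y hy τ
  rw [thetaMatrix, thetaMatrix, flip2_mul_hermMatrix]
  have e1 : -2 * -Qπ y τ = 2 * Qπ y τ := by ring
  have e2 : 2 * -Qπ y τ = -2 * Qπ y τ := by ring
  simp only [onsiteCoeff, interCoeff, oddCoeff, coeff₂, h0, hπ, e1, e2, sub_neg_eq_add,
    ← sub_eq_add_neg]
  congr 1 <;> ring

/-- The coefficients of the first-order system as a bounded function of time. -/
noncomputable def coeffBCF (V W : ℝ → ℝ) (Q₀ Qπ : ℝ → ℝ → ℝ) (T : ℝ → ℝ) (θ y : ℝ) :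
    BoundedContinuousFunction ℝ Mat4 :=
  toBCF (fun τ => firstOrder 0
      + (onsiteCoeff V W Q₀ Qπ T y τ + 4 * interCoeff V W Qπ T y τ) • lowerLeft (hermMatrix 1 0 0 0)
      + coeff₂ V W Q₀ Qπ T y τ • lowerLeft (hermMatrix 0 1 0 0)
      + onsiteCoeff V W Q₀ Qπ T y τ • lowerLeft (hermMatrix 0 0 0 1))
    + (4 * Real.sin θ ^ 2) • toBCF (fun τ => interCoeff V W Qπ T y τ •
      (lowerLeft (hermMatrix 0 0 0 1) - lowerLeft (hermMatrix 1 0 0 0)))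
    + Real.sin (2 * θ) • toBCF (fun τ => oddCoeff V W Qπ T y τ • lowerLeft (hermMatrix 0 0 1 0))

/-- `θ` enters only through scalar factors of periodic families depending on `y`, so smoothness in
each variable separately assembles to joint smoothness. -/
theorem IsLocalMode.coeffBCF_spec (h : IsLocalMode V W Q₀ Qπ T ρ r R) :
    ContDiffOn ℝ ∞ (fun p : ℝ × ℝ => coeffBCF V W Q₀ Qπ T p.1 p.2) (univ ×ˢ Ioo (-r) r) ∧
    ∀ θ, ∀ y ∈ Ioo (-r) r, ∀ τ,
      coeffBCF V W Q₀ Qπ T θ y τ = firstOrder (thetaMatrix V W Q₀ Qπ T θ y τ) := by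
  obtain ⟨c1, c2, c3, c4⟩ := h.smooth_coeffs
  have h2π := Real.two_pi_pos
  have s1 : ContDiffOn ℝ ∞ (fun p : ℝ × ℝ => firstOrder 0
      + (onsiteCoeff V W Q₀ Qπ T p.1 p.2 + 4 * interCoeff V W Qπ T p.1 p.2) •
        lowerLeft (hermMatrix 1 0 0 0)
      + coeff₂ V W Q₀ Qπ T p.1 p.2 • lowerLeft (hermMatrix 0 1 0 0)
      + onsiteCoeff V W Q₀ Qπ T p.1 p.2 • lowerLeft (hermMatrix 0 0 0 1)) (Ioo (-r) r ×ˢ univ) :=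
    ((contDiffOn_const.add ((c1.add (contDiffOn_const.mul c2)).smul contDiffOn_const)).add
      (c4.smul contDiffOn_const)).add (c1.smul contDiffOn_const)
  have s2 : ContDiffOn ℝ ∞ (fun p : ℝ × ℝ => interCoeff V W Qπ T p.1 p.2 •
      (lowerLeft (hermMatrix 0 0 0 1) - lowerLeft (hermMatrix 1 0 0 0))) (Ioo (-r) r ×ˢ univ) :=
    c2.smul contDiffOn_const
  have s3 : ContDiffOn ℝ ∞ (fun p : ℝ × ℝ => oddCoeff V W Qπ T p.1 p.2 •
      lowerLeft (hermMatrix 0 0 1 0)) (Ioo (-r) r ×ˢ univ) :=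
    c3.smul contDiffOn_const
  have p1 : ∀ y ∈ Ioo (-r) r, Function.Periodic (fun τ => firstOrder 0
      + (onsiteCoeff V W Q₀ Qπ T y τ + 4 * interCoeff V W Qπ T y τ) • lowerLeft (hermMatrix 1 0 0 0)
      + coeff₂ V W Q₀ Qπ T y τ • lowerLeft (hermMatrix 0 1 0 0)
      + onsiteCoeff V W Q₀ Qπ T y τ • lowerLeft (hermMatrix 0 0 0 1)) (2 * Real.pi) :=
    fun y hy τ => by
      obtain ⟨a, b⟩ := h.periodic hy τ
      simp only [onsiteCoeff, interCoeff, coeff₂, a, b]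
  have p2 : ∀ y ∈ Ioo (-r) r, Function.Periodic (fun τ => interCoeff V W Qπ T y τ •
      (lowerLeft (hermMatrix 0 0 0 1) - lowerLeft (hermMatrix 1 0 0 0))) (2 * Real.pi) :=
    fun y hy τ => by
      obtain ⟨a, b⟩ := h.periodic hy τ
      simp only [interCoeff, b]
  have p3 : ∀ y ∈ Ioo (-r) r, Function.Periodic (fun τ => oddCoeff V W Qπ T y τ •
      lowerLeft (hermMatrix 0 0 1 0)) (2 * Real.pi) :=
    fun y hy τ => by
      obtain ⟨a, b⟩ := h.periodic hy τ
      simp only [oddCoeff, b]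
  constructor
  · have hsnd : ContDiffOn ℝ ∞ (fun p : ℝ × ℝ => p.2) (univ ×ˢ Ioo (-r) r) := contDiffOn_snd
    have hmaps : MapsTo (fun p : ℝ × ℝ => p.2) (univ ×ˢ Ioo (-r) r) (Ioo (-r) r) := fun p hp => hp.2
    have hs : ContDiffOn ℝ ∞ (fun p : ℝ × ℝ => 4 * Real.sin p.1 ^ 2) (univ ×ˢ Ioo (-r) r) := by
      fun_prop
    have hs2 : ContDiffOn ℝ ∞ (fun p : ℝ × ℝ => Real.sin (2 * p.1)) (univ ×ˢ Ioo (-r) r) := by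
      fun_prop
    exact (((contDiffOn_toBCF h2π s1 p1).comp hsnd hmaps).add
      (hs.smul ((contDiffOn_toBCF h2π s2 p2).comp hsnd hmaps))).add
      (hs2.smul ((contDiffOn_toBCF h2π s3 p3).comp hsnd hmaps))
  · intro θ y hy τ
    simp only [coeffBCF, BoundedContinuousFunction.coe_add, BoundedContinuousFunction.coe_smul,
      Pi.add_apply]
    have d1 := (contDiff_of_contDiffOn_prod
      (Q := fun y τ => onsiteCoeff V W Q₀ Qπ T y τ) c1 hy).continuous
    have d2 := (contDiff_of_contDiffOn_prod
      (Q := fun y τ => interCoeff V W Qπ T y τ) c2 hy).continuous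
    have d3 := (contDiff_of_contDiffOn_prod
      (Q := fun y τ => oddCoeff V W Qπ T y τ) c3 hy).continuous
    have d4 := (contDiff_of_contDiffOn_prod
      (Q := fun y τ => coeff₂ V W Q₀ Qπ T y τ) c4 hy).continuous
    rw [toBCF_apply (by fun_prop) h2π (p1 y hy), toBCF_apply (by fun_prop) h2π (p2 y hy),
      toBCF_apply (by fun_prop) h2π (p3 y hy),
      thetaMatrix, firstOrder_hermMatrix]
    module

/-- A bound for the coefficients near `θ = y = 0`. -/
noncomputable def rateBound (V W : ℝ → ℝ) (Q₀ Qπ : ℝ → ℝ → ℝ) (T : ℝ → ℝ) : ℝ :=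
  ‖coeffBCF V W Q₀ Qπ T 0 0‖ + 1

theorem rateBound_pos : 0 < rateBound V W Q₀ Qπ T := by unfold rateBound; positivity

/-- The fundamental matrix of the variational system. -/
noncomputable def fundMatrix (V W : ℝ → ℝ) (Q₀ Qπ : ℝ → ℝ → ℝ) (T : ℝ → ℝ) (θ y t : ℝ) : Mat4 :=
  fundamental (rateBound V W Q₀ Qπ T) rateBound_pos (coeffBCF V W Q₀ Qπ T θ y) t

/-- The half-period monodromy matrix, composed with the sign change. -/
noncomputable def monodromy (V W : ℝ → ℝ) (Q₀ Qπ : ℝ → ℝ → ℝ) (T : ℝ → ℝ) (θ y : ℝ) : Mat4 :=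
  flip4 * fundMatrix V W Q₀ Qπ T θ y Real.pi

/-- The determinant whose zeros are the periodic even solutions. -/
noncomputable def detC (V W : ℝ → ℝ) (Q₀ Qπ : ℝ → ℝ → ℝ) (T : ℝ → ℝ) (θ y : ℝ) : ℝ :=
  (monodromy V W Q₀ Qπ T θ y).toBlocks₂₁.det.re

/-- The determinant whose zeros are the periodic odd solutions. -/
noncomputable def detB (V W : ℝ → ℝ) (Q₀ Qπ : ℝ → ℝ → ℝ) (T : ℝ → ℝ) (θ y : ℝ) : ℝ :=
  (monodromy V W Q₀ Qπ T θ y).toBlocks₁₂.det.re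

theorem contDiff_apply_apply_mat4 (i j : Fin 2 ⊕ Fin 2) : ContDiff ℝ ∞ fun M : Mat4 => M i j :=
  (LinearMap.toContinuousLinearMap
    ({ toFun := fun M : Mat4 => M i j, map_add' := fun _ _ => rfl, map_smul' := fun _ _ => rfl } :
      Mat4 →ₗ[ℝ] ℂ)).contDiff

theorem contDiff_det_blocks :
    ContDiff ℝ ∞ (fun M : Mat4 => M.toBlocks₂₁.det.re) ∧
    ContDiff ℝ ∞ (fun M : Mat4 => M.toBlocks₁₂.det.re) ∧
    ContDiff ℝ ∞ (fun M : Mat4 => M.toBlocks₁₁.det.re) ∧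
    ContDiff ℝ ∞ (fun M : Mat4 => M.toBlocks₁₁.trace.re) := by
  have hc := contDiff_apply_apply_mat4
  have hre : ∀ f : Mat4 → ℂ, ContDiff ℝ ∞ f → ContDiff ℝ ∞ fun M => (f M).re := fun f hf =>
    Complex.reCLM.contDiff.comp hf
  refine ⟨hre _ ?_, hre _ ?_, hre _ ?_, hre _ ?_⟩
  · simp only [Matrix.det_fin_two, Matrix.toBlocks₂₁, Matrix.of_apply]
    exact ((hc _ _).mul (hc _ _)).sub ((hc _ _).mul (hc _ _))
  · simp only [Matrix.det_fin_two, Matrix.toBlocks₁₂, Matrix.of_apply]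
    exact ((hc _ _).mul (hc _ _)).sub ((hc _ _).mul (hc _ _))
  · simp only [Matrix.det_fin_two, Matrix.toBlocks₁₁, Matrix.of_apply]
    exact ((hc _ _).mul (hc _ _)).sub ((hc _ _).mul (hc _ _))
  · simp only [Matrix.trace_fin_two, Matrix.toBlocks₁₁, Matrix.of_apply]
    exact (hc _ _).add (hc _ _)

/-- Near `θ = y = 0` the fundamental matrix is what its name says, and the monodromy is smooth. -/
theorem IsLocalMode.exists_smooth_monodromy (h : IsLocalMode V W Q₀ Qπ T ρ r R) :
    ∃ s > 0, s ≤ r ∧ s ≤ 1 ∧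
      (∀ θ ∈ Ioo (-s) s, ∀ y ∈ Ioo (-s) s,
        IsFundamental (thetaMatrix V W Q₀ Qπ T θ y) (fundMatrix V W Q₀ Qπ T θ y)) ∧
      ContDiffOn ℝ ∞ (fun p : ℝ × ℝ => monodromy V W Q₀ Qπ T p.1 p.2) (Ioo (-s) s ×ˢ Ioo (-s) s) := by
  obtain ⟨hs, hval⟩ := h.coeffBCF_spec
  have hopen : IsOpen ((univ : Set ℝ) ×ˢ Ioo (-r) r) := isOpen_univ.prod isOpen_Ioo
  have hr := h.radius_pos
  have hc : ContinuousAt (fun p : ℝ × ℝ => ‖coeffBCF V W Q₀ Qπ T p.1 p.2‖) (0, 0) :=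
    (hs.continuousOn.continuousAt (hopen.mem_nhds ⟨mem_univ _, by linarith, hr⟩)).norm
  -- The rate exceeds the norm of the coefficients at the origin by one, so by continuity one rate
  -- serves a whole neighbourhood.
  have hlt := hc.eventually_lt_const (u := rateBound V W Q₀ Qπ T) (by
    simp only [rateBound]; linarith)
  obtain ⟨d, hd, hball⟩ := Metric.eventually_nhds_iff_ball.1 hlt
  refine ⟨min d (min r 1), lt_min hd (lt_min hr one_pos), (min_le_right _ _).trans (min_le_left _ _),
    (min_le_right _ _).trans (min_le_right _ _), ?_, ?_⟩
  · intro θ hθ y hy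
    have hyr : y ∈ Ioo (-r) r := by
      have := (abs_lt.2 hy).trans_le ((min_le_right _ _).trans (min_le_left _ _))
      exact abs_lt.1 this
    have hb := hball (θ, y) (by
      rw [Metric.mem_ball, Prod.dist_eq, max_lt_iff]
      simp only [Real.dist_eq, sub_zero]
      exact ⟨(abs_lt.2 hθ).trans_le (min_le_left _ _), (abs_lt.2 hy).trans_le (min_le_left _ _)⟩)
    refine ⟨fun t => thetaMatrix_conjTranspose _ _ _, fun t => ?_, ?_⟩
    · rw [← hval θ y hyr t]
      exact hasDerivAt_fundamental rateBound_pos hb t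
    · exact fundamental_zero rateBound_pos hb
  · intro p hp
    have hyr : p.2 ∈ Ioo (-r) r := by
      have := (abs_lt.2 hp.2).trans_le ((min_le_right _ _).trans (min_le_left _ _))
      exact abs_lt.1 this
    have hb := hball p (by
      rw [Metric.mem_ball, Prod.dist_eq, max_lt_iff]
      simp only [Real.dist_eq, sub_zero]
      exact ⟨(abs_lt.2 hp.1).trans_le (min_le_left _ _),
        (abs_lt.2 hp.2).trans_le (min_le_left _ _)⟩)
    have h1 : ContDiffAt ℝ ∞ (fun p : ℝ × ℝ => coeffBCF V W Q₀ Qπ T p.1 p.2) p :=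
      hs.contDiffAt (hopen.mem_nhds ⟨mem_univ _, hyr⟩)
    have h2 : ContDiffAt ℝ ∞ (fun p : ℝ × ℝ => fundMatrix V W Q₀ Qπ T p.1 p.2 Real.pi) p :=
      ContDiffAt.comp (g := fun B => fundamental (rateBound V W Q₀ Qπ T) rateBound_pos B Real.pi)
        (f := fun p : ℝ × ℝ => coeffBCF V W Q₀ Qπ T p.1 p.2) p
        (contDiffAt_fundamental rateBound_pos hb Real.pi) h1
    exact (contDiffAt_const.mul h2).contDiffWithinAt

theorem det_toBlocks_map_star (M : Mat4) :
    (M.map star).toBlocks₂₁.det.re = M.toBlocks₂₁.det.re ∧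
    (M.map star).toBlocks₁₂.det.re = M.toBlocks₁₂.det.re := by
  constructor <;> simp [Matrix.det_fin_two, Matrix.toBlocks₂₁, Matrix.toBlocks₁₂]

theorem monodromy_neg_theta {θ y : ℝ}
    (h1 : IsFundamental (thetaMatrix V W Q₀ Qπ T θ y) (fundMatrix V W Q₀ Qπ T θ y))
    (h2 : IsFundamental (thetaMatrix V W Q₀ Qπ T (-θ) y) (fundMatrix V W Q₀ Qπ T (-θ) y)) :
    detC V W Q₀ Qπ T (-θ) y = detC V W Q₀ Qπ T θ y ∧
    detB V W Q₀ Qπ T (-θ) y = detB V W Q₀ Qπ T θ y := by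
  have h3 := h1.map_star h2 (fun t => thetaMatrix_neg_theta θ y t) Real.pi
  have h4 : flip4.map star = flip4 := by
    rw [flip4, Matrix.fromBlocks_map]
    congr 1
    all_goals ext i j; fin_cases i <;> fin_cases j <;> simp [flip2]
  have h5 : monodromy V W Q₀ Qπ T (-θ) y = (monodromy V W Q₀ Qπ T θ y).map star := by
    rw [monodromy, monodromy, h3]
    have : (flip4 * fundMatrix V W Q₀ Qπ T θ y Real.pi).map star =
        flip4.map star * (fundMatrix V W Q₀ Qπ T θ y Real.pi).map star :=
      Matrix.map_mul (f := starRingEnd ℂ)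
    rw [this, h4]
  rw [detC, detC, detB, detB, h5]
  exact det_toBlocks_map_star _

end Monodromy

/-! ### The decoupled system at zero amplitude. -/

section Harmonic

/-- The fundamental matrix of a pair of uncoupled oscillators of frequencies `a` and `b`. -/
noncomputable def oscillators (a b t : ℝ) : Mat4 :=
  Matrix.fromBlocks (hermMatrix (Real.cos (a * t)) 0 0 (Real.cos (b * t)))
    (hermMatrix (Real.sin (a * t) / a) 0 0 (Real.sin (b * t) / b))
    (hermMatrix (-(a * Real.sin (a * t))) 0 0 (-(b * Real.sin (b * t))))
    (hermMatrix (Real.cos (a * t)) 0 0 (Real.cos (b * t)))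

theorem hasDerivAt_hermMatrix_diag {f g : ℝ → ℝ} {f' g' t : ℝ} (hf : HasDerivAt f f' t)
    (hg : HasDerivAt g g' t) :
    HasDerivAt (fun t => hermMatrix (f t) 0 0 (g t)) (hermMatrix f' 0 0 g') t := by
  refine hasDerivAt_pi.2 fun i => hasDerivAt_pi.2 fun j => ?_
  fin_cases i <;> fin_cases j <;> simp only [hermMatrix]
  · exact hf.ofReal_comp
  · simpa using hasDerivAt_const t (0 : ℂ)
  · simpa using hasDerivAt_const t (0 : ℂ)
  · exact hg.ofReal_comp

theorem hasDerivAt_fromBlocks {A B C D : ℝ → Mat2} {A' B' C' D' : Mat2} {t : ℝ}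
    (hA : HasDerivAt A A' t) (hB : HasDerivAt B B' t) (hC : HasDerivAt C C' t)
    (hD : HasDerivAt D D' t) :
    HasDerivAt (fun t => Matrix.fromBlocks (A t) (B t) (C t) (D t))
      (Matrix.fromBlocks A' B' C' D') t := by
  refine hasDerivAt_pi.2 fun i => hasDerivAt_pi.2 fun j => ?_
  rcases i with i | i <;> rcases j with j | j
  · exact hasDerivAt_pi.1 (hasDerivAt_pi.1 hA i) j
  · exact hasDerivAt_pi.1 (hasDerivAt_pi.1 hB i) j
  · exact hasDerivAt_pi.1 (hasDerivAt_pi.1 hC i) j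
  · exact hasDerivAt_pi.1 (hasDerivAt_pi.1 hD i) j

theorem hermMatrix_diag_mul (a b c d : ℝ) :
    hermMatrix a 0 0 b * hermMatrix c 0 0 d = hermMatrix (a * c) 0 0 (b * d) := by
  ext i j
  fin_cases i <;> fin_cases j <;> simp [hermMatrix, Matrix.mul_apply, Fin.sum_univ_two]

theorem hermMatrix_diag_neg (a b : ℝ) :
    -hermMatrix a 0 0 b = hermMatrix (-a) 0 0 (-b) := by
  ext i j
  fin_cases i <;> fin_cases j <;> simp [hermMatrix]

theorem flip2_eq_hermMatrix : flip2 = hermMatrix (-1) 0 0 1 := by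
  ext i j
  fin_cases i <;> fin_cases j <;> simp [hermMatrix, flip2]

theorem hasDerivAt_sin_mul (a t : ℝ) :
    HasDerivAt (fun t => Real.sin (a * t)) (a * Real.cos (a * t)) t := by
  have := ((hasDerivAt_id t).const_mul a).sin
  simpa [mul_comm] using this

theorem hasDerivAt_cos_mul (a t : ℝ) :
    HasDerivAt (fun t => Real.cos (a * t)) (-(a * Real.sin (a * t))) t := by
  have := ((hasDerivAt_id t).const_mul a).cos
  simpa [mul_comm] using this

theorem IsFundamental.eq_oscillators {a b : ℝ} (ha : a ≠ 0) (hb : b ≠ 0) {M : ℝ → Mat2}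
    {Z : ℝ → Mat4} (hZ : IsFundamental M Z) (hM : ∀ t, M t = hermMatrix (a ^ 2) 0 0 (b ^ 2))
    (t : ℝ) : Z t = oscillators a b t := by
  have h0 : oscillators a b 0 = 1 := by
    rw [oscillators, ← Matrix.fromBlocks_one]
    congr 1
    all_goals ext i j; fin_cases i <;> fin_cases j <;> simp [hermMatrix]
  have := hZ.eq_mul (W := oscillators a b) (fun t => ?_) t
  · rw [this, h0, mul_one]
  · have k : ∀ c : ℝ, c ≠ 0 → HasDerivAt (fun t => Real.sin (c * t) / c) (Real.cos (c * t)) t :=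
      fun c hc => ((hasDerivAt_sin_mul c t).div_const c).congr_deriv (by field_simp)
    have l : ∀ c : ℝ, HasDerivAt (fun t => -(c * Real.sin (c * t)))
        (-c ^ 2 * Real.cos (c * t)) t :=
      fun c => ((hasDerivAt_sin_mul c t).const_mul c).neg.congr_deriv (by ring)
    refine (hasDerivAt_fromBlocks
      (hasDerivAt_hermMatrix_diag (hasDerivAt_cos_mul a t) (hasDerivAt_cos_mul b t))
      (hasDerivAt_hermMatrix_diag (k a ha) (k b hb))
      (hasDerivAt_hermMatrix_diag (l a) (l b))
      (hasDerivAt_hermMatrix_diag (hasDerivAt_cos_mul a t) (hasDerivAt_cos_mul b t))).congr_deriv ?_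
    rw [hM, firstOrder, oscillators, Matrix.fromBlocks_multiply, hermMatrix_diag_neg]
    simp only [zero_mul, one_mul, zero_add, add_zero, hermMatrix_diag_mul]
    congr 2
    · field_simp
    · field_simp

theorem flip4_mul_oscillators_blocks (a b : ℝ) :
    (flip4 * oscillators a b Real.pi).toBlocks₂₁.det.re =
      -(a * Real.sin (a * Real.pi) * (b * Real.sin (b * Real.pi))) ∧
    (flip4 * oscillators a b Real.pi).toBlocks₁₂.det.re =
      -(Real.sin (a * Real.pi) / a * (Real.sin (b * Real.pi) / b)) ∧
    (flip4 * oscillators a b Real.pi).toBlocks₁₁.det.re =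
      -(Real.cos (a * Real.pi) * Real.cos (b * Real.pi)) ∧
    (flip4 * oscillators a b Real.pi).toBlocks₁₁.trace.re =
      -Real.cos (a * Real.pi) + Real.cos (b * Real.pi) := by
  have hd : ∀ x y : ℝ, (hermMatrix x 0 0 y).det.re = x * y := fun x y => by
    rw [Matrix.det_fin_two]; simp [hermMatrix]
  have ht : ∀ x y : ℝ, (hermMatrix x 0 0 y).trace.re = x + y := fun x y => by
    rw [Matrix.trace_fin_two]; simp [hermMatrix]
  rw [flip4, oscillators, Matrix.fromBlocks_multiply]
  simp only [zero_mul, zero_add, add_zero, flip2_eq_hermMatrix, hermMatrix_diag_mul,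
    Matrix.toBlocks_fromBlocks₂₁, Matrix.toBlocks_fromBlocks₁₂, Matrix.toBlocks_fromBlocks₁₁,
    hd, ht]
  refine ⟨by ring, by ring, by ring, by ring⟩

variable {V W : ℝ → ℝ} {Q₀ Qπ : ℝ → ℝ → ℝ} {T : ℝ → ℝ} {ρ r R : ℝ}

theorem beta₁_pos (hV : IsPotential V) (hW : IsPotential W) : 0 < beta₁ V W :=
  div_pos (mul_pos (by norm_num) hW.pos) (omegaSq_pos hV hW)

theorem inPhaseFreq_sq_eq (hV : IsPotential V) (hW : IsPotential W) :
    inPhaseFreq V W ^ 2 = 1 - beta₁ V W := by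
  have h := omegaSq_pos hV hW
  rw [inPhaseFreq_sq hV hW, beta₁, eq_sub_iff_add_eq, ← add_div, div_eq_one_iff_eq h.ne', omegaSq]

theorem beta₁_lt_one (hV : IsPotential V) (hW : IsPotential W) : beta₁ V W < 1 := by
  have h := inPhaseFreq_sq_eq hV hW
  have := pow_pos (inPhaseFreq_pos hV hW) 2
  linarith

theorem IsLocalMode.thetaMatrix_zero (h : IsLocalMode V W Q₀ Qπ T ρ r R) (θ τ : ℝ) :
    thetaMatrix V W Q₀ Qπ T θ 0 τ = hermMatrix (√(1 - beta₁ V W * Real.sin θ ^ 2) ^ 2) 0 0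
      (√(inPhaseFreq V W ^ 2 + beta₁ V W * Real.sin θ ^ 2) ^ 2) := by
  have hb := beta₁_pos h.pos_V h.pos_W
  have hb1 := beta₁_lt_one h.pos_V h.pos_W
  have hs := Real.sin_sq_le_one θ
  have hs0 := sq_nonneg (Real.sin θ)
  have hw := omegaSq_pos h.pos_V h.pos_W
  have e1 : iteratedDeriv 2 (Vt V W) 0 = harmonicCoeff V / omegaSq V W :=
    iteratedDeriv_two_div_const _
  have e2 : iteratedDeriv 2 (Wt V W) 0 = harmonicCoeff W / omegaSq V W :=
    iteratedDeriv_two_div_const _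
  have e3 : harmonicCoeff V / omegaSq V W = 1 - beta₁ V W := by
    rw [← inPhaseFreq_sq_eq h.pos_V h.pos_W, inPhaseFreq_sq h.pos_V h.pos_W]
  have e4 : harmonicCoeff W / omegaSq V W = beta₁ V W / 4 := by
    rw [beta₁]; ring
  rw [Real.sq_sqrt (by nlinarith), Real.sq_sqrt (by positivity),
    inPhaseFreq_sq_eq h.pos_V h.pos_W]
  simp only [thetaMatrix, onsiteCoeff, interCoeff, oddCoeff, coeff₂, h.mode.order_zero_Q₀,
    h.mode.order_zero_Qπ, h.mode.order_zero_T, add_zero, mul_zero, e1, e2, e3, e4,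
    sub_self]
  congr 1 <;> ring

theorem IsLocalMode.blocks_zero (h : IsLocalMode V W Q₀ Qπ T ρ r R) {θ a b : ℝ}
    (hZ : IsFundamental (thetaMatrix V W Q₀ Qπ T θ 0) (fundMatrix V W Q₀ Qπ T θ 0))
    (hθ : Real.sin θ ^ 2 < 1) (ha : a = √(1 - beta₁ V W * Real.sin θ ^ 2))
    (hb : b = √(inPhaseFreq V W ^ 2 + beta₁ V W * Real.sin θ ^ 2)) :
    detC V W Q₀ Qπ T θ 0 = -(a * Real.sin (a * Real.pi) * (b * Real.sin (b * Real.pi))) ∧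
    detB V W Q₀ Qπ T θ 0 = -(Real.sin (a * Real.pi) / a * (Real.sin (b * Real.pi) / b)) ∧
    (monodromy V W Q₀ Qπ T θ 0).toBlocks₁₁.det.re =
      -(Real.cos (a * Real.pi) * Real.cos (b * Real.pi)) ∧
    (monodromy V W Q₀ Qπ T θ 0).toBlocks₁₁.trace.re =
      -Real.cos (a * Real.pi) + Real.cos (b * Real.pi) := by
  have hβ := beta₁_pos h.pos_V h.pos_W
  have hβ1 := beta₁_lt_one h.pos_V h.pos_W
  have hΩ := inPhaseFreq_pos h.pos_V h.pos_W
  have hs0 := sq_nonneg (Real.sin θ)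
  have ha0 : a ≠ 0 := by rw [ha]; exact (Real.sqrt_pos.2 (by nlinarith)).ne'
  have hb0 : b ≠ 0 := by rw [hb]; exact (Real.sqrt_pos.2 (by positivity)).ne'
  have := hZ.eq_oscillators ha0 hb0 (fun t => by rw [h.thetaMatrix_zero, ha, hb]) Real.pi
  simp only [detC, detB, monodromy, this]
  exact flip4_mul_oscillators_blocks a b

/-- Since `sin² θ ~ θ²`, a first derivative in `sin² θ` becomes a `θ²`-coefficient. -/
theorem tendsto_comp_sin_sq {F : ℝ → ℝ} {κ : ℝ} (hF : HasDerivAt F κ 0) :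
    Tendsto (fun θ => (F (Real.sin θ ^ 2) - F 0) / θ ^ 2) (𝓝[>] 0) (𝓝 κ) := by
  have h1 := hasDerivAt_iff_tendsto_slope_zero.1 hF
  have hne : ∀ᶠ θ : ℝ in 𝓝[>] 0, Real.sin θ ^ 2 ≠ 0 := by
    filter_upwards [Ioo_mem_nhdsGT Real.pi_pos] with θ hθ
    exact pow_ne_zero _ (Real.sin_pos_of_pos_of_lt_pi hθ.1 hθ.2).ne'
  have hlim : Tendsto (fun θ => Real.sin θ ^ 2) (𝓝[>] 0) (𝓝[≠] 0) := by
    refine tendsto_nhdsWithin_iff.2 ⟨?_, hne⟩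
    have : Continuous fun θ => Real.sin θ ^ 2 := by fun_prop
    have h := this.tendsto 0
    simp only [Real.sin_zero, ne_eq, OfNat.ofNat_ne_zero, not_false_eq_true, zero_pow] at h
    exact h.mono_left nhdsWithin_le_nhds
  have hsin : Tendsto (fun θ => Real.sin θ / θ) (𝓝[>] 0) (𝓝 1) := by
    have := hasDerivAt_iff_tendsto_slope_zero.1 (Real.hasDerivAt_sin 0)
    simp only [zero_add, Real.sin_zero, sub_zero, Real.cos_zero, smul_eq_mul] at this
    refine (this.mono_left (nhdsWithin_mono _ fun x hx => ne_of_gt hx)).congr fun θ => ?_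
    rw [inv_mul_eq_div]
  have h2 := (h1.comp hlim).mul (hsin.pow 2)
  rw [one_pow, mul_one] at h2
  refine h2.congr' ?_
  filter_upwards [hne] with θ hθ
  have hθ' : Real.sin θ ≠ 0 := by simpa using hθ
  simp only [Function.comp, zero_add, smul_eq_mul]
  field_simp

theorem hasDerivAt_sqrt_affine {c : ℝ} (hc : 0 < c) (β : ℝ) :
    HasDerivAt (fun s => √(c + β * s)) (β / (2 * √c)) 0 := by
  have h := ((((hasDerivAt_id (0 : ℝ)).const_mul β).const_add c)).sqrt (by simpa using hc.ne')
  simpa using h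

/-- Second-order expansion in `θ` of the determinants at `y = 0`. -/
theorem IsLocalMode.tendsto_det_zero (h : IsLocalMode V W Q₀ Qπ T ρ r R) {s : ℝ} (hs : 0 < s)
    (hs1 : s ≤ 1) (hZ : ∀ θ ∈ Ioo (-s) s,
      IsFundamental (thetaMatrix V W Q₀ Qπ T θ 0) (fundMatrix V W Q₀ Qπ T θ 0)) :
    Tendsto (fun θ => (detC V W Q₀ Qπ T θ 0 - detC V W Q₀ Qπ T 0 0) / θ ^ 2) (𝓝[>] 0)
      (𝓝 (-(inPhaseFreq V W * Real.sin (inPhaseFreq V W * Real.pi)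
        * (Real.pi * beta₁ V W / 2)))) ∧
    Tendsto (fun θ => (detB V W Q₀ Qπ T θ 0 - detB V W Q₀ Qπ T 0 0) / θ ^ 2) (𝓝[>] 0)
      (𝓝 (-(Real.sin (inPhaseFreq V W * Real.pi) / inPhaseFreq V W
        * (Real.pi * beta₁ V W / 2)))) := by
  set β := beta₁ V W with hβd
  set Ω := inPhaseFreq V W with hΩd
  have hΩ : 0 < Ω := inPhaseFreq_pos h.pos_V h.pos_W
  have hsin : ∀ θ ∈ Ioo (-s) s, Real.sin θ ^ 2 < 1 := by
    intro θ hθ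
    have hc : 0 < Real.cos θ := Real.cos_pos_of_mem_Ioo
      ⟨by linarith [hθ.1, Real.pi_gt_three], by linarith [hθ.2, Real.pi_gt_three]⟩
    have := Real.sin_sq_add_cos_sq θ
    have := pow_pos hc 2
    linarith
  have d1 : HasDerivAt (fun s => √(1 - β * s)) (-(β / 2)) 0 := by
    have := hasDerivAt_sqrt_affine one_pos (-β)
    simp only [neg_mul, ← sub_eq_add_neg, Real.sqrt_one, mul_one, neg_div] at this
    exact this
  have d2 : HasDerivAt (fun s => √(Ω ^ 2 + β * s)) (β / (2 * Ω)) 0 := by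
    have := hasDerivAt_sqrt_affine (pow_pos hΩ 2) β
    rwa [Real.sqrt_sq hΩ.le] at this
  have v1 : √(1 - β * 0) = 1 := by simp
  have v2 : √(Ω ^ 2 + β * 0) = Ω := by rw [mul_zero, add_zero, Real.sqrt_sq hΩ.le]
  -- The out-of-phase frequency is `1` at `θ = 0`, so its factor `sin(aπ)` vanishes there and only
  -- the derivative of this factor contributes to the coefficients below.
  have s1 := (d1.mul_const Real.pi).sin
  have s2 := (d2.mul_const Real.pi).sin
  have hev : ∀ᶠ θ in 𝓝[>] 0, θ ∈ Ioo (-s) s :=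
    (Filter.eventually_of_mem (Ioo_mem_nhdsGT hs)) fun θ hθ => ⟨by linarith [hθ.1], hθ.2⟩
  have h0 : (0 : ℝ) ∈ Ioo (-s) s := ⟨by linarith, hs⟩
  have hb0 := h.blocks_zero (hZ 0 h0) (hsin 0 h0) rfl rfl
  have z0 : Real.sin 0 ^ 2 = 0 := by simp
  constructor
  · have F := tendsto_comp_sin_sq ((d1.mul s1).mul (d2.mul s2)).neg
    simp only [v1, v2, Pi.neg_apply, Pi.mul_apply, one_mul, Real.sin_pi, Real.cos_pi] at F
    have e : -((-(β / 2) * 0 + -1 * (-(β / 2) * Real.pi)) * (Ω * Real.sin (Ω * Real.pi)) +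
        0 * (β / (2 * Ω) * Real.sin (Ω * Real.pi)
          + Ω * (Real.cos (Ω * Real.pi) * (β / (2 * Ω) * Real.pi)))) =
        -(Ω * Real.sin (Ω * Real.pi) * (Real.pi * β / 2)) := by ring
    rw [e] at F
    refine F.congr' ?_
    filter_upwards [hev] with θ hθ
    rw [(h.blocks_zero (hZ θ hθ) (hsin θ hθ) rfl rfl).1, hb0.1, z0, v1, v2]
    simp [← hβd, ← hΩd]
  · have F := tendsto_comp_sin_sq ((s1.div d1 (by rw [v1]; exact one_ne_zero)).mul
      (s2.div d2 (by rw [v2]; exact hΩ.ne'))).neg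
    simp only [v1, v2, Pi.neg_apply, Pi.mul_apply, Pi.div_apply, one_mul, Real.sin_pi,
      Real.cos_pi] at F
    have e : ∀ x, -((-1 * (-(β / 2) * Real.pi) * 1 - 0 * -(β / 2)) / 1 ^ 2
          * (Real.sin (Ω * Real.pi) / Ω) + 0 / 1 * x) =
        -(Real.sin (Ω * Real.pi) / Ω * (Real.pi * β / 2)) := fun x => by ring
    rw [e] at F
    refine F.congr' ?_
    filter_upwards [hev] with θ hθ
    rw [(h.blocks_zero (hZ θ hθ) (hsin θ hθ) rfl rfl).2.1, hb0.2.1, z0, v1, v2]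
    simp [← hβd, ← hΩd]

end Harmonic

/-! ### Partial derivatives of families and their commutation. -/

section PartialDerivatives

variable {f : ℝ → ℝ → ℝ} {r : ℝ}

theorem hasDerivAt_partial_fst
    (hf : ContDiffOn ℝ ∞ (fun p : ℝ × ℝ => f p.1 p.2) (Ioo (-r) r ×ˢ univ))
    {y : ℝ} (hy : y ∈ Ioo (-r) r) (t : ℝ) :
    HasDerivAt (fun z => f z t) (deriv (fun z => f z t) y) y :=
  (hasDerivAt_fst_of_contDiffOn hf hy t).differentiableAt.hasDerivAt

theorem hasDerivAt_partial_snd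
    (hf : ContDiffOn ℝ ∞ (fun p : ℝ × ℝ => f p.1 p.2) (Ioo (-r) r ×ˢ univ))
    {y : ℝ} (hy : y ∈ Ioo (-r) r) (t : ℝ) : HasDerivAt (f y) (deriv (f y) t) t :=
  (hasDerivAt_snd_of_contDiffOn hf hy t).differentiableAt.hasDerivAt

theorem contDiffOn_partial_fst
    (hf : ContDiffOn ℝ ∞ (fun p : ℝ × ℝ => f p.1 p.2) (Ioo (-r) r ×ˢ univ)) :
    ContDiffOn ℝ ∞ (fun p : ℝ × ℝ => deriv (fun z => f z p.2) p.1) (Ioo (-r) r ×ˢ univ) :=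
  (contDiffOn_fderiv_apply hf (1, 0)).congr fun p hp =>
    (hasDerivAt_fst_of_contDiffOn hf hp.1 p.2).deriv

theorem contDiffOn_partial_snd
    (hf : ContDiffOn ℝ ∞ (fun p : ℝ × ℝ => f p.1 p.2) (Ioo (-r) r ×ˢ univ)) :
    ContDiffOn ℝ ∞ (fun p : ℝ × ℝ => deriv (f p.1) p.2) (Ioo (-r) r ×ˢ univ) :=
  (contDiffOn_fderiv_apply hf (0, 1)).congr fun p hp =>
    (hasDerivAt_snd_of_contDiffOn hf hp.1 p.2).deriv

theorem hasDerivAt_partial_snd_snd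
    (hf : ContDiffOn ℝ ∞ (fun p : ℝ × ℝ => f p.1 p.2) (Ioo (-r) r ×ˢ univ))
    {y : ℝ} (hy : y ∈ Ioo (-r) r) (t : ℝ) : HasDerivAt (deriv (f y)) (deriv (deriv (f y)) t) t :=
  hasDerivAt_partial_snd (f := fun y => deriv (f y)) (contDiffOn_partial_snd hf) hy t

theorem deriv_partial_comm
    (hf : ContDiffOn ℝ ∞ (fun p : ℝ × ℝ => f p.1 p.2) (Ioo (-r) r ×ˢ univ))
    {y : ℝ} (hy : y ∈ Ioo (-r) r) (t : ℝ) :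
    deriv (fun s => deriv (fun z => f z s) y) t = deriv (fun z => deriv (f z) t) y := by
  set F : ℝ × ℝ → ℝ := fun p => f p.1 p.2 with hF
  have hopen : IsOpen (Ioo (-r) r ×ˢ (univ : Set ℝ)) := isOpen_Ioo.prod isOpen_univ
  have hmem : (y, t) ∈ Ioo (-r) r ×ˢ (univ : Set ℝ) := ⟨hy, mem_univ _⟩
  have hd : DifferentiableAt ℝ (fderiv ℝ F) (y, t) :=
    ((hf.fderiv_of_isOpen (m := ∞) hopen (by simp)).contDiffAt (hopen.mem_nhds hmem)).differentiableAt
      (by simp)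
  have hsymm : IsSymmSndFDerivAt ℝ F (y, t) :=
    (hf.contDiffAt (hopen.mem_nhds hmem)).isSymmSndFDerivAt (by
      rw [minSmoothness_of_isRCLikeNormedField]; exact WithTop.coe_le_coe.2 (le_top : (2 : ℕ∞) ≤ ⊤))
  have k : ∀ v : ℝ × ℝ, HasFDerivAt (fun p => fderiv ℝ F p v)
      ((ContinuousLinearMap.apply ℝ ℝ v).comp (fderiv ℝ (fderiv ℝ F) (y, t))) (y, t) := fun v =>
    (ContinuousLinearMap.apply ℝ ℝ v).hasFDerivAt.comp (y, t) hd.hasFDerivAt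
  have h1 : (fun s => deriv (fun z => f z s) y) = fun s => fderiv ℝ F (y, s) (1, 0) :=
    funext fun s => (hasDerivAt_fst_of_contDiffOn hf hy s).deriv
  have h2 : (fun z => deriv (f z) t) =ᶠ[𝓝 y] fun z => fderiv ℝ F (z, t) (0, 1) := by
    filter_upwards [isOpen_Ioo.mem_nhds hy] with z hz
    exact (hasDerivAt_snd_of_contDiffOn hf hz t).deriv
  have d1 : HasDerivAt (fun s => fderiv ℝ F (y, s) (1, 0))
      (fderiv ℝ (fderiv ℝ F) (y, t) (0, 1) (1, 0)) t :=
    (k (1, 0)).comp_hasDerivAt (f := fun s => (y, s)) t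
      ((hasDerivAt_const t y).prodMk (hasDerivAt_id t))
  have d2 : HasDerivAt (fun z => fderiv ℝ F (z, t) (0, 1))
      (fderiv ℝ (fderiv ℝ F) (y, t) (1, 0) (0, 1)) y :=
    (k (0, 1)).comp_hasDerivAt (f := fun z => (z, t)) y
      ((hasDerivAt_id y).prodMk (hasDerivAt_const y t))
  rw [h1, h2.deriv_eq, d1.deriv, d2.deriv, hsymm]

end PartialDerivatives

/-! ### Real solutions in terms of the blocks of the half-period matrix. -/

section RealSolutions

variable {a : ℝ → Mat2} {Z : ℝ → Mat4} {P B C D : Mat2} {f g f' g' x₁ x₂ x₄ : ℝ → ℝ}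

theorem IsFundamental.real_solution (hZ : IsFundamental a Z)
    (ha : ∀ t, a t = hermMatrix (x₁ t) (x₂ t) 0 (x₄ t))
    (hM : flip4 * Z Real.pi = Matrix.fromBlocks P B C D)
    (hf : ∀ t, HasDerivAt f (f' t) t) (hg : ∀ t, HasDerivAt g (g' t) t)
    (hf' : ∀ t, HasDerivAt f' (-(x₁ t * f t + x₂ t * g t)) t)
    (hg' : ∀ t, HasDerivAt g' (-(x₂ t * f t + x₄ t * g t)) t) :
    P *ᵥ ![(f 0 : ℂ), (g 0 : ℂ)] + B *ᵥ ![(f' 0 : ℂ), (g' 0 : ℂ)] =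
      ![-(f Real.pi : ℂ), (g Real.pi : ℂ)] ∧
    C *ᵥ ![(f 0 : ℂ), (g 0 : ℂ)] + D *ᵥ ![(f' 0 : ℂ), (g' 0 : ℂ)] =
      ![-(f' Real.pi : ℂ), (g' Real.pi : ℂ)] := by
  have hX : ∀ t, HasDerivAt (fun t => (Sum.elim ![(f t : ℂ), (g t : ℂ)] ![(f' t : ℂ), (g' t : ℂ)] :
      Fin 2 ⊕ Fin 2 → ℂ))
      (firstOrder (a t) *ᵥ Sum.elim ![(f t : ℂ), (g t : ℂ)] ![(f' t : ℂ), (g' t : ℂ)]) t := by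
    intro t
    rw [firstOrder_mulVec, ha]
    refine hasDerivAt_pi.2 fun i => ?_
    rcases i with i | i <;> fin_cases i
    · exact (hf t).ofReal_comp
    · exact (hg t).ofReal_comp
    · refine (hf' t).ofReal_comp.congr_deriv ?_
      simp [hermMatrix]; ring
    · refine (hg' t).ofReal_comp.congr_deriv ?_
      simp [hermMatrix]; ring
  have h := congrArg (fun v => flip4 *ᵥ v) (hZ.eq_mulVec hX Real.pi)
  simp only [Matrix.mulVec_mulVec, hM] at h
  rw [flip4, Matrix.fromBlocks_mulVec, Matrix.fromBlocks_mulVec] at h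
  simp only [Sum.elim_comp_inl, Sum.elim_comp_inr, Matrix.zero_mulVec, add_zero, zero_add] at h
  have hfl : ∀ x y : ℂ, flip2 *ᵥ ![x, y] = ![-x, y] := fun x y => by
    ext i; fin_cases i <;> simp [flip2, Matrix.mulVec, dotProduct, Fin.sum_univ_two]
  rw [hfl, hfl] at h
  constructor
  · ext i
    exact (congrFun h (Sum.inl i)).symm
  · ext i
    exact (congrFun h (Sum.inr i)).symm

end RealSolutions

/-! ### Two explicit solutions at `δ = 0`: the velocity and the amplitude derivative of the mode. -/

section Linearization

variable {V W : ℝ → ℝ} {Q₀ Qπ : ℝ → ℝ → ℝ} {T : ℝ → ℝ} {ρ r R : ℝ}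

theorem thetaMatrix_theta_zero (y τ : ℝ) :
    thetaMatrix V W Q₀ Qπ T 0 y τ = hermMatrix (onsiteCoeff V W Q₀ Qπ T y τ
      + 4 * interCoeff V W Qπ T y τ) (coeff₂ V W Q₀ Qπ T y τ) 0 (onsiteCoeff V W Q₀ Qπ T y τ) := by
  simp [thetaMatrix]

/-- The force on the in-phase component, up to the factor `-T²`. -/
noncomputable def inPhaseForce (V W : ℝ → ℝ) (u v : ℝ) : ℝ :=
  (1 / 2) * (deriv (Vt V W) (u + v) + deriv (Vt V W) (u - v))

/-- The force on the out-of-phase component, up to the factor `-T²`. -/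
noncomputable def outPhaseForce (V W : ℝ → ℝ) (u v : ℝ) : ℝ :=
  (1 / 2) * (deriv (Vt V W) (u + v) - deriv (Vt V W) (u - v))
    + deriv (Wt V W) (2 * v) - deriv (Wt V W) (-2 * v)

theorem hasDerivAt_deriv_of_contDiffOn {f : ℝ → ℝ} (hf : ContDiffOn ℝ ∞ f (Ioo (-R) R)) {x : ℝ}
    (hx : |x| < R) : HasDerivAt (deriv f) (iteratedDeriv 2 f x) x := by
  rw [iteratedDeriv_succ, iteratedDeriv_one]
  exact (((contDiffOn_deriv_Ioo hf).contDiffAt (isOpen_Ioo.mem_nhds (abs_lt.1 hx))).differentiableAt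
    (by simp)).hasDerivAt

/-- `T` is frozen at `y` and the path `(u, v)` is arbitrary, so the same chain rule serves
differentiation in `τ` and in the amplitude. -/
theorem IsLocalMode.hasDerivAt_force (h : IsLocalMode V W Q₀ Qπ T ρ r R) {y τ : ℝ}
    (hy : y ∈ Ioo (-r) r) {u v : ℝ → ℝ} {u' v' s : ℝ} (hu : HasDerivAt u u' s)
    (hv : HasDerivAt v v' s) (hus : u s = Q₀ y τ) (hvs : v s = Qπ y τ) :
    HasDerivAt (fun s => -T y ^ 2 * inPhaseForce V W (u s) (v s))
      (-(coeff₂ V W Q₀ Qπ T y τ * v' + onsiteCoeff V W Q₀ Qπ T y τ * u')) s ∧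
    HasDerivAt (fun s => -T y ^ 2 * outPhaseForce V W (u s) (v s))
      (-((onsiteCoeff V W Q₀ Qπ T y τ + 4 * interCoeff V W Qπ T y τ) * v'
        + coeff₂ V W Q₀ Qπ T y τ * u')) s := by
  obtain ⟨b1, b2⟩ := h.small y hy τ
  rw [abs_lt] at b1 b2
  have k1 := (hasDerivAt_deriv_of_contDiffOn h.smooth_V (x := u s + v s)
    (by rw [hus, hvs, abs_lt]; constructor <;> linarith)).comp s (hu.add hv)
  have k2 := (hasDerivAt_deriv_of_contDiffOn h.smooth_V (x := u s - v s)
    (by rw [hus, hvs, abs_lt]; constructor <;> linarith)).comp s (hu.sub hv)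
  have k3 := (hasDerivAt_deriv_of_contDiffOn h.smooth_W (x := 2 * v s)
    (by rw [hvs, abs_lt]; constructor <;> linarith)).comp s (hv.const_mul 2)
  have k4 := (hasDerivAt_deriv_of_contDiffOn h.smooth_W (x := -2 * v s)
    (by rw [hvs, abs_lt]; constructor <;> linarith)).comp s (hv.const_mul (-2))
  rw [hus, hvs] at k1 k2
  rw [hvs] at k3 k4
  constructor
  · refine (((k1.add k2).const_mul (1 / 2)).const_mul (-T y ^ 2)).congr_deriv ?_
    unfold coeff₂ onsiteCoeff
    ring
  · refine (((((k1.sub k2).const_mul (1 / 2)).add k3).sub k4).const_mul (-T y ^ 2)).congr_deriv ?_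
    unfold coeff₂ onsiteCoeff interCoeff
    ring

theorem IsLocalMode.smooth (h : IsLocalMode V W Q₀ Qπ T ρ r R) :
    ContDiffOn ℝ ∞ (fun p : ℝ × ℝ => Q₀ p.1 p.2) (Ioo (-r) r ×ˢ univ) ∧
    ContDiffOn ℝ ∞ (fun p : ℝ × ℝ => Qπ p.1 p.2) (Ioo (-r) r ×ˢ univ) ∧
    ContDiffOn ℝ ∞ T (Ioo (-r) r) := by
  have hsub : Ioo (-r) r ⊆ Ioo (-ρ) ρ := Ioo_subset_Ioo (by linarith [h.radius_le]) h.radius_le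
  exact ⟨h.mode.smooth_Q₀.mono (prod_mono hsub le_rfl),
    h.mode.smooth_Qπ.mono (prod_mono hsub le_rfl), h.mode.smooth_T.mono hsub⟩

theorem IsLocalMode.motion (h : IsLocalMode V W Q₀ Qπ T ρ r R) {y : ℝ} (hy : y ∈ Ioo (-r) r)
    (τ : ℝ) : deriv (deriv (Q₀ y)) τ = -T y ^ 2 * inPhaseForce V W (Q₀ y τ) (Qπ y τ) ∧
      deriv (deriv (Qπ y)) τ = -T y ^ 2 * outPhaseForce V W (Q₀ y τ) (Qπ y τ) := by
  have hyρ : y ∈ Ioo (-ρ) ρ := Ioo_subset_Ioo (by linarith [h.radius_le]) h.radius_le hy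
  have h1 := h.mode.motion_Q₀ y hyρ τ
  have h2 := h.mode.motion_Qπ y hyρ τ
  rw [iteratedDeriv_succ, iteratedDeriv_one] at h1 h2
  unfold inPhaseForce outPhaseForce
  constructor
  · linear_combination h1
  · linear_combination h2

theorem IsLocalMode.deriv_endpoints (h : IsLocalMode V W Q₀ Qπ T ρ r R) {y : ℝ}
    (hy : y ∈ Ioo (-r) r) : deriv (Q₀ y) 0 = 0 ∧ deriv (Qπ y) 0 = 0 ∧
      deriv (Q₀ y) Real.pi = 0 ∧ deriv (Qπ y) Real.pi = 0 := by
  have hyρ : y ∈ Ioo (-ρ) ρ := Ioo_subset_Ioo (by linarith [h.radius_le]) h.radius_le hy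
  exact ⟨deriv_zero_of_even (h.mode.even_Q₀ y hyρ), deriv_zero_of_even (h.mode.even_Qπ y hyρ),
    deriv_pi_of_even_periodic (h.mode.even_Q₀ y hyρ) (h.mode.periodic_Q₀ y hyρ),
    deriv_pi_of_even_periodic (h.mode.even_Qπ y hyρ) (h.mode.periodic_Qπ y hyρ)⟩

/-- The time derivative of the mode solves the variational system at `δ = 0`. -/
theorem IsLocalMode.hasDerivAt_velocity (h : IsLocalMode V W Q₀ Qπ T ρ r R) {y : ℝ}
    (hy : y ∈ Ioo (-r) r) (τ : ℝ) :
    HasDerivAt (deriv (deriv (Qπ y))) (-((onsiteCoeff V W Q₀ Qπ T y τ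
      + 4 * interCoeff V W Qπ T y τ) * deriv (Qπ y) τ
      + coeff₂ V W Q₀ Qπ T y τ * deriv (Q₀ y) τ)) τ ∧
    HasDerivAt (deriv (deriv (Q₀ y))) (-(coeff₂ V W Q₀ Qπ T y τ * deriv (Qπ y) τ
      + onsiteCoeff V W Q₀ Qπ T y τ * deriv (Q₀ y) τ)) τ := by
  obtain ⟨s0, sπ, -⟩ := h.smooth
  have e1 : deriv (deriv (Q₀ y)) = fun τ => -T y ^ 2 * inPhaseForce V W (Q₀ y τ) (Qπ y τ) :=
    funext fun τ => (h.motion hy τ).1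
  have e2 : deriv (deriv (Qπ y)) = fun τ => -T y ^ 2 * outPhaseForce V W (Q₀ y τ) (Qπ y τ) :=
    funext fun τ => (h.motion hy τ).2
  have := h.hasDerivAt_force hy (hasDerivAt_partial_snd s0 hy τ) (hasDerivAt_partial_snd sπ hy τ)
    rfl rfl
  rw [e1, e2]
  exact ⟨this.2, this.1⟩

/-- The derivative of the accelerations with respect to the amplitude. -/
theorem IsLocalMode.deriv_acceleration (h : IsLocalMode V W Q₀ Qπ T ρ r R) {y : ℝ}
    (hy : y ∈ Ioo (-r) r) (hT : T y ≠ 0) (τ : ℝ) :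
    deriv (fun z => deriv (deriv (Qπ z)) τ) y = -((onsiteCoeff V W Q₀ Qπ T y τ
      + 4 * interCoeff V W Qπ T y τ) * deriv (fun z => Qπ z τ) y
      + coeff₂ V W Q₀ Qπ T y τ * deriv (fun z => Q₀ z τ) y)
      + 2 * (deriv T y / T y) * deriv (deriv (Qπ y)) τ ∧
    deriv (fun z => deriv (deriv (Q₀ z)) τ) y = -(coeff₂ V W Q₀ Qπ T y τ *
      deriv (fun z => Qπ z τ) y + onsiteCoeff V W Q₀ Qπ T y τ * deriv (fun z => Q₀ z τ) y)
      + 2 * (deriv T y / T y) * deriv (deriv (Q₀ y)) τ := by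
  obtain ⟨s0, sπ, sT⟩ := h.smooth
  have hdT : HasDerivAt T (deriv T y) y :=
    ((sT.contDiffAt (isOpen_Ioo.mem_nhds hy)).differentiableAt (by simp)).hasDerivAt
  obtain ⟨f1, f2⟩ := h.hasDerivAt_force hy (hasDerivAt_partial_fst s0 hy τ)
    (hasDerivAt_partial_fst sπ hy τ) rfl rfl
  have hq := (hdT.pow 2).div_const (T y ^ 2)
  obtain ⟨m1, m2⟩ := h.motion hy τ
  constructor
  -- Factoring out `T z ^ 2 / T y ^ 2` freezes `T` in the force; the derivative of this factor is
  -- the forcing `2 (T'/T) Q''`.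
  · have e : (fun z => deriv (deriv (Qπ z)) τ) =ᶠ[𝓝 y] fun z => T z ^ 2 / T y ^ 2 *
        (-T y ^ 2 * outPhaseForce V W (Q₀ z τ) (Qπ z τ)) := by
      filter_upwards [isOpen_Ioo.mem_nhds hy] with z hz
      rw [(h.motion hz τ).2]
      field_simp
    rw [e.deriv_eq]
    refine (hq.mul f2).deriv.trans ?_
    rw [m2]
    simp only [Pi.pow_apply]
    field_simp
    ring
  · have e : (fun z => deriv (deriv (Q₀ z)) τ) =ᶠ[𝓝 y] fun z => T z ^ 2 / T y ^ 2 *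
        (-T y ^ 2 * inPhaseForce V W (Q₀ z τ) (Qπ z τ)) := by
      filter_upwards [isOpen_Ioo.mem_nhds hy] with z hz
      rw [(h.motion hz τ).1]
      field_simp
    rw [e.deriv_eq]
    refine (hq.mul f1).deriv.trans ?_
    rw [m1]
    simp only [Pi.pow_apply]
    field_simp
    ring

/-- If the accelerations at `τ = 0` do not vanish, the odd solution given by the velocity makes
the upper right block of the monodromy singular. -/
theorem IsLocalMode.det_eq_zero_of_velocity (h : IsLocalMode V W Q₀ Qπ T ρ r R) {y : ℝ}
    (hy : y ∈ Ioo (-r) r) {Z : ℝ → Mat4} {P B C D : Mat2}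
    (hZ : IsFundamental (thetaMatrix V W Q₀ Qπ T 0 y) Z)
    (hM : flip4 * Z Real.pi = Matrix.fromBlocks P B C D) (hne : deriv (deriv (Qπ y)) 0 ≠ 0) :
    B.det = 0 := by
  obtain ⟨s0, sπ, -⟩ := h.smooth
  obtain ⟨e1, e2, e3, e4⟩ := h.deriv_endpoints hy
  have := (hZ.real_solution (fun t => thetaMatrix_theta_zero y t) hM
    (fun t => hasDerivAt_partial_snd_snd sπ hy t)
    (fun t => hasDerivAt_partial_snd_snd s0 hy t)
    (fun t => (h.hasDerivAt_velocity hy t).1) (fun t => (h.hasDerivAt_velocity hy t).2)).1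
  rw [← Matrix.exists_mulVec_eq_zero_iff]
  refine ⟨![((deriv (deriv (Qπ y)) 0 : ℝ) : ℂ), ((deriv (deriv (Q₀ y)) 0 : ℝ) : ℂ)], ?_, ?_⟩
  · intro h0
    exact hne (by simpa using congrFun h0 0)
  · rw [e1, e2, e3, e4] at this
    have e : ![((0 : ℝ) : ℂ), ((0 : ℝ) : ℂ)] = 0 := by ext i; fin_cases i <;> simp
    have e' : ![-((0 : ℝ) : ℂ), ((0 : ℝ) : ℂ)] = 0 := by ext i; fin_cases i <;> simp
    rw [e, e', Matrix.mulVec_zero, zero_add] at this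
    exact this

/-- The even solution of the variational system at `δ = 0` given by the derivative of the mode
with respect to the amplitude, at fixed physical time. -/
theorem IsLocalMode.amplitude_solution (h : IsLocalMode V W Q₀ Qπ T ρ r R) {y : ℝ}
    (hy : y ∈ Ioo (-r) r) (hT : T y ≠ 0) {Z : ℝ → Mat4} {P B C D : Mat2}
    (hZ : IsFundamental (thetaMatrix V W Q₀ Qπ T 0 y) Z)
    (hM : flip4 * Z Real.pi = Matrix.fromBlocks P B C D) :
    C *ᵥ ![((deriv (fun z => Qπ z 0) y : ℝ) : ℂ), ((deriv (fun z => Q₀ z 0) y : ℝ) : ℂ)] =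
      ![((deriv T y / T y * Real.pi * deriv (deriv (Qπ y)) Real.pi : ℝ) : ℂ),
        ((-(deriv T y / T y * Real.pi * deriv (deriv (Q₀ y)) Real.pi) : ℝ) : ℂ)] := by
  obtain ⟨s0, sπ, -⟩ := h.smooth
  obtain ⟨e1, e2, e3, e4⟩ := h.deriv_endpoints hy
  set k := deriv T y / T y with hk
  have hcomm : ∀ {Q : ℝ → ℝ → ℝ},
      ContDiffOn ℝ ∞ (fun p : ℝ × ℝ => Q p.1 p.2) (Ioo (-r) r ×ˢ univ) → ∀ t,
      HasDerivAt (fun s => deriv (fun z => Q z s) y) (deriv (fun z => deriv (Q z) t) y) t ∧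
      HasDerivAt (fun s => deriv (fun z => deriv (Q z) s) y)
        (deriv (fun z => deriv (deriv (Q z)) t) y) t := by
    intro Q hQ t
    constructor
    · rw [← deriv_partial_comm hQ hy t]
      exact hasDerivAt_partial_snd (f := fun y s => deriv (fun z => Q z s) y)
        (contDiffOn_partial_fst hQ) hy t
    · rw [← deriv_partial_comm (f := fun y => deriv (Q y)) (contDiffOn_partial_snd hQ) hy t]
      exact hasDerivAt_partial_snd (f := fun y s => deriv (fun z => deriv (Q z) s) y)
        (contDiffOn_partial_fst (f := fun y => deriv (Q y)) (contDiffOn_partial_snd hQ)) hy t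
  -- The secular term `(T'/T) τ ∂_τ Q` converts the derivative at fixed `τ` into one at fixed
  -- physical time and cancels the forcing. At `τ = π` it leaves the velocity `-(T'/T) π Q''(π)`, to
  -- which the flip adds a sign in the first component.
  have hdtau : ∀ {Q : ℝ → ℝ → ℝ},
      ContDiffOn ℝ ∞ (fun p : ℝ × ℝ => Q p.1 p.2) (Ioo (-r) r ×ˢ univ) → ∀ t,
      HasDerivAt (fun s => deriv (fun z => Q z s) y - k * (s * deriv (Q y) s))
        (deriv (fun z => deriv (Q z) t) y - k * (deriv (Q y) t + t * deriv (deriv (Q y)) t)) t := by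
    intro Q hQ t
    refine ((hcomm hQ t).1.sub (((hasDerivAt_id t).mul
      (hasDerivAt_partial_snd_snd hQ hy t)).const_mul k)).congr_deriv ?_
    simp
  have hdtau2 : ∀ {Q : ℝ → ℝ → ℝ} {c : ℝ},
      ContDiffOn ℝ ∞ (fun p : ℝ × ℝ => Q p.1 p.2) (Ioo (-r) r ×ˢ univ) → ∀ t,
      HasDerivAt (deriv (deriv (Q y))) c t →
      HasDerivAt (fun s => deriv (fun z => deriv (Q z) s) y
          - k * (deriv (Q y) s + s * deriv (deriv (Q y)) s))
        (deriv (fun z => deriv (deriv (Q z)) t) y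
          - k * (2 * deriv (deriv (Q y)) t + t * c)) t := by
    intro Q c hQ t hc
    refine ((hcomm hQ t).2.sub (((hasDerivAt_partial_snd_snd hQ hy t).add
      ((hasDerivAt_id t).mul hc)).const_mul k)).congr_deriv ?_
    simp only [id]
    ring
  have hsol := (hZ.real_solution (fun t => thetaMatrix_theta_zero y t) hM
    (fun t => hdtau sπ t) (fun t => hdtau s0 t)
    (fun t => (hdtau2 sπ t (h.hasDerivAt_velocity hy t).1).congr_deriv (by
      rw [(h.deriv_acceleration hy hT t).1]; ring))
    (fun t => (hdtau2 s0 t (h.hasDerivAt_velocity hy t).2).congr_deriv (by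
      rw [(h.deriv_acceleration hy hT t).2]; ring))).2
  have z : ∀ {Q : ℝ → ℝ → ℝ} {t : ℝ}, (∀ z ∈ Ioo (-r) r, deriv (Q z) t = 0) →
      deriv (fun z => deriv (Q z) t) y = 0 := by
    intro Q t hz
    have : (fun z => deriv (Q z) t) =ᶠ[𝓝 y] fun _ => 0 := by
      filter_upwards [isOpen_Ioo.mem_nhds hy] with z hz' using hz z hz'
    rw [this.deriv_eq, deriv_const]
  rw [z (Q := Qπ) (t := 0) fun z hz => (h.deriv_endpoints hz).2.1,
    z (Q := Q₀) (t := 0) fun z hz => (h.deriv_endpoints hz).1,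
    z (Q := Qπ) (t := Real.pi) fun z hz => (h.deriv_endpoints hz).2.2.2,
    z (Q := Q₀) (t := Real.pi) fun z hz => (h.deriv_endpoints hz).2.2.1, e1, e2, e3, e4] at hsol
  have e : ∀ x : ℝ, 0 - k * (0 + 0 * x) = 0 := fun x => by ring
  have e5 : ∀ x : ℝ, x - k * (0 * 0) = x := fun x => by ring
  have e6 : ![((0 : ℝ) : ℂ), ((0 : ℝ) : ℂ)] = 0 := by ext i; fin_cases i <;> simp
  rw [e, e, e6, Matrix.mulVec_zero, add_zero, e5, e5] at hsol
  rw [hsol]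
  ext i
  fin_cases i
  · simp; ring
  · simp; ring

end Linearization

/-! ### Leading orders of energy, period and acceleration. -/

section Asymptotics

variable {V W : ℝ → ℝ} {Q₀ Qπ : ℝ → ℝ → ℝ} {T : ℝ → ℝ} {ρ r R : ℝ}

theorem tendsto_div_of_hasDerivAt {u : ℝ → ℝ} {c : ℝ} (hu : HasDerivAt u c 0) (h0 : u 0 = 0) :
    Tendsto (fun y => u y / y) (𝓝[>] 0) (𝓝 c) := by
  have := hasDerivAt_iff_tendsto_slope_zero.1 hu
  simp only [zero_add, h0, sub_zero, smul_eq_mul] at this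
  refine (this.mono_left (nhdsWithin_mono _ fun x hx => ne_of_gt hx)).congr fun θ => ?_
  rw [inv_mul_eq_div]

theorem isLittleO_pow_iff_tendsto_div {u : ℝ → ℝ} {c : ℝ} {m : ℕ} :
    (fun y => u y - c * y ^ m) =o[𝓝[>] 0] (fun y : ℝ => y ^ m) ↔
      Tendsto (fun y => u y / y ^ m) (𝓝[>] 0) (𝓝 c) := by
  have hne : ∀ᶠ y : ℝ in 𝓝[>] 0, y ^ m ≠ 0 := by
    filter_upwards [self_mem_nhdsWithin] with y hy using pow_ne_zero _ (ne_of_gt hy)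
  rw [isLittleO_iff_tendsto' (hne.mono fun y h1 h2 => absurd h2 h1),
    ← tendsto_sub_nhds_zero_iff (u := fun y => u y / y ^ m)]
  refine tendsto_congr' (hne.mono fun y hy => ?_)
  field_simp

theorem tendsto_comp_quadratic {f u : ℝ → ℝ} {c : ℝ} (hR : 0 < R)
    (hf : ContDiffOn ℝ ∞ f (Ioo (-R) R)) (f0 : f 0 = 0) (f1 : deriv f 0 = 0)
    (hu : HasDerivAt u c 0) (h0 : u 0 = 0) :
    Tendsto (fun y => f (u y) / y ^ 2) (𝓝[>] 0) (𝓝 (iteratedDeriv 2 f 0 / 2 * c ^ 2)) := by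
  have hm : (0 : ℝ) ∈ Ioo (-R) R := ⟨by linarith, hR⟩
  have h := taylor_isLittleO (n := 2) (convex_Ioo (-R) R) hm
    (hf.of_le (WithTop.coe_le_coe.2 (le_top : (2 : ℕ∞) ≤ ⊤)))
  rw [isOpen_Ioo.nhdsWithin_eq hm] at h
  have h' : (fun x => f x - iteratedDeriv 2 f 0 / 2 * x ^ 2) =o[𝓝 0] fun x : ℝ => x ^ 2 := by
    refine h.congr (fun x => ?_) (fun x => by simp)
    rw [taylor_within_apply]
    congr 1
    simp only [Finset.sum_range_succ, Finset.sum_range_zero, iteratedDerivWithin_of_isOpen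
      isOpen_Ioo hm, iteratedDeriv_zero, iteratedDeriv_one, f0, f1]
    simp [Nat.factorial]
    ring
  have hlim := tendsto_div_of_hasDerivAt hu h0
  have hu0 : Tendsto u (𝓝[>] 0) (𝓝 0) := by
    have := hu.continuousAt.tendsto
    rw [h0] at this
    exact this.mono_left nhdsWithin_le_nhds
  have hO : (fun y => u y ^ 2) =O[𝓝[>] 0] fun y : ℝ => y ^ 2 := by
    have h1 : u =O[𝓝 0] fun y : ℝ => y := by simpa [h0] using hu.isBigO_sub
    exact (h1.mono nhdsWithin_le_nhds).pow 2
  have k := isLittleO_pow_iff_tendsto_div (c := 0) (m := 2)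
    (u := fun y => f (u y) - iteratedDeriv 2 f 0 / 2 * u y ^ 2) |>.1
    (by simpa [Function.comp_def] using (h'.comp_tendsto hu0).trans_isBigO hO)
  have := k.add ((hlim.pow 2).const_mul (iteratedDeriv 2 f 0 / 2))
  rw [zero_add] at this
  refine this.congr fun y => ?_
  rw [div_pow, sub_div]
  ring

theorem IsLocalMode.zero_mem (h : IsLocalMode V W Q₀ Qπ T ρ r R) : (0 : ℝ) ∈ Ioo (-r) r :=
  ⟨by linarith [h.radius_pos], h.radius_pos⟩

theorem IsLocalMode.hasDerivAt_zero (h : IsLocalMode V W Q₀ Qπ T ρ r R) (τ : ℝ) :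
    HasDerivAt (fun y => Q₀ y τ) 0 0 ∧ HasDerivAt (fun y => Qπ y τ) (Real.cos τ) 0 := by
  obtain ⟨s0, sπ, -⟩ := h.smooth
  exact ⟨(hasDerivAt_partial_fst s0 h.zero_mem τ).congr_deriv (h.mode.order_one_Q₀ τ),
    (hasDerivAt_partial_fst sπ h.zero_mem τ).congr_deriv (h.mode.order_one_Qπ τ)⟩

theorem IsLocalMode.energyDensity_eq (h : IsLocalMode V W Q₀ Qπ T ρ r R) {y : ℝ}
    (hy : y ∈ Ioo (-r) r) : energyDensity V W Q₀ Qπ T y = omegaSq V W / 2 *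
      (Vt V W (Q₀ y 0 + Qπ y 0) + Vt V W (Q₀ y 0 - Qπ y 0) + Wt V W (2 * Qπ y 0)
        + Wt V W (-2 * Qπ y 0)) := by
  obtain ⟨e1, e2, -⟩ := h.deriv_endpoints hy
  have hw := (omegaSq_pos h.pos_V h.pos_W).ne'
  rw [energyDensity, e1, e2, Vt, Vt, Wt, Wt]
  field_simp
  ring

theorem IsLocalMode.smooth_energy (h : IsLocalMode V W Q₀ Qπ T ρ r R) :
    ContDiffOn ℝ ∞ (energyDensity V W Q₀ Qπ T) (Ioo (-r) r) := by
  obtain ⟨s0, sπ, -⟩ := h.smooth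
  have k : ∀ {Q : ℝ → ℝ → ℝ}, ContDiffOn ℝ ∞ (fun p : ℝ × ℝ => Q p.1 p.2) (Ioo (-r) r ×ˢ univ) →
      ContDiffOn ℝ ∞ (fun y => Q y 0) (Ioo (-r) r) := fun hQ =>
    hQ.comp (f := fun y : ℝ => (y, (0 : ℝ))) (by fun_prop) fun y hy => ⟨hy, mem_univ _⟩
  have hb : ∀ y ∈ Ioo (-r) r, (-(R / 2) < Q₀ y 0 ∧ Q₀ y 0 < R / 2) ∧
      (-(R / 2) < Qπ y 0 ∧ Qπ y 0 < R / 2) := fun y hy => by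
    obtain ⟨b1, b2⟩ := h.small y hy 0
    exact ⟨abs_lt.1 b1, abs_lt.1 b2⟩
  refine ContDiffOn.congr (contDiffOn_const.mul (((ContDiffOn.add
    (h.smooth_V.comp ((k s0).add (k sπ)) fun y hy => ?_)
    (h.smooth_V.comp ((k s0).sub (k sπ)) fun y hy => ?_)).add
    (h.smooth_W.comp (contDiffOn_const.mul (k sπ)) fun y hy => ?_)).add
    (h.smooth_W.comp (contDiffOn_const.mul (k sπ)) fun y hy => ?_))) fun y hy =>
    h.energyDensity_eq hy
  all_goals
    obtain ⟨⟨_, _⟩, _, _⟩ := hb y hy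
    constructor
  all_goals linarith

/-- At `τ = 0` all velocities vanish by evenness, so the energy is potential and its quadratic part
comes from `Qπ ≈ y`. -/
theorem IsLocalMode.tendsto_energy (h : IsLocalMode V W Q₀ Qπ T ρ r R) :
    Tendsto (fun y => energyDensity V W Q₀ Qπ T y / y ^ 2) (𝓝[>] 0) (𝓝 (omegaSq V W / 2)) := by
  have hw := omegaSq_pos h.pos_V h.pos_W
  have v0 : Vt V W 0 = 0 := by rw [Vt, h.pos_V.zero, zero_div]
  have w0 : Wt V W 0 = 0 := by rw [Wt, h.pos_W.zero, zero_div]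
  have v1 : deriv (Vt V W) 0 = 0 := deriv_div_const_zero h.pos_V _
  have w1 : deriv (Wt V W) 0 = 0 := deriv_div_const_zero h.pos_W _
  have v2 : iteratedDeriv 2 (Vt V W) 0 = harmonicCoeff V / omegaSq V W :=
    iteratedDeriv_two_div_const _
  have w2 : iteratedDeriv 2 (Wt V W) 0 = harmonicCoeff W / omegaSq V W :=
    iteratedDeriv_two_div_const _
  obtain ⟨d0, dπ⟩ := h.hasDerivAt_zero 0
  rw [Real.cos_zero] at dπ
  have z0 := h.mode.order_zero_Q₀ 0
  have zπ := h.mode.order_zero_Qπ 0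
  have k1 := tendsto_comp_quadratic h.range_pos h.smooth_V v0 v1 (d0.add dπ) (by simp [z0, zπ])
  have k2 := tendsto_comp_quadratic h.range_pos h.smooth_V v0 v1 (d0.sub dπ) (by simp [z0, zπ])
  have k3 := tendsto_comp_quadratic h.range_pos h.smooth_W w0 w1 (dπ.const_mul 2) (by simp [zπ])
  have k4 := tendsto_comp_quadratic h.range_pos h.smooth_W w0 w1 (dπ.const_mul (-2)) (by simp [zπ])
  have := (((k1.add k2).add k3).add k4).const_mul (omegaSq V W / 2)
  rw [v2, w2] at this
  have e : omegaSq V W / 2 * (harmonicCoeff V / omegaSq V W / 2 * (0 + 1) ^ 2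
      + harmonicCoeff V / omegaSq V W / 2 * (0 - 1) ^ 2
      + harmonicCoeff W / omegaSq V W / 2 * (2 * 1) ^ 2
      + harmonicCoeff W / omegaSq V W / 2 * (-2 * 1) ^ 2) = omegaSq V W / 2 := by
    have : omegaSq V W = harmonicCoeff V + 4 * harmonicCoeff W := rfl
    field_simp
    linear_combination -2 * this
  rw [e] at this
  refine this.congr' ?_
  filter_upwards [Ioo_mem_nhdsGT h.radius_pos] with y hy
  rw [h.energyDensity_eq ⟨by linarith [hy.1, h.radius_pos], hy.2⟩]
  simp only [Pi.add_apply, Pi.sub_apply]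
  ring

/-- At small amplitudes the energy density is positive and strictly increasing. -/
theorem IsLocalMode.exists_strictMonoOn_energy (h : IsLocalMode V W Q₀ Qπ T ρ r R) :
    ∃ y₁ > 0, y₁ ≤ r ∧ StrictMonoOn (energyDensity V W Q₀ Qπ T) (Ioo 0 y₁) ∧
      ∀ y ∈ Ioo 0 y₁, 0 < energyDensity V W Q₀ Qπ T y := by
  have hw := omegaSq_pos h.pos_V h.pos_W
  have hE := h.tendsto_energy
  have h1 := isLittleO_deriv_of_isLittleO (m := 1) h.radius_pos h.smooth_energy
    (isLittleO_pow_iff_tendsto_div.2 hE)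
  have h2 := isLittleO_pow_iff_tendsto_div.1 h1
  have p1 := h2.eventually_const_lt (u := 0) (by push_cast; linarith)
  have p2 := hE.eventually_const_lt (u := 0) (by linarith)
  obtain ⟨u, hu, hsub⟩ := mem_nhdsGT_iff_exists_Ioo_subset.1
    (inter_mem (p1.and p2) (Ioo_mem_nhdsGT h.radius_pos))
  have hur : u ≤ r := by
    by_contra hlt
    push Not at hlt
    have hr := h.radius_pos
    exact absurd (hsub ⟨hr, hlt⟩).2.2 (lt_irrefl _)
  refine ⟨u, hu, hur, ?_, fun y hy => ?_⟩
  · refine strictMonoOn_of_deriv_pos (convex_Ioo 0 u) ?_ fun y hy => ?_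
    · exact h.smooth_energy.continuousOn.mono
        (Ioo_subset_Ioo (by linarith [h.radius_pos]) hur)
    · rw [interior_Ioo] at hy
      have := (hsub hy).1.1
      rw [pow_one] at this
      exact (div_pos_iff_of_pos_right hy.1).1 this
  · exact (div_pos_iff_of_pos_right (pow_pos hy.1 2)).1 (hsub hy).1.2

/-- The leading term of the period, and its relation to the frequency-energy expansion. -/
theorem IsLocalMode.period_expansion (h : IsLocalMode V W Q₀ Qπ T ρ r R) {n : ℕ} {γ : ℝ}
    (hiso : IsochronousUpTo V W Q₀ Qπ T n γ) :
    Tendsto (fun y => (T y - 1) / y ^ (2 * n)) (𝓝[>] 0) (𝓝 (periodCoeff T n)) ∧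
    γ = -2 * omegaSq V W * (2 / omegaSq V W) ^ n * periodCoeff T n := by
  have hw := omegaSq_pos h.pos_V h.pos_W
  obtain ⟨s0, sπ, sT⟩ := h.smooth
  set ε := energyDensity V W Q₀ Qπ T with hε
  have hEn : Tendsto (fun y => ε y ^ n / y ^ (2 * n)) (𝓝[>] 0) (𝓝 ((omegaSq V W / 2) ^ n)) :=
    (h.tendsto_energy.pow n).congr fun y => by rw [div_pow, pow_mul]
  have hpos : ∀ᶠ y : ℝ in 𝓝[>] 0, 0 < y := self_mem_nhdsWithin
  have hO : (fun y => ε y ^ n) =O[𝓝[>] 0] fun y : ℝ => y ^ (2 * n) := by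
    refine isBigO_of_div_tendsto_nhds (hpos.mono fun y hy h0 => ?_) _ hEn
    exact absurd h0 (pow_pos hy _).ne'
  have h1 := isLittleO_pow_iff_tendsto_div (c := 0) (m := 2 * n)
    (u := fun y => freqSq V W T y - omegaSq V W - γ * ε y ^ n) |>.1
    (by simpa using hiso.expansion.trans_isBigO hO)
  have h2 : Tendsto (fun y => (freqSq V W T y - omegaSq V W) / y ^ (2 * n)) (𝓝[>] 0)
      (𝓝 (γ * (omegaSq V W / 2) ^ n)) := by
    have := h1.add (hEn.const_mul γ)
    rw [zero_add] at this
    exact this.congr fun y => by ring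
  have hTc : Tendsto T (𝓝[>] 0) (𝓝 1) := by
    have := (sT.continuousOn.continuousAt (isOpen_Ioo.mem_nhds h.zero_mem)).tendsto
    rw [h.mode.order_zero_T] at this
    exact this.mono_left nhdsWithin_le_nhds
  -- Solving `ω²/T² - ω² = -ω² (T - 1)(T + 1)/T²` for `T - 1`.
  have h3 : Tendsto (fun y => (T y - 1) / y ^ (2 * n)) (𝓝[>] 0)
      (𝓝 (γ * (omegaSq V W / 2) ^ n * (-(1 ^ 2 / (omegaSq V W * (1 + 1)))))) := by
    have := h2.mul ((hTc.pow 2).div ((hTc.add_const 1).const_mul (omegaSq V W))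
      (by positivity)).neg
    refine this.congr' ?_
    filter_upwards [hpos, hTc.eventually_const_lt one_half_lt_one] with y hy hTy
    have hT0 : T y ≠ 0 := by linarith
    have hT1 : T y + 1 ≠ 0 := by linarith
    simp only [freqSq, Pi.div_apply]
    field_simp
    ring
  have h4 : periodCoeff T n =
      γ * (omegaSq V W / 2) ^ n * (-(1 ^ 2 / (omegaSq V W * (1 + 1)))) := by
    have := (iteratedDeriv_eq_zero_of_isLittleO h.radius_pos (sT.sub contDiffOn_const)
      (isLittleO_pow_iff_tendsto_div.2 h3)).2
    rw [← this, periodCoeff]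
    -- As `2n ≥ 1`, subtracting the constant `1` does not change the coefficient.
    obtain ⟨m, hm⟩ : ∃ m, 2 * n = m + 1 := ⟨2 * n - 1, by have := hiso.order_pos; omega⟩
    rw [hm, iteratedDeriv_succ', iteratedDeriv_succ']
    congr 2
    ext y
    exact (deriv_sub_const 1).symm
  rw [← h4] at h3
  refine ⟨h3, ?_⟩
  rw [h4, div_pow, div_pow]
  have := pow_ne_zero n hw.ne'
  field_simp
  ring

/-- Derivatives in `τ` and `y` commute, so the limit is the second `τ`-derivative of the first-order
term, `0` or `cos τ`. -/
theorem IsLocalMode.tendsto_acceleration (h : IsLocalMode V W Q₀ Qπ T ρ r R) (τ : ℝ) :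
    Tendsto (fun y => deriv (deriv (Q₀ y)) τ / y) (𝓝[>] 0) (𝓝 0) ∧
    Tendsto (fun y => deriv (deriv (Qπ y)) τ / y) (𝓝[>] 0) (𝓝 (-Real.cos τ)) := by
  obtain ⟨s0, sπ, -⟩ := h.smooth
  have key : ∀ {Q : ℝ → ℝ → ℝ}, ContDiffOn ℝ ∞ (fun p : ℝ × ℝ => Q p.1 p.2) (Ioo (-r) r ×ˢ univ) →
      (∀ τ, Q 0 τ = 0) → Tendsto (fun y => deriv (deriv (Q y)) τ / y) (𝓝[>] 0)
        (𝓝 (deriv (deriv fun s => deriv (fun z => Q z s) 0) τ)) := by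
    intro Q hQ hQ0
    have e1 : (deriv fun s => deriv (fun z => Q z s) 0) = fun s => deriv (fun z => deriv (Q z) s) 0 :=
      funext fun s => deriv_partial_comm hQ h.zero_mem s
    rw [e1, deriv_partial_comm (f := fun y => deriv (Q y)) (contDiffOn_partial_snd hQ) h.zero_mem]
    refine tendsto_div_of_hasDerivAt (hasDerivAt_partial_fst (f := fun y => deriv (deriv (Q y)))
      (contDiffOn_partial_snd (f := fun y => deriv (Q y)) (contDiffOn_partial_snd hQ))
      h.zero_mem τ) ?_
    have : Q 0 = fun _ => 0 := funext hQ0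
    simp [this]
  have k1 := key s0 h.mode.order_zero_Q₀
  have k2 := key sπ h.mode.order_zero_Qπ
  have e1 : (fun s => deriv (fun z => Q₀ z s) 0) = fun _ => 0 := funext h.mode.order_one_Q₀
  have e2 : (fun s => deriv (fun z => Qπ z s) 0) = Real.cos := funext h.mode.order_one_Qπ
  rw [e1] at k1
  rw [e2] at k2
  simp only [Real.deriv_cos', deriv.fun_neg, Real.deriv_sin, deriv_const'] at k1 k2
  exact ⟨k1, k2⟩

end Asymptotics

/-! ### The determinants of the off-diagonal blocks at `δ = 0`. -/

section LocalSystem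

variable {V W : ℝ → ℝ} {Q₀ Qπ : ℝ → ℝ → ℝ} {T : ℝ → ℝ} {ρ r R s : ℝ}

/-- The range `|θ|, |y| < s` on which the monodromy is smooth. -/
structure IsMonodromyRange (V W : ℝ → ℝ) (Q₀ Qπ : ℝ → ℝ → ℝ) (T : ℝ → ℝ) (ρ r R s : ℝ) :
    Prop where
  isLocalMode : IsLocalMode V W Q₀ Qπ T ρ r R
  pos : 0 < s
  le_radius : s ≤ r
  le_one : s ≤ 1
  isFundamental : ∀ θ ∈ Ioo (-s) s, ∀ y ∈ Ioo (-s) s,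
    IsFundamental (thetaMatrix V W Q₀ Qπ T θ y) (fundMatrix V W Q₀ Qπ T θ y)
  smooth : ContDiffOn ℝ ∞ (fun p : ℝ × ℝ => monodromy V W Q₀ Qπ T p.1 p.2)
    (Ioo (-s) s ×ˢ Ioo (-s) s)

namespace IsMonodromyRange

theorem zero_mem (h : IsMonodromyRange V W Q₀ Qπ T ρ r R s) : (0 : ℝ) ∈ Ioo (-s) s :=
  ⟨by linarith [h.pos], h.pos⟩

theorem subset (h : IsMonodromyRange V W Q₀ Qπ T ρ r R s) : Ioo (-s) s ⊆ Ioo (-r) r :=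
  Ioo_subset_Ioo (by linarith [h.le_radius]) h.le_radius

theorem smooth_det (h : IsMonodromyRange V W Q₀ Qπ T ρ r R s) :
    ContDiffOn ℝ ∞ (fun p : ℝ × ℝ => detC V W Q₀ Qπ T p.1 p.2) (Ioo (-s) s ×ˢ Ioo (-s) s) ∧
    ContDiffOn ℝ ∞ (fun p : ℝ × ℝ => detB V W Q₀ Qπ T p.1 p.2) (Ioo (-s) s ×ˢ Ioo (-s) s) :=
  ⟨contDiff_det_blocks.1.comp_contDiffOn h.smooth, contDiff_det_blocks.2.1.comp_contDiffOn h.smooth⟩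

theorem even_det (h : IsMonodromyRange V W Q₀ Qπ T ρ r R s) {θ y : ℝ} (hθ : θ ∈ Ioo (-s) s)
    (hy : y ∈ Ioo (-s) s) :
    detC V W Q₀ Qπ T (-θ) y = detC V W Q₀ Qπ T θ y ∧
    detB V W Q₀ Qπ T (-θ) y = detB V W Q₀ Qπ T θ y :=
  monodromy_neg_theta (h.isFundamental θ hθ y hy)
    (h.isFundamental (-θ) ⟨by linarith [hθ.2], by linarith [hθ.1]⟩ y hy)

theorem exists_blocks (h : IsMonodromyRange V W Q₀ Qπ T ρ r R s) {θ y : ℝ} (hθ : θ ∈ Ioo (-s) s)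
    (hy : y ∈ Ioo (-s) s) :
    ∃ P B C : Mat2, monodromy V W Q₀ Qπ T θ y = Matrix.fromBlocks P B C Pᴴ ∧ Bᴴ = B ∧ Cᴴ = C ∧
      P * P - B * C = 1 ∧ P * B = B * Pᴴ ∧ C * P = Pᴴ * C ∧
      C.det = detC V W Q₀ Qπ T θ y ∧ B.det = detB V W Q₀ Qπ T θ y ∧
      P.det.re = (monodromy V W Q₀ Qπ T θ y).toBlocks₁₁.det.re ∧
      P.trace.re = (monodromy V W Q₀ Qπ T θ y).toBlocks₁₁.trace.re := by
  obtain ⟨P, B, C, hM, hB, hC, h1, h2, h3⟩ := (h.isFundamental θ hθ y hy).exists_blocks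
    (h.isLocalMode.thetaMatrix_neg θ (h.subset hy))
    (h.isLocalMode.thetaMatrix_shift θ (h.subset hy))
  have hM' : monodromy V W Q₀ Qπ T θ y = Matrix.fromBlocks P B C Pᴴ := hM
  refine ⟨P, B, C, hM', hB, hC, h1, h2, h3, ?_, ?_, ?_, ?_⟩
  · rw [detC, hM', Matrix.toBlocks_fromBlocks₂₁]
    exact Complex.ext rfl (by simpa using im_det_eq_zero hC)
  · rw [detB, hM', Matrix.toBlocks_fromBlocks₁₂]
    exact Complex.ext rfl (by simpa using im_det_eq_zero hB)
  · rw [hM', Matrix.toBlocks_fromBlocks₁₁]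
  · rw [hM', Matrix.toBlocks_fromBlocks₁₁]

theorem eventually_mem (h : IsMonodromyRange V W Q₀ Qπ T ρ r R s) :
    ∀ᶠ y in 𝓝[>] 0, y ∈ Ioo (-s) s :=
  Filter.eventually_of_mem (Ioo_mem_nhdsGT h.pos) fun y hy => ⟨by linarith [hy.1, h.pos], hy.2⟩

/-- The velocity of the mode is an odd periodic solution at `δ = 0`; it is nontrivial because the
acceleration at `τ = 0` is close to `-y`. -/
theorem eventually_detB_eq_zero (h : IsMonodromyRange V W Q₀ Qπ T ρ r R s) :
    ∀ᶠ y in 𝓝[>] 0, detB V W Q₀ Qπ T 0 y = 0 := by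
  have h1 := (h.isLocalMode.tendsto_acceleration 0).2
  rw [Real.cos_zero] at h1
  filter_upwards [h.eventually_mem, h1.eventually_lt_const (u := 0) (by norm_num)] with y hy hne
  obtain ⟨P, B, C, hM, -, -, -, -, -, -, hd, -⟩ := h.exists_blocks h.zero_mem hy
  have := h.isLocalMode.det_eq_zero_of_velocity (h.subset hy) (h.isFundamental 0 h.zero_mem y hy) hM
    (fun h0 => by rw [h0, zero_div] at hne; exact lt_irrefl _ hne)
  rw [hd] at this
  exact_mod_cast this

theorem upperLeft_zero_zero (h : IsMonodromyRange V W Q₀ Qπ T ρ r R s) :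
    (monodromy V W Q₀ Qπ T 0 0).toBlocks₁₁.det.re = Real.cos (inPhaseFreq V W * Real.pi) ∧
    (monodromy V W Q₀ Qπ T 0 0).toBlocks₁₁.trace.re =
      1 + Real.cos (inPhaseFreq V W * Real.pi) := by
  have hΩ := inPhaseFreq_pos h.isLocalMode.pos_V h.isLocalMode.pos_W
  have := h.isLocalMode.blocks_zero (h.isFundamental 0 h.zero_mem 0 h.zero_mem)
    (a := 1) (b := inPhaseFreq V W) (by simp) (by simp) (by simp [Real.sqrt_sq hΩ.le])
  simp only [one_mul, Real.sin_pi, Real.cos_pi, zero_div, zero_mul, neg_zero, neg_neg] at this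
  refine ⟨?_, this.2.2.2⟩
  rw [this.2.2.1]; ring

theorem lowerLeft_zero_zero (h : IsMonodromyRange V W Q₀ Qπ T ρ r R s) :
    (monodromy V W Q₀ Qπ T 0 0).toBlocks₂₁ =
      hermMatrix 0 0 0 (-(inPhaseFreq V W * Real.sin (inPhaseFreq V W * Real.pi))) := by
  have hΩ := inPhaseFreq_pos h.isLocalMode.pos_V h.isLocalMode.pos_W
  have := (h.isFundamental 0 h.zero_mem 0 h.zero_mem).eq_oscillators one_ne_zero hΩ.ne'
    (fun t => by rw [h.isLocalMode.thetaMatrix_zero]; simp [Real.sq_sqrt (sq_nonneg _)]) Real.pi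
  rw [monodromy, this, flip4, oscillators, Matrix.fromBlocks_multiply,
    Matrix.toBlocks_fromBlocks₂₁, flip2_eq_hermMatrix]
  simp [hermMatrix_diag_mul]

/-- The leading term of the determinant at `δ = 0`. -/
theorem tendsto_detC (h : IsMonodromyRange V W Q₀ Qπ T ρ r R s) {n : ℕ} {a : ℝ} (hn : 1 ≤ n)
    (ha : Tendsto (fun y => (T y - 1) / y ^ (2 * n)) (𝓝[>] 0) (𝓝 a)) :
    Tendsto (fun y => detC V W Q₀ Qπ T 0 y / y ^ (2 * n)) (𝓝[>] 0)
      (𝓝 (-(inPhaseFreq V W * Real.sin (inPhaseFreq V W * Real.pi)) * (2 * n * a * Real.pi))) := by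
  obtain ⟨s0, sπ, sT⟩ := h.isLocalMode.smooth
  set b := inPhaseFreq V W * Real.sin (inPhaseFreq V W * Real.pi) with hb
  have hT1 : Tendsto T (𝓝[>] 0) (𝓝 1) := by
    have := (sT.continuousOn.continuousAt (isOpen_Ioo.mem_nhds h.isLocalMode.zero_mem)).tendsto
    rw [h.isLocalMode.mode.order_zero_T] at this
    exact this.mono_left nhdsWithin_le_nhds
  -- The power `y^{2n}` splits into `y^{2n-1}` for `T'` and one factor `y` for the acceleration.
  obtain ⟨m, hm⟩ : ∃ m, 2 * n = m + 1 := ⟨2 * n - 1, by omega⟩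
  have hdT : Tendsto (fun y => deriv T y / y ^ m) (𝓝[>] 0) (𝓝 (2 * n * a)) := by
    rw [hm] at ha
    have := isLittleO_deriv_of_isLittleO h.isLocalMode.radius_pos (sT.sub contDiffOn_const)
      (isLittleO_pow_iff_tendsto_div.2 ha)
    have h2 := isLittleO_pow_iff_tendsto_div.1 this
    have e : (m + 1 : ℝ) = 2 * n := by exact_mod_cast hm.symm
    rw [e] at h2
    refine h2.congr fun y => ?_
    congr 1
    exact deriv_sub_const 1
  obtain ⟨a0, aπ⟩ := h.isLocalMode.tendsto_acceleration Real.pi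
  have hw : ∀ {q : ℝ → ℝ} {c : ℝ}, Tendsto (fun y => q y / y) (𝓝[>] 0) (𝓝 c) →
      Tendsto (fun y => deriv T y / T y * Real.pi * q y / y ^ (2 * n)) (𝓝[>] 0)
        (𝓝 (2 * n * a / 1 * Real.pi * c)) := by
    intro q c hq
    refine (((hdT.div hT1 one_ne_zero).mul_const Real.pi).mul hq).congr fun y => ?_
    simp only [Pi.div_apply]
    rw [hm, pow_succ]
    simp only [div_eq_mul_inv, mul_inv]
    ring
  have w1 := hw aπ
  have w2 := hw a0
  have hu : Tendsto (fun y => deriv (fun z => Qπ z 0) y) (𝓝[>] 0) (𝓝 1) := by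
    have hc : ContinuousOn (fun y => deriv (fun z => Qπ z 0) y) (Ioo (-r) r) :=
      (contDiffOn_partial_fst sπ).continuousOn.comp (f := fun y : ℝ => (y, (0 : ℝ)))
        (by fun_prop) fun y hy => ⟨hy, mem_univ _⟩
    have := (hc.continuousAt (isOpen_Ioo.mem_nhds h.isLocalMode.zero_mem)).tendsto
    rw [h.isLocalMode.mode.order_one_Qπ, Real.cos_zero] at this
    exact this.mono_left nhdsWithin_le_nhds
  have hC : ∀ i j, Tendsto (fun y => (monodromy V W Q₀ Qπ T 0 y).toBlocks₂₁ i j) (𝓝[>] 0)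
      (𝓝 (hermMatrix 0 0 0 (-b) i j)) := by
    intro i j
    have hc : ContinuousOn (fun y => monodromy V W Q₀ Qπ T 0 y) (Ioo (-s) s) :=
      h.smooth.continuousOn.comp (f := fun y : ℝ => ((0 : ℝ), y)) (by fun_prop)
        fun y hy => ⟨h.zero_mem, hy⟩
    have h1 := (hc.continuousAt (isOpen_Ioo.mem_nhds h.zero_mem)).tendsto
    have h2 := ((contDiff_apply_apply_mat4 (Sum.inr i) (Sum.inl j)).continuous.tendsto _).comp h1
    rw [hb, ← h.lowerLeft_zero_zero]
    exact h2.mono_left nhdsWithin_le_nhds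
  have c01 := hC 0 1
  have c11 := hC 1 1
  simp only [hermMatrix, Matrix.of_apply, Matrix.cons_val', Matrix.cons_val_zero,
    Matrix.cons_val_one, Matrix.cons_val_fin_one, Complex.ofReal_zero, mul_zero, add_zero] at c01 c11
  have hofReal : ∀ {f : ℝ → ℝ} {c : ℝ}, Tendsto f (𝓝[>] 0) (𝓝 c) →
      Tendsto (fun y => (f y : ℂ)) (𝓝[>] 0) (𝓝 (c : ℂ)) := fun hf =>
    (Complex.continuous_ofReal.tendsto _).comp hf
  have hlim := ((c11.mul (hofReal w1)).add (c01.mul (hofReal w2))).div (hofReal hu)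
    (by simp)
  have hre := (Complex.continuous_re.tendsto _).comp hlim
  have e : ((((-b : ℝ) : ℂ) * ((2 * n * a / 1 * Real.pi * -Real.cos Real.pi : ℝ) : ℂ)
      + 0 * ((2 * n * a / 1 * Real.pi * 0 : ℝ) : ℂ)) / ((1 : ℝ) : ℂ)).re =
      -b * (2 * n * a * Real.pi) := by
    rw [zero_mul, add_zero, ← Complex.ofReal_mul, ← Complex.ofReal_div, Complex.ofReal_re,
      Real.cos_pi]
    ring
  rw [e] at hre
  refine hre.congr' ?_
  filter_upwards [h.eventually_mem, hT1.eventually_const_lt zero_lt_one,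
    hu.eventually_const_lt zero_lt_one, self_mem_nhdsWithin] with y hy hTy huy hy0
  obtain ⟨P, B, C, hM, -, -, -, -, -, hd, -⟩ := h.exists_blocks h.zero_mem hy
  have hs := h.isLocalMode.amplitude_solution (h.subset hy) hTy.ne'
    (h.isFundamental 0 h.zero_mem y hy) hM
  have r0 := congrFun hs 0
  have r1 := congrFun hs 1
  simp only [Matrix.mulVec, dotProduct, Fin.sum_univ_two, Matrix.cons_val_zero,
    Matrix.cons_val_one, Matrix.cons_val_fin_one] at r0 r1
  rw [Matrix.det_fin_two] at hd
  simp only [Function.comp, Pi.div_apply, hM, Matrix.toBlocks_fromBlocks₂₁]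
  have hy0' : ((y : ℂ)) ^ (2 * n) ≠ 0 := pow_ne_zero _ (by exact_mod_cast ne_of_gt hy0)
  have hu0 : ((deriv (fun z => Qπ z 0) y : ℝ) : ℂ) ≠ 0 := by exact_mod_cast huy.ne'
  set w₁ := deriv T y / T y * Real.pi * deriv (deriv (Qπ y)) Real.pi with hw₁
  set w₂ := deriv T y / T y * Real.pi * deriv (deriv (Q₀ y)) Real.pi with hw₂
  -- Cramer's rule for the amplitude solution: eliminating its second component leaves `det C` times
  -- the first, which tends to `1`. In the limit `C 1 1 → -b` and `C 0 1 → 0`.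
  have key : (C 1 1 * ((w₁ / y ^ (2 * n) : ℝ) : ℂ) + C 0 1 * ((w₂ / y ^ (2 * n) : ℝ) : ℂ)) /
      ((deriv (fun z => Qπ z 0) y : ℝ) : ℂ) = ((detC V W Q₀ Qπ T 0 y / y ^ (2 * n) : ℝ) : ℂ) := by
    push_cast at r0 r1 ⊢
    rw [← hd]
    field_simp
    linear_combination -(C 1 1) * r0 + (C 0 1) * r1
  rw [key, Complex.ofReal_re]

end IsMonodromyRange

end LocalSystem

/-! ### The sign of `det C` decides stability. -/

section Stability

variable {V W : ℝ → ℝ} {Q₀ Qπ : ℝ → ℝ → ℝ} {T : ℝ → ℝ} {ρ r R s : ℝ}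

theorem IsLocalMode.continuous_thetaMatrix (h : IsLocalMode V W Q₀ Qπ T ρ r R) (θ : ℝ) {y : ℝ}
    (hy : y ∈ Ioo (-r) r) : Continuous (thetaMatrix V W Q₀ Qπ T θ y) := by
  obtain ⟨c1, c2, c3, c4⟩ := h.smooth_coeffs
  have d1 := (contDiff_of_contDiffOn_prod
    (Q := fun y τ => onsiteCoeff V W Q₀ Qπ T y τ) c1 hy).continuous
  have d2 := (contDiff_of_contDiffOn_prod
    (Q := fun y τ => interCoeff V W Qπ T y τ) c2 hy).continuous
  have d3 := (contDiff_of_contDiffOn_prod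
    (Q := fun y τ => oddCoeff V W Qπ T y τ) c3 hy).continuous
  have d4 := (contDiff_of_contDiffOn_prod
    (Q := fun y τ => coeff₂ V W Q₀ Qπ T y τ) c4 hy).continuous
  refine continuous_matrix fun i j => ?_
  fin_cases i <;> fin_cases j <;> simp [thetaMatrix, hermMatrix] <;> fun_prop

theorem inPhase_cos_sin (hV : IsPotential V) (hW : IsPotential W) :
    -1 < Real.cos (inPhaseFreq V W * Real.pi) ∧ Real.cos (inPhaseFreq V W * Real.pi) < 1 ∧
      0 < Real.sin (inPhaseFreq V W * Real.pi) := by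
  have h0 := inPhaseFreq_pos hV hW
  have h1 := inPhaseFreq_lt_one hV hW
  have hpi := Real.pi_pos
  have hs : 0 < Real.sin (inPhaseFreq V W * Real.pi) :=
    Real.sin_pos_of_pos_of_lt_pi (by positivity) (by nlinarith)
  have := Real.sin_sq_add_cos_sq (inPhaseFreq V W * Real.pi)
  have := pow_pos hs 2
  refine ⟨?_, ?_, hs⟩ <;> nlinarith

namespace IsMonodromyRange

/-- The `θ²`-coefficients of the two determinants at `y = 0`. -/
theorem tendsto_det (h : IsMonodromyRange V W Q₀ Qπ T ρ r R s) :
    Tendsto (fun θ => (detC V W Q₀ Qπ T θ 0 - detC V W Q₀ Qπ T 0 0) / θ ^ 2) (𝓝[>] 0)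
      (𝓝 (-(inPhaseFreq V W * Real.sin (inPhaseFreq V W * Real.pi)
        * (Real.pi * beta₁ V W / 2)))) ∧
    Tendsto (fun θ => (detB V W Q₀ Qπ T θ 0 - detB V W Q₀ Qπ T 0 0) / θ ^ 2) (𝓝[>] 0)
      (𝓝 (-(Real.sin (inPhaseFreq V W * Real.pi) / inPhaseFreq V W
        * (Real.pi * beta₁ V W / 2)))) :=
  h.isLocalMode.tendsto_det_zero h.pos h.le_one fun θ hθ => h.isFundamental θ hθ 0 h.zero_mem

/-- `det B` vanishes on `θ = 0` and has a negative `θ²`-coefficient, uniformly for small `y`. -/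
theorem exists_detB_neg (h : IsMonodromyRange V W Q₀ Qπ T ρ r R s) :
    ∃ r₁ > 0, r₁ ≤ s ∧ ∀ y ∈ Ioo 0 r₁, ∀ θ ∈ Ioo 0 r₁, detB V W Q₀ Qπ T θ y < 0 := by
  have hΩ := inPhaseFreq_pos h.isLocalMode.pos_V h.isLocalMode.pos_W
  have hβ := beta₁_pos h.isLocalMode.pos_V h.isLocalMode.pos_W
  have hsin := (inPhase_cos_sin h.isLocalMode.pos_V h.isLocalMode.pos_W).2.2
  have hpi := Real.pi_pos
  have hκ : 0 < Real.sin (inPhaseFreq V W * Real.pi) / inPhaseFreq V W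
    * (Real.pi * beta₁ V W / 2) := by positivity
  set κ := Real.sin (inPhaseFreq V W * Real.pi) / inPhaseFreq V W
    * (Real.pi * beta₁ V W / 2) with hκd
  obtain ⟨r', hr', hr's, hA⟩ := (even_family_expansion h.pos h.smooth_det.2
    (fun θ hθ y hy => (h.even_det hθ hy).2) h.tendsto_det.2).1 (κ / 2) (by linarith)
  obtain ⟨u, hu, hsub⟩ := mem_nhdsGT_iff_exists_Ioo_subset.1 h.eventually_detB_eq_zero
  refine ⟨min r' u, lt_min hr' hu, (min_le_left _ _).trans hr's, fun y hy θ hθ => ?_⟩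
  have hy0 : detB V W Q₀ Qπ T 0 y = 0 := hsub ⟨hy.1, hy.2.trans_le (min_le_right _ _)⟩
  have := hA y ⟨by linarith [hy.1], hy.2.trans_le (min_le_left _ _)⟩ 0 θ le_rfl hθ.1.le
    (hθ.2.trans_le (min_le_left _ _))
  rw [hy0] at this
  have h2 := (abs_le.1 this).2
  have := mul_pos hκ (pow_pos hθ.1 2)
  nlinarith

/-- The sign of `detC` decides the existence of periodic even solutions and the stability. -/
theorem exists_stability_region (h : IsMonodromyRange V W Q₀ Qπ T ρ r R s) :
    ∃ r₁ > 0, r₁ ≤ s ∧ ∀ y ∈ Ioo 0 r₁, ∀ θ ∈ Ico 0 r₁,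
      (HasSymmetricPeriodicSolution V W Q₀ Qπ T (4 * Real.sin θ ^ 2) y ↔
        detC V W Q₀ Qπ T θ y = 0) ∧
      (0 < θ → detC V W Q₀ Qπ T θ y < 0 → IsStable V W Q₀ Qπ T (4 * Real.sin θ ^ 2) y) ∧
      (0 < θ → 0 < detC V W Q₀ Qπ T θ y → ¬ IsStable V W Q₀ Qπ T (4 * Real.sin θ ^ 2) y) := by
  obtain ⟨r₁, hr₁, hr₁s, hB⟩ := h.exists_detB_neg
  obtain ⟨c1, c2, -⟩ := inPhase_cos_sin h.isLocalMode.pos_V h.isLocalMode.pos_W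
  obtain ⟨z1, z2⟩ := h.upperLeft_zero_zero
  have hopen : IsOpen (Ioo (-s) s ×ˢ Ioo (-s) s) := isOpen_Ioo.prod isOpen_Ioo
  have hM : ContinuousAt (fun p : ℝ × ℝ => monodromy V W Q₀ Qπ T p.1 p.2) (0, 0) :=
    h.smooth.continuousOn.continuousAt (hopen.mem_nhds ⟨h.zero_mem, h.zero_mem⟩)
  obtain ⟨dt, hdt⟩ : ∃ f : ℝ × ℝ → ℝ,
    ∀ p, f p = (monodromy V W Q₀ Qπ T p.1 p.2).toBlocks₁₁.det.re := ⟨_, fun _ => rfl⟩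
  obtain ⟨tr, htr'⟩ : ∃ f : ℝ × ℝ → ℝ,
    ∀ p, f p = (monodromy V W Q₀ Qπ T p.1 p.2).toBlocks₁₁.trace.re := ⟨_, fun _ => rfl⟩
  have hd : ContinuousAt dt (0, 0) := (ContinuousAt.comp (g := fun M : Mat4 => M.toBlocks₁₁.det.re)
    contDiff_det_blocks.2.2.1.continuous.continuousAt hM).congr
      (Filter.Eventually.of_forall fun p => (hdt p).symm)
  have ht : ContinuousAt tr (0, 0) := (ContinuousAt.comp
    (g := fun M : Mat4 => M.toBlocks₁₁.trace.re)
    contDiff_det_blocks.2.2.2.continuous.continuousAt hM).congr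
      (Filter.Eventually.of_forall fun p => (htr' p).symm)
  rw [← hdt (0, 0)] at z1
  rw [← htr' (0, 0)] at z2
  -- At the origin `P` has the eigenvalues `1` and `cos(Ωπ) ∈ (-1, 1)`. Simplicity, `|tr P| < 2` and
  -- positivity of the characteristic polynomial at `-1` are open conditions; only its sign at `1`
  -- remains undecided.
  have e1 : ∀ᶠ p in 𝓝 (0, 0), 4 * dt p < tr p ^ 2 := (hd.const_mul 4).eventually_lt (ht.pow 2) (by
    rw [z1, z2]; nlinarith [mul_pos (sub_pos.2 c2) (sub_pos.2 c2)])
  have e2 : ∀ᶠ p in 𝓝 (0, 0), |tr p| < 2 := ht.abs.eventually_lt_const (by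
    change |tr (0, 0)| < 2
    rw [z2, abs_lt]; constructor <;> linarith)
  have e3 : ∀ᶠ p in 𝓝 (0, 0), 0 < 1 + tr p + dt p :=
    ((ht.const_add 1).add hd).eventually_const_lt (by
      change 0 < 1 + tr (0, 0) + dt (0, 0)
      rw [z1, z2]; linarith)
  obtain ⟨d, hd0, hball⟩ := Metric.eventually_nhds_iff_ball.1 (e1.and (e2.and e3))
  refine ⟨min r₁ d, lt_min hr₁ hd0, (min_le_left _ _).trans hr₁s, fun y hy θ hθ => ?_⟩
  have hs1 := h.le_one
  have hy1 : y < r₁ := hy.2.trans_le (min_le_left _ _)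
  have hθ1 : θ < r₁ := hθ.2.trans_le (min_le_left _ _)
  have hys : y ∈ Ioo (-s) s := ⟨by linarith [hy.1], by linarith⟩
  have hθs : θ ∈ Ioo (-s) s := ⟨by linarith [hθ.1], by linarith⟩
  have hyr := h.subset hys
  have hθπ : θ ∈ Icc 0 (Real.pi / 2) := ⟨hθ.1, by linarith [Real.pi_gt_three]⟩
  have hcoeff : coeffMatrix V W Q₀ Qπ T (4 * Real.sin θ ^ 2) y = thetaMatrix V W Q₀ Qπ T θ y :=
    funext fun τ => coeffMatrix_eq_thetaMatrix hθπ y τ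
  have hZ := h.isFundamental θ hθs y hys
  have heven := h.isLocalMode.thetaMatrix_neg θ hyr
  have hshift := h.isLocalMode.thetaMatrix_shift θ hyr
  have hc := h.isLocalMode.continuous_thetaMatrix θ hyr
  rw [← hcoeff] at hZ hc
  rw [← hcoeff] at heven hshift
  obtain ⟨P, B, C, hMeq, hBh, hCh, hP, hPB, hCP, dC, dB, dP, tP⟩ := h.exists_blocks hθs hys
  obtain ⟨b1, b2, b3⟩ := hball (θ, y) (by
    rw [Metric.mem_ball, Prod.dist_eq, max_lt_iff]
    simp only [Real.dist_eq, sub_zero]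
    exact ⟨(abs_of_nonneg hθ.1).trans_lt (hθ.2.trans_le (min_le_right _ _)),
      (abs_of_pos hy.1).trans_lt (hy.2.trans_le (min_le_right _ _))⟩)
  have dP' : dt (θ, y) = P.det.re := (hdt _).trans dP.symm
  have tP' : tr (θ, y) = P.trace.re := (htr' _).trans tP.symm
  rw [dP', tP'] at b1 b3
  rw [tP'] at b2
  refine ⟨?_, fun hθ0 hneg => ?_, fun hθ0 hpos => ?_⟩
  · rw [hasSymmetricPeriodicSolution_iff hZ hc heven hshift hMeq hP hCP, dC]
    exact_mod_cast Iff.rfl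
  all_goals
    have hBneg := hB y ⟨hy.1, hy1⟩ θ ⟨hθ0, hθ1⟩
    have hB0 : B.det ≠ 0 := by rw [dB]; exact_mod_cast hBneg.ne
    obtain ⟨i1, i2⟩ := im_trace_det_eq_zero hB0 hPB
    have htr : P.trace = ((P.trace.re : ℝ) : ℂ) := Complex.ext rfl (by simpa using i1)
    have hdr : P.det = ((P.det.re : ℝ) : ℂ) := Complex.ext rfl (by simpa using i2)
    -- With `det B < 0` and a positive second factor, `1 - tr P + det P` has the sign opposite to
    -- that of `det C`.
    have hprod := det_sub_one_mul_det_add_one hP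
    rw [dB, dC, htr, hdr] at hprod
    have hprod' : (1 - P.trace.re + P.det.re) * (1 + P.trace.re + P.det.re) =
        detB V W Q₀ Qπ T θ y * detC V W Q₀ Qπ T θ y := by exact_mod_cast hprod
  · obtain ⟨K, hK⟩ := exists_bound_pow hP hPB hCP hBh hCh htr hdr b1 b2 b3
      ((pos_iff_pos_of_mul_pos (by rw [hprod']; exact mul_pos_of_neg_of_neg hBneg hneg)).2 b3)
    refine isStable_of_bound hZ hshift (K := K) fun k => ?_
    have := hK k
    rwa [← hMeq] at this
  · obtain ⟨v, hv, μ, hμ, hgrow⟩ := exists_unbounded_pow hP hPB hCP hBh hCh htr hdr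
      (neg_of_mul_neg_left (by rw [hprod']; exact mul_neg_of_neg_of_pos hBneg hpos) b3.le)
    refine not_isStable_of_unbounded hZ hc hshift hv hμ fun k => ?_
    have := hgrow k
    rwa [← hMeq] at this

end IsMonodromyRange

end Stability

/-! ### The transition curve in the variable `θ`. -/

section Transition

variable {V W : ℝ → ℝ} {Q₀ Qπ : ℝ → ℝ → ℝ} {T : ℝ → ℝ} {ρ r R s : ℝ} {n : ℕ} {a : ℝ}

/-- For a hard mode (`a < 0`), the second transition curve in the variable `θ`, where
`δ = 4 sin² θ`. -/
theorem IsMonodromyRange.exists_curve (h : IsMonodromyRange V W Q₀ Qπ T ρ r R s) (hn : 1 ≤ n)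
    (ha : Tendsto (fun y => (T y - 1) / y ^ (2 * n)) (𝓝[>] 0) (𝓝 a)) (ha0 : a < 0) {c : ℝ}
    (hc0 : 0 < c) :
    ∃ y₁ θ₁ θ₂ : ℝ, ∃ θs : ℝ → ℝ, 0 < y₁ ∧ y₁ ≤ c ∧ y₁ ≤ r ∧ 0 < θ₁ ∧ θ₁ ≤ 1 ∧ 0 < θ₂ ∧
      (∀ y ∈ Ioo 0 y₁, θs y ∈ Ioc 0 1) ∧
      (∀ y ∈ Ioo 0 y₁, ∀ θ ∈ Ico 0 θ₁,
        (HasSymmetricPeriodicSolution V W Q₀ Qπ T (4 * Real.sin θ ^ 2) y ↔ θ = θs y) ∧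
        (0 < θ → θ < θs y → ¬ IsStable V W Q₀ Qπ T (4 * Real.sin θ ^ 2) y) ∧
        (0 < θ → θs y < θ → IsStable V W Q₀ Qπ T (4 * Real.sin θ ^ 2) y)) ∧
      Tendsto (fun y => Real.sin (θs y) ^ 2 / y ^ (2 * n)) (𝓝[>] 0)
        (𝓝 (-(4 * n * a / beta₁ V W))) ∧
      StrictMonoOn θs (Ioo 0 y₁) ∧ ∀ θ ∈ Ioo 0 θ₂, ∃ y ∈ Ioo 0 y₁, θs y = θ := by
  have hΩ := inPhaseFreq_pos h.isLocalMode.pos_V h.isLocalMode.pos_W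
  have hβ := beta₁_pos h.isLocalMode.pos_V h.isLocalMode.pos_W
  have hsin := (inPhase_cos_sin h.isLocalMode.pos_V h.isLocalMode.pos_W).2.2
  have hpi := Real.pi_pos
  have hn0 : (0 : ℝ) < n := by exact_mod_cast hn
  set b := inPhaseFreq V W * Real.sin (inPhaseFreq V W * Real.pi) with hb
  have hb0 : 0 < b := mul_pos hΩ hsin
  set β := beta₁ V W with hβd
  have hκ0 : -(b * (Real.pi * β / 2)) < 0 := by
    have : 0 < b * (Real.pi * β / 2) := by positivity
    linarith
  have hc : 0 < -b * (2 * n * a * Real.pi) := by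
    have : 0 < b * (2 * n * -a * Real.pi) := by
      have := neg_pos.2 ha0
      positivity
    linarith
  obtain ⟨y₁, θ₁, θs, hy₁, hy₁s, hθ₁, hθ₁s, hmem, hzero, hanti, hlim, hmono, θ₂, hθ₂, hsurj⟩ :=
    exists_transition_curve (m := 2 * n) h.pos hκ0 hc (by omega) h.smooth_det.1
      (fun θ hθ y hy => (h.even_det hθ hy).1) h.tendsto_det.1
      (isLittleO_pow_iff_tendsto_div.2 (h.tendsto_detC hn ha))
  obtain ⟨r₁, hr₁, hr₁s, hreg⟩ := h.exists_stability_region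
  have hmin : 0 < min (min y₁ r₁) c := lt_min (lt_min hy₁ hr₁) hc0
  set z := min (min y₁ r₁) c with hz
  have hzy : z ≤ y₁ := (min_le_left _ _).trans (min_le_left _ _)
  have hzr : z ≤ r₁ := (min_le_left _ _).trans (min_le_right _ _)
  have hhalf : z / 2 ∈ Ioo 0 y₁ := ⟨by linarith, by linarith⟩
  have hsub : Ioo 0 z ⊆ Ioo 0 y₁ := Ioo_subset_Ioo le_rfl hzy
  have hs1 := h.le_one
  -- Heights below `θs (z / 2)` are attained at amplitudes below `z / 2` by monotonicity, so the
  -- curve still covers them after the range of `y` is shrunk to `z`.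
  refine ⟨z, min θ₁ r₁, min θ₂ (θs (z / 2)), θs, hmin, min_le_right _ _,
    hzr.trans (hr₁s.trans h.le_radius), lt_min hθ₁ hr₁, (min_le_left _ _).trans (hθ₁s.trans hs1),
    lt_min hθ₂ (hmem _ hhalf).1, fun y hy => ?_, fun y hy θ hθ => ?_, ?_, hmono.mono hsub,
    fun θ hθ => ?_⟩
  · have := hmem y (hsub hy)
    exact ⟨this.1, by linarith [this.2]⟩
  · have hyy := hsub hy
    obtain ⟨g1, g2, g3⟩ := hreg y ⟨hy.1, hy.2.trans_le hzr⟩ θ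
      ⟨hθ.1, hθ.2.trans_le (min_le_right _ _)⟩
    have m1 : θ ∈ Ico 0 θ₁ := ⟨hθ.1, hθ.2.trans_le (min_le_left _ _)⟩
    have m2 : θs y ∈ Ico 0 θ₁ := ⟨(hmem y hyy).1.le, (hmem y hyy).2⟩
    have hz0 := hzero y hyy
    refine ⟨?_, fun h0 hlt => g3 h0 ?_, fun h0 hlt => g2 h0 ?_⟩
    · rw [g1]
      exact ⟨fun he => (hanti y hyy).injOn m1 m2 (he.trans hz0.symm), fun he => he ▸ hz0⟩
    · have := hanti y hyy m1 m2 hlt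
      simp only [hz0] at this
      exact this
    · have := hanti y hyy m2 m1 hlt
      simp only [hz0] at this
      exact this
  · have e : -(-b * (2 * n * a * Real.pi)) / -(b * (Real.pi * β / 2)) = -(4 * n * a / β) := by
      field_simp
      ring
    rw [e] at hlim
    have h2 := isLittleO_pow_iff_tendsto_div.1 hlim
    have hy0 : Tendsto (fun y : ℝ => y ^ (2 * n)) (𝓝[>] 0) (𝓝 0) := by
      have := (continuous_pow (M := ℝ) (2 * n)).tendsto 0
      rw [zero_pow (by omega)] at this
      exact this.mono_left nhdsWithin_le_nhds
    have hpos : ∀ᶠ y in 𝓝[>] 0, y ∈ Ioo 0 y₁ := Ioo_mem_nhdsGT hy₁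
    have hθ2 : Tendsto (fun y => θs y ^ 2) (𝓝[>] 0) (𝓝 0) := by
      have := h2.mul hy0
      rw [mul_zero] at this
      refine this.congr' (hpos.mono fun y hy => ?_)
      exact div_mul_cancel₀ _ (pow_ne_zero _ hy.1.ne')
    have hθ0 : Tendsto θs (𝓝[>] 0) (𝓝[>] 0) := by
      refine tendsto_nhdsWithin_iff.2 ⟨?_, hpos.mono fun y hy => (hmem y hy).1⟩
      have := (Real.continuous_sqrt.tendsto 0).comp hθ2
      rw [Real.sqrt_zero] at this
      exact this.congr' (hpos.mono fun y hy => Real.sqrt_sq (hmem y hy).1.le)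
    have hsx := (tendsto_div_of_hasDerivAt (Real.hasDerivAt_sin 0) Real.sin_zero).comp hθ0
    rw [Real.cos_zero] at hsx
    have := (hsx.pow 2).mul h2
    rw [one_pow, one_mul] at this
    refine this.congr' (hpos.mono fun y hy => ?_)
    have := (hmem y hy).1.ne'
    have := hy.1.ne'
    simp only [Function.comp]
    field_simp
  · obtain ⟨y, hy, rfl⟩ := hsurj θ ⟨hθ.1, hθ.2.trans_le (min_le_left _ _)⟩
    have := (hmono.lt_iff_lt hy hhalf).1 (hθ.2.trans_le (min_le_right _ _))
    exact ⟨y, ⟨hy.1, by linarith⟩, rfl⟩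

/-- For a soft mode (`a > 0`) there is no transition. -/
theorem IsMonodromyRange.exists_stable (h : IsMonodromyRange V W Q₀ Qπ T ρ r R s) (hn : 1 ≤ n)
    (ha : Tendsto (fun y => (T y - 1) / y ^ (2 * n)) (𝓝[>] 0) (𝓝 a)) (ha0 : 0 < a) :
    ∃ y₁ > 0, y₁ ≤ r ∧ y₁ ≤ 1 ∧ ∀ y ∈ Ioo 0 y₁, ∀ θ ∈ Ico 0 y₁,
      ¬ HasSymmetricPeriodicSolution V W Q₀ Qπ T (4 * Real.sin θ ^ 2) y ∧
      (0 < θ → IsStable V W Q₀ Qπ T (4 * Real.sin θ ^ 2) y) := by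
  have hΩ := inPhaseFreq_pos h.isLocalMode.pos_V h.isLocalMode.pos_W
  have hβ := beta₁_pos h.isLocalMode.pos_V h.isLocalMode.pos_W
  have hsin := (inPhase_cos_sin h.isLocalMode.pos_V h.isLocalMode.pos_W).2.2
  have hpi := Real.pi_pos
  have hn0 : (0 : ℝ) < n := by exact_mod_cast hn
  have hlim := h.tendsto_detC hn ha
  have hκ := h.tendsto_det.1
  set b := inPhaseFreq V W * Real.sin (inPhaseFreq V W * Real.pi) with hb
  have hb0 : 0 < b := mul_pos hΩ hsin
  set κ := b * (Real.pi * beta₁ V W / 2) with hκd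
  have hκ0 : 0 < κ := by positivity
  obtain ⟨r', hr', hr's, hA⟩ := (even_family_expansion h.pos h.smooth_det.1
    (fun θ hθ y hy => (h.even_det hθ hy).1) hκ).1 (κ / 2) (by linarith)
  obtain ⟨r₁, hr₁, hr₁s, hreg⟩ := h.exists_stability_region
  have hev := hlim.eventually_lt_const (u := 0) (by
    have : 0 < b * (2 * n * a * Real.pi) := by positivity
    linarith)
  obtain ⟨u, hu, hsub⟩ := mem_nhdsGT_iff_exists_Ioo_subset.1 hev
  have hu0 : (0 : ℝ) < u := hu
  have hs1 := h.le_one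
  refine ⟨min (min r' r₁) u, lt_min (lt_min hr' hr₁) hu,
    ((min_le_left _ _).trans (min_le_right _ _)).trans (hr₁s.trans h.le_radius),
    ((min_le_left _ _).trans (min_le_right _ _)).trans (hr₁s.trans hs1), fun y hy θ hθ => ?_⟩
  have hr'm : min (min r' r₁) u ≤ r' := (min_le_left _ _).trans (min_le_left _ _)
  have hr₁m : min (min r' r₁) u ≤ r₁ := (min_le_left _ _).trans (min_le_right _ _)
  have hD0 : detC V W Q₀ Qπ T 0 y < 0 := by
    have h1 := hsub ⟨hy.1, hy.2.trans_le (min_le_right _ _)⟩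
    exact (div_neg_iff.1 h1).elim (fun h2 => absurd h2.2 (pow_pos hy.1 _).not_gt) fun h2 => h2.1
  -- For `a > 0` both leading terms of `det C` are negative, so it never vanishes.
  have hD : detC V W Q₀ Qπ T θ y < 0 := by
    have h1 := hA y ⟨by linarith [hy.1], hy.2.trans_le hr'm⟩ 0 θ le_rfl hθ.1
      (hθ.2.trans_le hr'm)
    have h2 := (abs_le.1 h1).2
    have := mul_nonneg hκ0.le (sq_nonneg θ)
    nlinarith
  obtain ⟨g1, g2, -⟩ := hreg y ⟨hy.1, hy.2.trans_le hr₁m⟩ θ ⟨hθ.1, hθ.2.trans_le hr₁m⟩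
  exact ⟨fun hs => hD.ne (g1.1 hs), fun h0 => g2 h0 hD⟩

theorem strictMonoOn_four_sin_sq : StrictMonoOn (fun θ => 4 * Real.sin θ ^ 2) (Icc 0 1) := by
  intro x hx y hy hxy
  have hpi := Real.pi_gt_three
  have h1 : Real.sin x < Real.sin y := Real.sin_lt_sin_of_lt_of_le_pi_div_two (by linarith [hx.1])
    (by linarith [hy.2]) hxy
  have h0 : 0 ≤ Real.sin x := Real.sin_nonneg_of_nonneg_of_le_pi hx.1 (by linarith [hx.2])
  have := pow_lt_pow_left₀ h1 h0 two_ne_zero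
  simp only
  linarith

theorem exists_four_sin_sq {θ₁ δ : ℝ} (h0 : 0 < θ₁)
    (hδ : δ ∈ Ico 0 (4 * Real.sin θ₁ ^ 2)) :
    ∃ θ ∈ Ico 0 θ₁, δ = 4 * Real.sin θ ^ 2 ∧ (0 < δ → 0 < θ) := by
  have hc : ContinuousOn (fun θ => 4 * Real.sin θ ^ 2) (Icc 0 θ₁) := by fun_prop
  have := intermediate_value_Ico h0.le hc
  obtain ⟨θ, hθ, rfl⟩ := this (by simpa using hδ)
  refine ⟨θ, hθ, rfl, fun hp => hθ.1.lt_of_ne ?_⟩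
  rintro rfl
  simp at hp

theorem four_sin_sq_bounds {θ₁ : ℝ} (h0 : 0 < θ₁) (h1 : θ₁ ≤ 1) :
    0 < 4 * Real.sin θ₁ ^ 2 ∧ 4 * Real.sin θ₁ ^ 2 ≤ 4 := by
  have h2 := Real.sin_pos_of_pos_of_lt_pi h0 (by linarith [Real.pi_gt_three])
  have h3 := Real.sin_sq_le_one θ₁
  exact ⟨by positivity, by linarith⟩

end Transition

/-! ### Energy densities and long lattices. -/

section Bifurcation

variable {V W : ℝ → ℝ} {Q₀ Qπ : ℝ → ℝ → ℝ} {T : ℝ → ℝ} {ρ r R s : ℝ} {n : ℕ} {a γ : ℝ}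

theorem pi_div_mem {N : ℕ} (hN : 2 ≤ N) : Real.pi / N ∈ Ioc 0 (Real.pi / 2) := by
  have hpi := Real.pi_pos
  have h2 : (2 : ℝ) ≤ N := by exact_mod_cast hN
  exact ⟨by positivity, div_le_div_of_nonneg_left hpi.le (by norm_num) h2⟩

/-- The equivalent forms of the leading-order bifurcation energy density. -/
theorem bifurcationEnergy_eq (hV : IsPotential V) (hW : IsPotential W) (hn : 1 ≤ n) (ha : a < 0)
    (hγ : γ = -2 * omegaSq V W * (2 / omegaSq V W) ^ n * a) (N : ℕ) :
    bifurcationEnergy W n γ N = ((linFreqSq V W Real.pi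
      - linFreqSq V W (Real.pi - 2 * Real.pi / N)) / (2 * n * γ)) ^ ((1 : ℝ) / n) ∧
    bifurcationEnergy W n γ N = omegaSq V W / 2 *
      (-(harmonicCoeff W * Real.sin (Real.pi / N) ^ 2) / (n * omegaSq V W * a))
        ^ ((1 : ℝ) / n) := by
  have hw := omegaSq_pos hV hW
  have hφ : 0 < harmonicCoeff W := hW.pos
  have hn0 : (0 : ℝ) < n := by exact_mod_cast hn
  constructor
  · rw [bifurcationEnergy]
    congr 1
    have e : (Real.pi - 2 * Real.pi / N) / 2 = Real.pi / 2 - Real.pi / N := by ring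
    rw [linFreqSq, linFreqSq, e, Real.sin_pi_div_two, Real.sin_pi_div_two_sub]
    have := Real.sin_sq_add_cos_sq (Real.pi / N)
    rw [show harmonicCoeff V + 4 * harmonicCoeff W * 1 ^ 2
      - (harmonicCoeff V + 4 * harmonicCoeff W * Real.cos (Real.pi / N) ^ 2) =
      2 * (2 * harmonicCoeff W * Real.sin (Real.pi / N) ^ 2) by
        linear_combination (-4 * harmonicCoeff W) * this, mul_assoc 2 (n : ℝ) γ,
      mul_div_mul_left _ _ two_ne_zero]
  · have hx : 0 ≤ -(harmonicCoeff W * Real.sin (Real.pi / N) ^ 2) / (n * omegaSq V W * a) :=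
      div_nonneg_of_nonpos (by have := sq_nonneg (Real.sin (Real.pi / N)); nlinarith)
        (mul_nonpos_of_nonneg_of_nonpos (by positivity) ha.le)
    have e : 2 * harmonicCoeff W * Real.sin (Real.pi / N) ^ 2 / (n * γ) = (omegaSq V W / 2) ^ n *
        (-(harmonicCoeff W * Real.sin (Real.pi / N) ^ 2) / (n * omegaSq V W * a)) := by
      rw [hγ, div_pow, div_pow]
      have := ha.ne
      have := pow_ne_zero n hw.ne'
      field_simp
    rw [bifurcationEnergy, e, Real.mul_rpow (by positivity) hx, one_div,
      Real.pow_rpow_inv_natCast (by positivity) (by omega)]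

theorem pos_iff_periodCoeff_neg (hw : 0 < omegaSq V W)
    (hγ : γ = -2 * omegaSq V W * (2 / omegaSq V W) ^ n * a) : (0 < γ ↔ a < 0) ∧ (γ < 0 ↔ 0 < a) := by
  have hk : 0 < 2 * omegaSq V W * (2 / omegaSq V W) ^ n := by positivity
  have e : γ = -(2 * omegaSq V W * (2 / omegaSq V W) ^ n * a) := by rw [hγ]; ring
  rw [e]
  constructor
  · rw [neg_pos]
    exact ⟨fun h => neg_of_mul_neg_right h hk.le, fun h => mul_neg_of_pos_of_neg hk h⟩
  · rw [neg_lt_zero, mul_pos_iff_of_pos_left hk]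

/-- The ratio of the energy density on the transition curve to the leading-order value. -/
theorem IsLocalMode.tendsto_energy_ratio (h : IsLocalMode V W Q₀ Qπ T ρ r R) (hn : 1 ≤ n)
    (ha : a < 0) (hγ : γ = -2 * omegaSq V W * (2 / omegaSq V W) ^ n * a) {θs : ℝ → ℝ}
    (hθ : Tendsto (fun y => Real.sin (θs y) ^ 2 / y ^ (2 * n)) (𝓝[>] 0)
      (𝓝 (-(4 * n * a / beta₁ V W)))) :
    Tendsto (fun y => energyDensity V W Q₀ Qπ T y /
      (2 * harmonicCoeff W * Real.sin (θs y) ^ 2 / (n * γ)) ^ ((1 : ℝ) / n)) (𝓝[>] 0) (𝓝 1) := by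
  have hw := omegaSq_pos h.pos_V h.pos_W
  have hφ : 0 < harmonicCoeff W := h.pos_W.pos
  have hβ := beta₁_pos h.pos_V h.pos_W
  have hn0 : (0 : ℝ) < n := by exact_mod_cast hn
  have hγ0 : 0 < γ := (pos_iff_periodCoeff_neg hw hγ).1.2 ha
  obtain ⟨y₁, hy₁, -, -, hpos⟩ := h.exists_strictMonoOn_energy
  -- The ratio of `n`-th powers tends to `1`; the root `1/n` is taken afterwards.
  have h1 := (h.tendsto_energy.pow n).div ((hθ.const_mul (2 * harmonicCoeff W)).div_const (n * γ))
    (by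
      have := ha.ne
      have := hβ.ne'
      have := hφ.ne'
      have := hγ0.ne'
      have := hn0.ne'
      have := hw.ne'
      simp [*])
  have e : (omegaSq V W / 2) ^ n / (2 * harmonicCoeff W * -(4 * n * a / beta₁ V W) / (n * γ)) =
      1 := by
    rw [hγ, beta₁, div_pow, div_pow]
    have := ha.ne
    have := pow_ne_zero n hw.ne'
    field_simp
  rw [e] at h1
  have h2 := h1.rpow_const (p := (1 : ℝ) / n) (Or.inl one_ne_zero)
  rw [Real.one_rpow] at h2
  refine h2.congr' ?_
  filter_upwards [Ioo_mem_nhdsGT hy₁] with y hy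
  have hy0 := pow_pos hy.1 (2 * n)
  have hε := hpos y hy
  have e2 : (energyDensity V W Q₀ Qπ T y / y ^ 2) ^ n /
      (2 * harmonicCoeff W * (Real.sin (θs y) ^ 2 / y ^ (2 * n)) / (n * γ)) =
      energyDensity V W Q₀ Qπ T y ^ n / (2 * harmonicCoeff W * Real.sin (θs y) ^ 2 / (n * γ)) := by
    rw [div_pow, ← pow_mul]
    rcases eq_or_ne (Real.sin (θs y)) 0 with hz | hz
    · simp [hz]
    · have := hy0.ne'
      field_simp
  simp only [Pi.div_apply]
  rw [e2, Real.div_rpow (by positivity) (by positivity), one_div,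
    Real.pow_rpow_inv_natCast hε.le (by omega)]

/-- The bifurcation of a hard mode in long lattices. -/
theorem IsMonodromyRange.exists_bifurcation (h : IsMonodromyRange V W Q₀ Qπ T ρ r R s) (hn : 1 ≤ n)
    (ha : Tendsto (fun y => (T y - 1) / y ^ (2 * n)) (𝓝[>] 0) (𝓝 a)) (ha0 : a < 0)
    (hγ : γ = -2 * omegaSq V W * (2 / omegaSq V W) ^ n * a) :
    ∃ y₁ : ℝ, ∃ N₀ : ℕ, ∃ εb : ℕ → ℝ, 0 < y₁ ∧ y₁ ≤ r ∧
      (∀ N : ℕ, N₀ ≤ N → 0 < εb N ∧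
        (∃ y ∈ Ioo 0 y₁, energyDensity V W Q₀ Qπ T y = εb N) ∧
        ∀ y ∈ Ioo 0 y₁,
          (HasSymmetricPeriodicSolution V W Q₀ Qπ T (latticeDelta N) y ↔
            energyDensity V W Q₀ Qπ T y = εb N) ∧
          (energyDensity V W Q₀ Qπ T y < εb N → IsStable V W Q₀ Qπ T (latticeDelta N) y) ∧
          (εb N < energyDensity V W Q₀ Qπ T y → ¬ IsStable V W Q₀ Qπ T (latticeDelta N) y)) ∧
      Tendsto (fun N : ℕ => εb N / bifurcationEnergy W n γ N) atTop (𝓝 1) := by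
  obtain ⟨c, hc, -, hmonoE, hposE⟩ := h.isLocalMode.exists_strictMonoOn_energy
  obtain ⟨y₁, θ₁, θ₂, θs, hy₁, hy₁c, hy₁r, hθ₁, -, hθ₂, hmem, hiff, hlim, hmono, hsurj⟩ :=
    h.exists_curve hn ha ha0 hc
  have hsub : Ioo 0 y₁ ⊆ Ioo 0 c := Ioo_subset_Ioo le_rfl hy₁c
  have hmonoE' := hmonoE.mono hsub
  have hpiN : Tendsto (fun N : ℕ => Real.pi / N) atTop (𝓝 0) := tendsto_const_div_atTop_nhds_zero_nat _
  obtain ⟨N₀, hN₀⟩ := eventually_atTop.1 ((hpiN.eventually_lt_const (lt_min hθ₁ hθ₂)).and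
    (eventually_ge_atTop 2))
  -- The bifurcation amplitude is the point of the curve at height `θ = π / N`. For `N < N₀` the
  -- value is an irrelevant `0`.
  have hex : ∀ N : ℕ, ∃ y, N₀ ≤ N → y ∈ Ioo 0 y₁ ∧ θs y = Real.pi / N := by
    intro N
    by_cases hN : N₀ ≤ N
    · obtain ⟨g1, g2⟩ := hN₀ N hN
      obtain ⟨y, hy, hyN⟩ := hsurj (Real.pi / N) ⟨(pi_div_mem g2).1, g1.trans_le (min_le_right _ _)⟩
      exact ⟨y, fun _ => ⟨hy, hyN⟩⟩
    · exact ⟨0, fun h => absurd h hN⟩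
  choose yb hyb using hex
  -- No inverse function is needed: once `π / N` falls below `θs` at a given amplitude, monotonicity
  -- puts `yb N` below it.
  have hyb0 : Tendsto yb atTop (𝓝[>] 0) := by
    refine tendsto_nhdsWithin_iff.2 ⟨?_, eventually_atTop.2 ⟨N₀, fun N hN => (hyb N hN).1.1⟩⟩
    refine Metric.tendsto_atTop'.2 fun η hη => ?_
    have hη' : min η y₁ / 2 ∈ Ioo 0 y₁ := by
      have h1 := lt_min hη hy₁
      have h2 := min_le_right η y₁
      exact ⟨by linarith, by linarith⟩
    obtain ⟨N₁, hN₁⟩ := eventually_atTop.1 (hpiN.eventually_lt_const (hmem _ hη').1)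
    refine ⟨max N₀ N₁, fun N hN => ?_⟩
    obtain ⟨g1, g2⟩ := hyb N ((le_max_left _ _).trans hN.le)
    have g3 := hN₁ N ((le_max_right _ _).trans hN.le)
    rw [← g2] at g3
    have g4 := (hmono.lt_iff_lt g1 hη').1 g3
    rw [Real.dist_eq, sub_zero, abs_of_pos g1.1]
    have h1 := lt_min hη hy₁
    have := min_le_left η y₁
    linarith
  refine ⟨y₁, N₀, fun N => energyDensity V W Q₀ Qπ T (yb N), hy₁, hy₁r, fun N hN => ?_, ?_⟩
  · obtain ⟨g1, g2⟩ := hyb N hN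
    obtain ⟨k1, k2⟩ := hN₀ N hN
    have hp := (pi_div_mem k2).1
    refine ⟨hposE _ (hsub g1), ⟨yb N, g1, rfl⟩, fun y hy => ?_⟩
    obtain ⟨i1, i2, i3⟩ := hiff y hy (Real.pi / N) ⟨hp.le, k1.trans_le (min_le_left _ _)⟩
    rw [← g2] at i1 i2 i3 hp
    rw [latticeDelta, ← g2]
    refine ⟨?_, fun hlt => i3 hp ?_, fun hlt => i2 hp ?_⟩
    · rw [i1, hmono.injOn.eq_iff g1 hy, hmonoE'.injOn.eq_iff hy g1, eq_comm]
    · exact hmono hy g1 ((hmonoE'.lt_iff_lt hy g1).1 hlt)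
    · exact hmono g1 hy ((hmonoE'.lt_iff_lt g1 hy).1 hlt)
  · have := (h.isLocalMode.tendsto_energy_ratio hn ha0 hγ hlim).comp hyb0
    refine this.congr' (eventually_atTop.2 ⟨N₀, fun N hN => ?_⟩)
    simp only [Function.comp, (hyb N hN).2, bifurcationEnergy]

/-- For `a < 0` the curve is transported from `θ` to `δ = 4 sin² θ`. For `a > 0` the leading term
itself serves as `δs`: it is negative, so no admissible `δ` meets it or lies below it. -/
theorem IsMonodromyRange.exists_transition (h : IsMonodromyRange V W Q₀ Qπ T ρ r R s) (hn : 1 ≤ n)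
    (ha : Tendsto (fun y => (T y - 1) / y ^ (2 * n)) (𝓝[>] 0) (𝓝 a)) (ha0 : a ≠ 0) :
    ∃ y₁ δ₁ : ℝ, ∃ δs : ℝ → ℝ, 0 < y₁ ∧ y₁ ≤ r ∧ 0 < δ₁ ∧ δ₁ ≤ 4 ∧
      ((fun y => δs y - -(16 * n * a * y ^ (2 * n) / beta₁ V W))
        =o[𝓝[>] 0] (fun y : ℝ => y ^ (2 * n))) ∧
      ∀ y ∈ Ioo 0 y₁, ∀ δ ∈ Ico 0 δ₁,
        (HasSymmetricPeriodicSolution V W Q₀ Qπ T δ y ↔ δ = δs y) ∧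
        (0 < δ → δ < δs y → ¬ IsStable V W Q₀ Qπ T δ y) ∧
        (0 < δ → δs y < δ → IsStable V W Q₀ Qπ T δ y) := by
  have hβ := beta₁_pos h.isLocalMode.pos_V h.isLocalMode.pos_W
  have hn0 : (0 : ℝ) < n := by exact_mod_cast hn
  rcases lt_or_gt_of_ne ha0 with hneg | hpos
  · obtain ⟨y₁, θ₁, -, θs, hy₁, -, hy₁r, hθ₁, hθ₁1, -, hmem, hiff, hlim, -⟩ :=
      h.exists_curve hn ha hneg one_pos
    obtain ⟨b1, b2⟩ := four_sin_sq_bounds hθ₁ hθ₁1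
    refine ⟨y₁, 4 * Real.sin θ₁ ^ 2, fun y => 4 * Real.sin (θs y) ^ 2, hy₁, hy₁r, b1, b2, ?_,
      fun y hy δ hδ => ?_⟩
    · have h1 := isLittleO_pow_iff_tendsto_div.2 (hlim.const_mul 4 |>.congr fun y =>
        (mul_div_assoc 4 (Real.sin (θs y) ^ 2) (y ^ (2 * n))).symm)
      refine h1.congr_left fun y => ?_
      ring
    · obtain ⟨θ, hθ, rfl, hθ0⟩ := exists_four_sin_sq hθ₁ hδ
      obtain ⟨i1, i2, i3⟩ := hiff y hy θ hθ
      have m1 : θ ∈ Icc (0 : ℝ) 1 := ⟨hθ.1, hθ.2.le.trans hθ₁1⟩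
      have m2 : θs y ∈ Icc (0 : ℝ) 1 := ⟨(hmem y hy).1.le, (hmem y hy).2⟩
      have hm := strictMonoOn_four_sin_sq
      exact ⟨i1.trans (hm.injOn.eq_iff m1 m2).symm,
        fun h0 hlt => i2 (hθ0 h0) ((hm.lt_iff_lt m1 m2).1 hlt),
        fun h0 hlt => i3 (hθ0 h0) ((hm.lt_iff_lt m2 m1).1 hlt)⟩
  · obtain ⟨y₁, hy₁, hy₁r, hy₁1, hst⟩ := h.exists_stable hn ha hpos
    obtain ⟨b1, b2⟩ := four_sin_sq_bounds hy₁ hy₁1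
    refine ⟨y₁, 4 * Real.sin y₁ ^ 2, fun y => -(16 * n * a * y ^ (2 * n) / beta₁ V W), hy₁, hy₁r,
      b1, b2, ?_, fun y hy δ hδ => ?_⟩
    · simp only [sub_self]
      exact isLittleO_zero _ _
    · have hy0 := pow_pos hy.1 (2 * n)
      have hlt : -(16 * n * a * y ^ (2 * n) / beta₁ V W) < 0 := by
        have : 0 < 16 * n * a * y ^ (2 * n) / beta₁ V W := by positivity
        linarith
      have hδ0 := hδ.1
      obtain ⟨θ, hθ, rfl, hθ0⟩ := exists_four_sin_sq hy₁ hδ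
      obtain ⟨i1, i2⟩ := hst y hy θ hθ
      exact ⟨⟨fun hs => absurd hs i1, fun he => by linarith⟩, fun _ h2 => by linarith,
        fun h0 _ => i2 (hθ0 h0)⟩

end Bifurcation

end OutOfPhaseMode

/-! ### Assembly of the theorem. -/

theorem mainTheorem4 (V W : ℝ → ℝ)
    (hV : OutOfPhaseMode.IsPotential V) (hW : OutOfPhaseMode.IsPotential W)
    (Q₀ Qπ : ℝ → ℝ → ℝ) (T : ℝ → ℝ) (ρ : ℝ)
    (hmode : OutOfPhaseMode.IsMode V W Q₀ Qπ T ρ)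
    (n : ℕ) (γ : ℝ)
    (hiso : OutOfPhaseMode.IsochronousUpTo V W Q₀ Qπ T n γ) :
    -- expansion of the period, and the relation between its coefficient and `γ`
    ((fun y => T y - (1 + OutOfPhaseMode.periodCoeff T n * y ^ (2 * n)))
        =o[𝓝[>] 0] (fun y : ℝ => y ^ (2 * n))) ∧
    γ = -2 * OutOfPhaseMode.omegaSq V W * (2 / OutOfPhaseMode.omegaSq V W) ^ n
      * OutOfPhaseMode.periodCoeff T n ∧
    -- the second transition curve `δ = δs y`
    (∃ y₁ δ₁ : ℝ, ∃ δs : ℝ → ℝ, 0 < y₁ ∧ y₁ ≤ ρ ∧ 0 < δ₁ ∧ δ₁ ≤ 4 ∧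
      ((fun y => δs y - -(16 * n * OutOfPhaseMode.periodCoeff T n * y ^ (2 * n)
          / OutOfPhaseMode.beta₁ V W)) =o[𝓝[>] 0] (fun y : ℝ => y ^ (2 * n))) ∧
      ∀ y ∈ Ioo 0 y₁, ∀ δ ∈ Ico 0 δ₁,
        (OutOfPhaseMode.HasSymmetricPeriodicSolution V W Q₀ Qπ T δ y ↔ δ = δs y) ∧
        (0 < δ → δ < δs y → ¬ OutOfPhaseMode.IsStable V W Q₀ Qπ T δ y) ∧
        (0 < δ → δs y < δ → OutOfPhaseMode.IsStable V W Q₀ Qπ T δ y)) ∧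
    -- for `γ > 0` the mode bifurcates, at the energy density `εb N` in the lattice of `N` sites
    (0 < γ →
      (∃ y₁ : ℝ, ∃ N₀ : ℕ, ∃ εb : ℕ → ℝ, 0 < y₁ ∧ y₁ ≤ ρ ∧
        (∀ N : ℕ, N₀ ≤ N → Even N →
          0 < εb N ∧
          (∃ y ∈ Ioo 0 y₁, OutOfPhaseMode.energyDensity V W Q₀ Qπ T y = εb N) ∧
          ∀ y ∈ Ioo 0 y₁,
            (OutOfPhaseMode.HasSymmetricPeriodicSolution V W Q₀ Qπ T
                (OutOfPhaseMode.latticeDelta N) y ↔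
              OutOfPhaseMode.energyDensity V W Q₀ Qπ T y = εb N) ∧
            (OutOfPhaseMode.energyDensity V W Q₀ Qπ T y < εb N →
              OutOfPhaseMode.IsStable V W Q₀ Qπ T (OutOfPhaseMode.latticeDelta N) y) ∧
            (εb N < OutOfPhaseMode.energyDensity V W Q₀ Qπ T y →
              ¬ OutOfPhaseMode.IsStable V W Q₀ Qπ T (OutOfPhaseMode.latticeDelta N) y)) ∧
        Tendsto (fun N : ℕ => εb N / OutOfPhaseMode.bifurcationEnergy W n γ N)
          (atTop ⊓ 𝓟 {N : ℕ | Even N}) (𝓝 1)) ∧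
      -- the other two forms of the leading-order bifurcation energy density
      (∀ N : ℕ, 2 ≤ N →
        OutOfPhaseMode.bifurcationEnergy W n γ N =
          ((OutOfPhaseMode.linFreqSq V W Real.pi
            - OutOfPhaseMode.linFreqSq V W (Real.pi - 2 * Real.pi / N)) / (2 * n * γ))
            ^ ((1 : ℝ) / n) ∧
        OutOfPhaseMode.bifurcationEnergy W n γ N =
          OutOfPhaseMode.omegaSq V W / 2 *
            (-(OutOfPhaseMode.harmonicCoeff W * Real.sin (Real.pi / N) ^ 2)
              / (n * OutOfPhaseMode.omegaSq V W * OutOfPhaseMode.periodCoeff T n))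
              ^ ((1 : ℝ) / n))) ∧
    -- for `γ < 0` there is no bifurcation
    (γ < 0 → ∃ y₁ : ℝ, ∃ N₀ : ℕ, 0 < y₁ ∧ y₁ ≤ ρ ∧
      ∀ N : ℕ, N₀ ≤ N → Even N → ∀ y ∈ Ioo 0 y₁,
        ¬ OutOfPhaseMode.HasSymmetricPeriodicSolution V W Q₀ Qπ T
            (OutOfPhaseMode.latticeDelta N) y ∧
        OutOfPhaseMode.IsStable V W Q₀ Qπ T (OutOfPhaseMode.latticeDelta N) y) := by
  obtain ⟨r, R, h⟩ := hmode.exists_isLocalMode hV hW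
  obtain ⟨s, hs, hsr, hs1, hF, hM⟩ := h.exists_smooth_monodromy
  have hR : OutOfPhaseMode.IsMonodromyRange V W Q₀ Qπ T ρ r R s := ⟨h, hs, hsr, hs1, hF, hM⟩
  have hn := hiso.order_pos
  have hω := OutOfPhaseMode.omegaSq_pos hV hW
  have hrρ := h.radius_le
  obtain ⟨hT, hγ⟩ := h.period_expansion hiso
  obtain ⟨hpos, hneg⟩ := OutOfPhaseMode.pos_iff_periodCoeff_neg hω hγ
  have ha0 : OutOfPhaseMode.periodCoeff T n ≠ 0 := by
    intro h0
    rw [h0, mul_zero] at hγ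
    exact hiso.coeff_ne_zero hγ
  refine ⟨?_, hγ, ?_, fun hγ0 => ⟨?_, fun N _ => ?_⟩, fun hγ0 => ?_⟩
  · exact (OutOfPhaseMode.isLittleO_pow_iff_tendsto_div.2 hT).congr_left fun y => by ring
  · obtain ⟨y₁, δ₁, δs, h1, h2, h3⟩ := hR.exists_transition hn hT ha0
    exact ⟨y₁, δ₁, δs, h1, h2.trans hrρ, h3⟩
  · obtain ⟨y₁, N₀, εb, h1, h2, h3, h4⟩ := hR.exists_bifurcation hn hT (hpos.1 hγ0) hγ
    exact ⟨y₁, N₀, εb, h1, h2.trans hrρ, fun N hN _ => h3 N hN, h4.mono_left inf_le_left⟩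
  · exact OutOfPhaseMode.bifurcationEnergy_eq hV hW hn (hpos.1 hγ0) hγ N
  · obtain ⟨y₁, h1, h2, -, h3⟩ := hR.exists_stable hn hT (hneg.1 hγ0)
    obtain ⟨N₀, hN₀⟩ := eventually_atTop.1
      (((tendsto_const_div_atTop_nhds_zero_nat Real.pi).eventually_lt_const h1).and
        (eventually_ge_atTop 2))
    refine ⟨y₁, N₀, h1, h2.trans hrρ, fun N hN _ y hy => ?_⟩
    obtain ⟨k1, k2⟩ := hN₀ N hN
    have hp := (OutOfPhaseMode.pi_div_mem k2).1
    obtain ⟨g1, g2⟩ := h3 y hy (Real.pi / N) ⟨hp.le, k1⟩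
    exact ⟨g1, g2 hp⟩
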